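/- \textbf{Setting.} Let $\mathcal T\subset\mathbb R^2$ be a compact convex set with nonempty interior and perimeter $L$, let $\gamma:\mathbb R\to\partial\mathcal T$ be the $L$-periodic counter-clockwise (ccw) arc-length parametrization of its boundary (corners are allowed), and let $0<\nu\le 1$. A defender moves on $\partial\mathcal T$, $\dot s_D=\omega_D$ with $|\omega_D|\le 1$; an intruder moves in the plane, $\dot{\mathbf x}_A=\mathbf u_A$ with $\|\mathbf u_A\|\le\nu$, and starts outside $\mathcal T$. Write $\ell(a,b)=(b-a)\bmod L\in[0,L)$ for the ccw arc length from $a$ to $b$. \textbf{Breaching points.} For $\mathbf x\notin\mathcal T$ let $\mathcal S_d(\mathbf x)$ be the set of $s$ such that the open segment from $\mathbf x$ to $\gamma(s)$ does not meet $\mathcal T$. With $$J_L(s;s_D,\mathbf x)=\ell(s_D,s)-\tfrac1\nu\|\gamma(s)-\mathbf x\|,\qquad J_R(s;s_D,\mathbf x)=\ell(s,s_D)-\tfrac1\nu\|\gamma(s)-\mathbf x\|,$$ the left breaching point $s_L=s_L(\mathbf x)\in\mathcal S_d$ is the maximizer of $J_L(\cdot\,;s_D,\mathbf x)$ on $\mathcal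 S_d(\mathbf x)$ for $s_D\notin\mathcal S_d(\mathbf x)$ (it does not depend on $s_D$), and $s_R=s_R(\mathbf x)$ is the one of $J_R$. For every $s_D$ put $J_L^*(s_D,\mathbf x)=J_L(s_L;s_D,\mathbf x)$ and $J_R^*(s_D,\mathbf x)=J_R(s_R;s_D,\mathbf x)$. \textbf{Regions, value function, strategies.} $\mathbf x$ is in the left region $\Omega_L(s_D)$ if either $s_D$ lies on the ccw segment $[s_R,s_L]$ and $J_L^*>J_R^*$, or $s_D$ does not lie on it and $J_L^*<J_R^*$. Let $$V=J_L^*,\quad \omega_D^*=1,\quad \mathbf u_A^*=\nu\,\tfrac{\gamma(s_L)-\mathbf x}{\|\gamma(s_L)-\mathbf x\|}\quad\text{on }\Omega_L(s_D),\qquad V=J_R^*,\quad \omega_D^*=-1,\quad \mathbf u_A^*=\nu\,\tfrac{\gamma(s_R)-\mathbf x}{\|\gamma(s_R)-\mathbf x\|}\quad\text{otherwise.}$$ \textbf{Game.} The payoff is the safe distance at breaching time, $P_1=\min\{\ell(s_D(t_F),s_B),\,\ell(s_B,s_D(t_F))\}$, where $t_F$ is the first time at which the intruder is in $\mathcal T$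 and $\gamma(s_B)=\mathbf x_A(t_F)$; $P_1=0$ if the intruder never reaches $\mathcal T$. The intruder maximizes and the defender minimizes $P_1$. A strategy is a map from the state $(s_D,\mathbf x_A)$ to admissible control values. It is played with a sampling period $\tau>0$: the state is read at the times $0,\tau,2\tau,\dots$ and the prescribed control is held in between, while the opponent uses an arbitrary measurable admissible control. From a given initial state, a defender strategy guarantees $c$ if for every $\varepsilon>0$ there is $\delta>0$ such that for all $\tau\in(0,\delta)$ every resulting play has $P_1\le c+\varepsilon$; an intruder strategy guarantees $c$ if in the same sense every resulting play has $P_1\ge c-\varepsilon$. \textbf{Theorem.} Suppose that $\mathbf x_A\notin\mathcal T$ and $V(s_D,\mathbf x_A)>0$, and write $V=V(s_D,\mathbf x_A)$. From the initial state $(s_D,\mathbf x_A)$: \begin{enumerate} \item $\omega_D^*$ guarantees $V$ for the defender; \item if $\nu<1$ or $\mathcal T$ is strictly convex, then $\mathbf u_A^*$ guarantees $V$ for the intruder, so that $(\omega_D^*,\mathbf u_A^*)$ is a saddle-point equilibrium: $P_1(\omega_D^*,\mathbf u_A)\le V\le P_1(\omega_D,\mathbf u_A^*)$ in the sense above; \item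 the value of the game is $V$: $V$ is the least payoff that some defender strategy guarantees, and the supremum of the payoffs that the intruder strategies guarantee (a maximum in case 2), i.e. $V=\min_{\omega_D}\max_{\mathbf u_A}P_1=\max_{\mathbf u_A}\min_{\omega_D}P_1$. \end{enumerate} -/

import Mathlib

open Set MeasureTheory

noncomputable section

namespace PerimeterDefense

/-- The plane with its Euclidean norm. -/
abbrev Plane := EuclideanSpace ℝ (Fin 2)

/-! ### Geometry of the perimeter -/

/-- `γ` is the counter-clockwise arc-length parametrization, extended `L`-periodically to `ℝ`,
of the boundary of the planar set `T`, whose perimeter is `L`.  Counter-clockwise means that `T`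
lies to the left of every tangent vector. No smoothness is required, corners are allowed. -/
structure IsPerimeter (T : Set Plane) (L : ℝ) (γ : ℝ → Plane) : Prop where
  pos : 0 < L
  periodic : Function.Periodic γ L
  injOn : InjOn γ (Ico 0 L)
  image_eq : γ '' Ico 0 L = frontier T
  unitSpeed : HasUnitSpeedOn γ univ
  ccw : ∀ (s : ℝ) (v : Plane), HasDerivAt γ v s → ∀ p ∈ T,
    0 ≤ v 0 * (p 1 - γ s 1) - v 1 * (p 0 - γ s 0)

/-- The counter-clockwise arc length from `a` to `b`, that is `(b - a) mod L`. -/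
def arc (L a b : ℝ) : ℝ := L * Int.fract ((b - a) / L)

/-- The perimeter positions that can be reached from `x` on a straight line without
crossing `T`. -/
def reachable (T : Set Plane) (γ : ℝ → Plane) (x : Plane) : Set ℝ :=
  {s | Disjoint (openSegment ℝ x (γ s)) T}

/-- `J_L(s_B; s_D, x_A)`. -/
def JL (L : ℝ) (γ : ℝ → Plane) (ν sB sD : ℝ) (x : Plane) : ℝ :=
  arc L sD sB - ‖γ sB - x‖ / ν

/-- `J_R(s_B; s_D, x_A)`. -/
def JR (L : ℝ) (γ : ℝ → Plane) (ν sB sD : ℝ) (x : Plane) : ℝ :=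
  arc L sB sD - ‖γ sB - x‖ / ν

/-- `s` is a left breaching point for `x`: it maximizes `J_L(· ; s_D, x)` over the reachable
positions, for defender positions outside the reachable part. (There `s_D` only adds a constant
to `J_L`.) -/
def IsLeftBreachingPoint (T : Set Plane) (L : ℝ) (γ : ℝ → Plane) (ν : ℝ) (x : Plane)
    (s : ℝ) : Prop :=
  s ∈ Ico 0 L ∧ s ∈ reachable T γ x ∧
    ∀ sD ∉ reachable T γ x, ∀ s' ∈ reachable T γ x, JL L γ ν s' sD x ≤ JL L γ ν s sD x

/-- The same for the right breaching point and `J_R`. -/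
def IsRightBreachingPoint (T : Set Plane) (L : ℝ) (γ : ℝ → Plane) (ν : ℝ) (x : Plane)
    (s : ℝ) : Prop :=
  s ∈ Ico 0 L ∧ s ∈ reachable T γ x ∧
    ∀ sD ∉ reachable T γ x, ∀ s' ∈ reachable T γ x, JR L γ ν s' sD x ≤ JR L γ ν s sD x

/-- The left breaching point `s_L(x)` (it exists and is unique for `x ∉ T`). -/
def sL (T : Set Plane) (L : ℝ) (γ : ℝ → Plane) (ν : ℝ) (x : Plane) : ℝ :=
  Classical.epsilon (IsLeftBreachingPoint T L γ ν x)

/-- The right breaching point `s_R(x)` (it exists and is unique for `x ∉ T`). -/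
def sR (T : Set Plane) (L : ℝ) (γ : ℝ → Plane) (ν : ℝ) (x : Plane) : ℝ :=
  Classical.epsilon (IsRightBreachingPoint T L γ ν x)

/-- `J_L^*(s_D, x)`. -/
def JLstar (T : Set Plane) (L : ℝ) (γ : ℝ → Plane) (ν sD : ℝ) (x : Plane) : ℝ :=
  JL L γ ν (sL T L γ ν x) sD x

/-- `J_R^*(s_D, x)`. -/
def JRstar (T : Set Plane) (L : ℝ) (γ : ℝ → Plane) (ν sD : ℝ) (x : Plane) : ℝ :=
  JR L γ ν (sR T L γ ν x) sD x

/-- The defender stands on the counter-clockwise segment `[s_R(x), s_L(x)]`.  The surface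
`J_L^* = J_R^*` is the afferent surface, which extends from the defender, where this holds, and
the dispersal surface, which extends from the opposite point, where this fails. -/
def DefenderInFront (T : Set Plane) (L : ℝ) (γ : ℝ → Plane) (ν sD : ℝ) (x : Plane) : Prop :=
  arc L (sR T L γ ν x) sD ≤ arc L (sR T L γ ν x) (sL T L γ ν x)

/-- `x ∈ Ω_L(s_D)`: the intruder is on the left (counter-clockwise) side of the defender, as
separated from the right side by the two singular surfaces. -/
def InLeftRegion (T : Set Plane) (L : ℝ) (γ : ℝ → Plane) (ν sD : ℝ) (x : Plane) : Prop :=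
  (DefenderInFront T L γ ν sD x ∧ JRstar T L γ ν sD x < JLstar T L γ ν sD x) ∨
  (¬ DefenderInFront T L γ ν sD x ∧ JLstar T L γ ν sD x < JRstar T L γ ν sD x)

open Classical in
/-- The function `V(s_D, x_A)`. -/
def V (T : Set Plane) (L : ℝ) (γ : ℝ → Plane) (ν sD : ℝ) (x : Plane) : ℝ :=
  if InLeftRegion T L γ ν sD x then JLstar T L γ ν sD x else JRstar T L γ ν sD x

/-! ### Feedback strategies -/

open Classical in
/-- The defender strategy `ω_D^*`. -/
def defenderStar (T : Set Plane) (L : ℝ) (γ : ℝ → Plane) (ν : ℝ) : ℝ → Plane → ℝ :=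
  fun sD x => if InLeftRegion T L γ ν sD x then 1 else -1

/-- Velocity of norm `ν` from `x` towards `y`. -/
def headTo (ν : ℝ) (x y : Plane) : Plane := ν • (‖y - x‖⁻¹ • (y - x))

open Classical in
/-- The intruder strategy `u_A^*`. -/
def intruderStar (T : Set Plane) (L : ℝ) (γ : ℝ → Plane) (ν : ℝ) : ℝ → Plane → Plane :=
  fun sD x =>
    if InLeftRegion T L γ ν sD x then headTo ν x (γ (sL T L γ ν x))
    else headTo ν x (γ (sR T L γ ν x))

/-! ### Dynamics and payoff -/

/-- Admissible defender controls. -/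
def IsDefenderControl (ω : ℝ → ℝ) : Prop := Measurable ω ∧ ∀ t, |ω t| ≤ 1

/-- Admissible intruder controls. -/
def IsIntruderControl (ν : ℝ) (u : ℝ → Plane) : Prop := Measurable u ∧ ∀ t, ‖u t‖ ≤ ν

/-- Defender position (modulo `L`) at time `t`. -/
def defenderPos (s₀ : ℝ) (ω : ℝ → ℝ) (t : ℝ) : ℝ := s₀ + ∫ r in (0 : ℝ)..t, ω r

/-- Intruder position at time `t`. -/
def intruderPos (x₀ : Plane) (u : ℝ → Plane) (t : ℝ) : Plane := x₀ + ∫ r in (0 : ℝ)..t, u r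

/-- The times at which the intruder is in the target. -/
def targetTimes (T : Set Plane) (x₀ : Plane) (u : ℝ → Plane) : Set ℝ :=
  {t | 0 ≤ t ∧ intruderPos x₀ u t ∈ T}

/-- The time at which the intruder reaches the target (if it ever does). -/
def breachTime (T : Set Plane) (x₀ : Plane) (u : ℝ → Plane) : ℝ := sInf (targetTimes T x₀ u)

/-- The arc-length position in `[0, L)` of a perimeter point. -/
def perimeterPos (L : ℝ) (γ : ℝ → Plane) (p : Plane) : ℝ :=
  Classical.epsilon fun s => s ∈ Ico 0 L ∧ γ s = p

open Classical in
/-- The payoff `P₁`: the safe distance at breaching time.  If the intruder never reaches the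
target the payoff is `0`, as in the case of a capture on the perimeter. -/
def payoff (T : Set Plane) (L : ℝ) (γ : ℝ → Plane) (s₀ : ℝ) (x₀ : Plane)
    (ω : ℝ → ℝ) (u : ℝ → Plane) : ℝ :=
  if (targetTimes T x₀ u).Nonempty then
    min
      (arc L (defenderPos s₀ ω (breachTime T x₀ u))
        (perimeterPos L γ (intruderPos x₀ u (breachTime T x₀ u))))
      (arc L (perimeterPos L γ (intruderPos x₀ u (breachTime T x₀ u)))
        (defenderPos s₀ ω (breachTime T x₀ u)))
  else 0

/-! ### Outcome of feedback strategies

The feedback laws are discontinuous and are realized in sampled form: a player reads the state at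
the times `0, τ, 2τ, …` and keeps the prescribed control in between, while the opponent uses any
measurable control; then `τ → 0`. -/

/-- The control `ω` follows the feedback strategy `σ` with sampling period `τ`. -/
def DefenderFollows (σ : ℝ → Plane → ℝ) (τ s₀ : ℝ) (x₀ : Plane)
    (ω : ℝ → ℝ) (u : ℝ → Plane) : Prop :=
  ∀ k : ℕ, ∀ t ∈ Ico (k * τ) ((k + 1) * τ),
    ω t = σ (defenderPos s₀ ω (k * τ)) (intruderPos x₀ u (k * τ))

/-- The control `u` follows the feedback strategy `μ` with sampling period `τ`. -/
def IntruderFollows (μ : ℝ → Plane → Plane) (τ s₀ : ℝ) (x₀ : Plane)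
    (ω : ℝ → ℝ) (u : ℝ → Plane) : Prop :=
  ∀ k : ℕ, ∀ t ∈ Ico (k * τ) ((k + 1) * τ),
    u t = μ (defenderPos s₀ ω (k * τ)) (intruderPos x₀ u (k * τ))

/-- `σ` is an admissible defender strategy that keeps the payoff from exceeding `c`, whatever
the intruder does, up to an error that vanishes with the sampling period. -/
def DefenderGuarantees (T : Set Plane) (L : ℝ) (γ : ℝ → Plane) (ν s₀ : ℝ) (x₀ : Plane)
    (σ : ℝ → Plane → ℝ) (c : ℝ) : Prop :=
  (∀ s x, |σ s x| ≤ 1) ∧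
  ∀ ε > 0, ∃ δ > 0, ∀ τ ∈ Ioo 0 δ, ∀ (ω : ℝ → ℝ) (u : ℝ → Plane),
    IsDefenderControl ω → IsIntruderControl ν u → DefenderFollows σ τ s₀ x₀ ω u →
      payoff T L γ s₀ x₀ ω u ≤ c + ε

/-- `μ` is an admissible intruder strategy that secures the payoff `c`, whatever the defender
does, up to an error that vanishes with the sampling period. -/
def IntruderGuarantees (T : Set Plane) (L : ℝ) (γ : ℝ → Plane) (ν s₀ : ℝ) (x₀ : Plane)
    (μ : ℝ → Plane → Plane) (c : ℝ) : Prop :=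
  (∀ s x, ‖μ s x‖ ≤ ν) ∧
  ∀ ε > 0, ∃ δ > 0, ∀ τ ∈ Ioo 0 δ, ∀ (ω : ℝ → ℝ) (u : ℝ → Plane),
    IsDefenderControl ω → IsIntruderControl ν u → IntruderFollows μ τ s₀ x₀ ω u →
      c - ε ≤ payoff T L γ s₀ x₀ ω u

end PerimeterDefense

end

/-! The planar game reduces to a pursuit on a line. Follow the metric projection of the intruder `x`
onto `T` by a continuous parameter `Θ` along the boundary. Let `disp` be the signed arc swept by the
projection along a segment, and let `pot` be the supremum of `disp` minus travel time over the
points visible from `x`. Put g = Θ + `pot` and h = Θ − `pot` of the reversed curve. Both potentials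
are nonpositive, so g ≤ h, and both vanish on `T`. In these terms the state is the defender position
s together with the L-periodic family of intervals [g + kL, h + kL].

If s lies in a gap (h, g + L), then V = min(s − h, g + L − s), and the left region tells which end
is nearer (`value_of_gap`). Conversely, V > 0 puts the defender in a gap
(`exists_gap_of_value_pos`). At the breach g = h = Θ, and this minimum is the payoff. Matching it
with the definition of V needs the fact that the segment from `x` to a breaching point makes with
`T` an angle of cosine at most ν (`inner_le_of_isBest`): otherwise a slightly earlier boundary point
would be better.

No intruder moves g or h faster than speed 1 (`pot_transport`, `IsTrack.abs_sub_le`). Heading to the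
left breaching point moves g at speed exactly 1 (`pot_of_mem_segment`), and heading to the right one
moves h at speed −1.

Defender: running at speed 1 to the nearer end keeps that distance from growing. A step changes each
distance by at most 2τ, so sampling errors do not accumulate (`exists_le_step`).

Intruder: the nearer end runs away at speed 1. The other distance is at least half of the gap length
L + `width`, and `width` = g − h does not decrease under such a heading, so again only 2τ is lost in
all (`le_step_of_heading`). The target is reached because `width` ≤ 0 gains a definite amount in
each step made far from `T`, while close to `T` the breaching point is less than one step away. The
latter needs ν < 1 or strict convexity (`exists_near`).

For ν = 1 and a general `T`, the intruder plays the strategy of a speed slightly below 1, which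
costs arbitrarily little (`exists_slower`). Guarantees of the two players are compared by letting
their strategies play each other (`IntruderGuarantees.le`). -/

namespace PerimeterDefense

variable {T : Set Plane} {L ν : ℝ} {γ : ℝ → Plane}

/-! ### Boundary curves of convex bodies -/

/-- `γ` is an `L`-periodic arc-length parametrization, of either orientation, of the boundary of
the convex body `T`. -/
structure IsBoundaryCurve (T : Set Plane) (L : ℝ) (γ : ℝ → Plane) : Prop where
  convex : Convex ℝ T
  compact : IsCompact T
  interior_nonempty : (interior T).Nonempty
  pos : 0 < L
  periodic : Function.Periodic γ L
  injOn : InjOn γ (Ico 0 L)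
  image_eq : γ '' Ico 0 L = frontier T
  unitSpeed : HasUnitSpeedOn γ univ

namespace IsBoundaryCurve

theorem nonempty (H : IsBoundaryCurve T L γ) : T.Nonempty := H.interior_nonempty.mono interior_subset

theorem isClosed (H : IsBoundaryCurve T L γ) : IsClosed T := H.compact.isClosed

theorem eVariationOn_Icc (H : IsBoundaryCurve T L γ) (a b : ℝ) :
    eVariationOn γ (Icc a b) = ENNReal.ofReal (b - a) := by
  have := H.unitSpeed (mem_univ a) (mem_univ b)
  simpa using this

theorem dist_le (H : IsBoundaryCurve T L γ) (a b : ℝ) : ‖γ a - γ b‖ ≤ |a - b| := by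
  wlog hab : a ≤ b generalizing a b
  · rw [norm_sub_rev, abs_sub_comm]; exact this b a (le_of_not_ge hab)
  have h := eVariationOn.edist_le γ (s := Icc a b) (left_mem_Icc.2 hab) (right_mem_Icc.2 hab)
  rw [H.eVariationOn_Icc, edist_dist, ENNReal.ofReal_le_ofReal_iff (by linarith),
    dist_eq_norm] at h
  rw [abs_sub_comm, abs_of_nonneg (by linarith)]; exact h

theorem lipschitz (H : IsBoundaryCurve T L γ) : LipschitzWith 1 γ :=
  LipschitzWith.of_dist_le_mul fun a b => by
    simpa [dist_eq_norm] using H.dist_le a b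

theorem continuous (H : IsBoundaryCurve T L γ) : Continuous γ := H.lipschitz.continuous

theorem apply_add_int_mul (H : IsBoundaryCurve T L γ) (s : ℝ) (k : ℤ) : γ (s + k * L) = γ s :=
  H.periodic.int_mul k s

/-- Every real number is congruent modulo `L` to one in a given half-open period. -/
theorem exists_add_int_mul_mem (H : IsBoundaryCurve T L γ) (s a : ℝ) :
    ∃ k : ℤ, s + k * L ∈ Ico a (a + L) := by
  obtain ⟨k, hk, -⟩ := existsUnique_add_zsmul_mem_Ico H.pos s a
  exact ⟨k, by simpa using hk⟩

theorem eq_iff (H : IsBoundaryCurve T L γ) {a b : ℝ} : γ a = γ b ↔ ∃ k : ℤ, b = a + k * L := by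
  constructor
  · intro h
    obtain ⟨m, hm⟩ := H.exists_add_int_mul_mem a 0
    obtain ⟨n, hn⟩ := H.exists_add_int_mul_mem b 0
    rw [zero_add] at hm hn
    have := H.injOn hm hn (by rw [H.apply_add_int_mul, H.apply_add_int_mul, h])
    refine ⟨m - n, ?_⟩
    push_cast; linarith
  · rintro ⟨k, rfl⟩
    exact (H.apply_add_int_mul a k).symm

theorem eq_of_abs_sub_lt (H : IsBoundaryCurve T L γ) {a b : ℝ} (h : γ a = γ b)
    (hab : |a - b| < L) : a = b := by
  obtain ⟨k, rfl⟩ := H.eq_iff.1 h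
  have hL := H.pos
  have : |(k : ℝ)| * L < 1 * L := by
    rw [← abs_of_pos hL, ← abs_mul, abs_of_pos hL, one_mul]
    simpa using hab
  have hk : |(k : ℝ)| < 1 := lt_of_mul_lt_mul_right this hL.le
  have : k = 0 := by
    rw [← Int.abs_lt_one_iff]; exact_mod_cast hk
  simp [this]

theorem mem_frontier (H : IsBoundaryCurve T L γ) (s : ℝ) : γ s ∈ frontier T := by
  obtain ⟨m, hm⟩ := H.exists_add_int_mul_mem s 0
  rw [← H.image_eq, ← H.apply_add_int_mul s m]
  exact ⟨_, by simpa using hm, rfl⟩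

theorem apply_mem (H : IsBoundaryCurve T L γ) (s : ℝ) : γ s ∈ T :=
  H.isClosed.frontier_subset (H.mem_frontier s)

theorem exists_param (H : IsBoundaryCurve T L γ) {p : Plane} (hp : p ∈ frontier T) (a : ℝ) :
    ∃ s ∈ Ico a (a + L), γ s = p := by
  rw [← H.image_eq] at hp
  obtain ⟨s, -, rfl⟩ := hp
  obtain ⟨m, hm⟩ := H.exists_add_int_mul_mem s a
  exact ⟨_, hm, H.apply_add_int_mul s m⟩

/-- Reversal exchanges left and right, so each result about the left breaching point also serves for
the right one. -/
theorem rev (H : IsBoundaryCurve T L γ) : IsBoundaryCurve T L (fun s => γ (-s)) where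
  convex := H.convex
  compact := H.compact
  interior_nonempty := H.interior_nonempty
  pos := H.pos
  periodic := fun s => by
    have := H.apply_add_int_mul (-s) (-1)
    refine Eq.trans ?_ this
    simp only
    congr 1; push_cast; ring
  injOn := fun a ha b hb h => by
    have := H.eq_of_abs_sub_lt h (by
      rw [abs_lt]; constructor <;> linarith [ha.1, ha.2, hb.1, hb.2])
    linarith
  image_eq := by
    ext p
    constructor
    · rintro ⟨s, -, rfl⟩; exact H.mem_frontier _
    · intro hp
      obtain ⟨s, -, rfl⟩ := H.exists_param hp 0
      obtain ⟨m, hm⟩ := H.exists_add_int_mul_mem (-s) 0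
      rw [zero_add] at hm
      refine ⟨_, hm, ?_⟩
      have := H.apply_add_int_mul s (-m)
      simp only
      rw [← this]; congr 1; push_cast; ring
  unitSpeed := by
    intro a _ b _
    rw [univ_inter]
    have : eVariationOn (γ ∘ fun s : ℝ => -s) (Icc a b) = eVariationOn γ ((fun s : ℝ => -s) '' Icc a b) :=
      eVariationOn.comp_eq_of_antitoneOn γ _ (fun x _ y _ h => neg_le_neg h)
    have h2 : (fun s : ℝ => -s) '' Icc a b = Icc (-b) (-a) := by simp
    rw [h2, H.eVariationOn_Icc] at this
    simp only [NNReal.coe_one, one_mul]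
    rw [show b - a = -a - -b by ring, ← this]
    rfl

end IsBoundaryCurve

/-! ### The metric projection -/

/-- The nearest point of `T`. -/
noncomputable def proj (T : Set Plane) (x : Plane) : Plane :=
  Classical.epsilon fun v => v ∈ T ∧ ∀ w ∈ T, inner ℝ (x - v) (w - v) ≤ 0

namespace IsBoundaryCurve

theorem proj_spec (H : IsBoundaryCurve T L γ) (x : Plane) :
    proj T x ∈ T ∧ ∀ w ∈ T, inner ℝ (x - proj T x) (w - proj T x) ≤ 0 := by
  refine Classical.epsilon_spec (p := fun v => v ∈ T ∧ ∀ w ∈ T, inner ℝ (x - v) (w - v) ≤ 0) ?_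
  obtain ⟨v, hv, h⟩ := exists_norm_eq_iInf_of_complete_convex H.nonempty H.isClosed.isComplete
    H.convex x
  exact ⟨v, hv, (norm_eq_iInf_iff_real_inner_le_zero H.convex hv).1 h⟩

theorem proj_mem (H : IsBoundaryCurve T L γ) (x : Plane) : proj T x ∈ T := (H.proj_spec x).1

theorem inner_proj_le (H : IsBoundaryCurve T L γ) (x : Plane) {w : Plane} (hw : w ∈ T) :
    inner ℝ (x - proj T x) (w - proj T x) ≤ 0 := (H.proj_spec x).2 w hw

/-- Add the variational inequalities at the two projections and apply Cauchy–Schwarz. -/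
theorem norm_proj_sub_le (H : IsBoundaryCurve T L γ) (x y : Plane) :
    ‖proj T x - proj T y‖ ≤ ‖x - y‖ := by
  have h1 := H.inner_proj_le x (H.proj_mem y)
  have h2 := H.inner_proj_le y (H.proj_mem x)
  have h3 : ‖proj T x - proj T y‖ ^ 2 ≤ inner ℝ (x - y) (proj T x - proj T y) := by
    rw [← real_inner_self_eq_norm_sq]
    have e : inner ℝ (x - y) (proj T x - proj T y)
        - inner ℝ (proj T x - proj T y) (proj T x - proj T y)
        = - inner ℝ (x - proj T x) (proj T y - proj T x)
          - inner ℝ (y - proj T y) (proj T x - proj T y) := by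
      simp only [inner_sub_left, inner_sub_right]; ring
    linarith
  have h4 := real_inner_le_norm (x - y) (proj T x - proj T y)
  by_contra! h
  nlinarith [norm_nonneg (x - y), norm_nonneg (proj T x - proj T y)]

theorem continuous_proj (H : IsBoundaryCurve T L γ) : Continuous (proj T) :=
  (LipschitzWith.of_dist_le_mul (K := 1) fun a b => by
    simpa [dist_eq_norm] using H.norm_proj_sub_le a b).continuous

theorem proj_eq_of_inner_le (H : IsBoundaryCurve T L γ) {x v : Plane} (hv : v ∈ T)
    (h : ∀ w ∈ T, inner ℝ (x - v) (w - v) ≤ 0) : proj T x = v := by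
  have h1 := H.inner_proj_le x hv
  have h2 := h _ (H.proj_mem x)
  have : ‖proj T x - v‖ ^ 2 ≤ 0 := by
    rw [← real_inner_self_eq_norm_sq]
    have e : inner ℝ (proj T x - v) (proj T x - v)
        = inner ℝ (x - v) (proj T x - v) + inner ℝ (x - proj T x) (v - proj T x) := by
      simp only [inner_sub_left, inner_sub_right, real_inner_comm]; ring
    linarith
  have : ‖proj T x - v‖ = 0 := by
    nlinarith [norm_nonneg (proj T x - v)]
  exact sub_eq_zero.1 (norm_eq_zero.1 this)

theorem proj_of_mem (H : IsBoundaryCurve T L γ) {x : Plane} (hx : x ∈ T) : proj T x = x :=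
  H.proj_eq_of_inner_le hx (by simp)

theorem proj_eq_proj_of_mem_segment (H : IsBoundaryCurve T L γ) {x z : Plane}
    (hz : z ∈ segment ℝ x (proj T x)) : proj T z = proj T x := by
  obtain ⟨a, b, ha, hb, hab, rfl⟩ := hz
  refine H.proj_eq_of_inner_le (H.proj_mem x) fun w hw => ?_
  have : a • x + b • proj T x - proj T x = a • (x - proj T x) := by
    obtain rfl : b = 1 - a := by linarith
    module
  rw [this, real_inner_smul_left]
  exact mul_nonpos_of_nonneg_of_nonpos ha (H.inner_proj_le x hw)

theorem proj_mem_frontier (H : IsBoundaryCurve T L γ) {x : Plane} (hx : x ∉ interior T) :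
    proj T x ∈ frontier T := by
  rw [H.isClosed.frontier_eq]
  refine ⟨H.proj_mem x, fun hi => ?_⟩
  by_cases hxT : x ∈ T
  · rw [H.proj_of_mem hxT] at hi; exact hx hi
  have hne : x - proj T x ≠ 0 := fun h => hxT (by
    rw [sub_eq_zero.1 h]; exact H.proj_mem x)
  obtain ⟨ε, hε, hball⟩ := Metric.isOpen_iff.1 isOpen_interior _ hi
  set v := x - proj T x with hv
  have hvpos : 0 < ‖v‖ := norm_pos_iff.2 hne
  -- A small step from an interior projection towards `x` would stay in `T` and violate the
  -- variational inequality.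
  have hmem : proj T x + (ε / 2 / ‖v‖) • v ∈ T := by
    apply interior_subset; apply hball
    rw [Metric.mem_ball, dist_eq_norm, add_sub_cancel_left, norm_smul, Real.norm_of_nonneg
      (by positivity), div_mul_cancel₀ _ hvpos.ne']
    linarith
  have := H.inner_proj_le x hmem
  rw [add_sub_cancel_left, ← hv, real_inner_smul_right, real_inner_self_eq_norm_sq] at this
  have : 0 < ε / 2 / ‖v‖ * ‖v‖ ^ 2 := by positivity
  linarith

/-- A ray from an interior point leaves `T` through its boundary. -/
theorem exists_exit (H : IsBoundaryCurve T L γ) {q w : Plane} (hq : q ∈ interior T) (hw : w ≠ 0) :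
    ∃ r : ℝ, 0 < r ∧ q + r • w ∈ frontier T := by
  obtain ⟨M, hM⟩ := H.compact.isBounded.exists_norm_le
  have hcont : Continuous fun r : ℝ => q + r • w := by fun_prop
  have hpre : IsPreconnected ((fun r : ℝ => q + r • w) '' Ici 0) :=
    isPreconnected_Ici.image _ hcont.continuousOn
  have hwpos : 0 < ‖w‖ := norm_pos_iff.2 hw
  -- A ray that misses the frontier is connected, hence stays in the interior, which is bounded.
  by_contra! hno
  have hsub : (fun r : ℝ => q + r • w) '' Ici 0 ⊆ interior T := by
    have hdisj : ∀ z ∈ (fun r : ℝ => q + r • w) '' Ici 0, z ∉ frontier T := by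
      rintro _ ⟨r, hr, rfl⟩ hf
      rcases (mem_Ici.1 hr).eq_or_lt with h | h
      · rw [← h] at hf; simp only [zero_smul, add_zero] at hf
        exact hf.2 hq
      · exact hno r h hf
    refine hpre.subset_left_of_subset_union isOpen_interior H.isClosed.isOpen_compl
      (disjoint_left.2 fun z hz hz' => hz' (interior_subset hz)) (fun z hz => ?_)
      ⟨q, ⟨0, self_mem_Ici, by simp⟩, hq⟩
    by_cases hzT : z ∈ T
    · left
      by_contra h
      exact hdisj z hz (by rw [H.isClosed.frontier_eq]; exact ⟨hzT, h⟩)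
    · right; exact hzT
  have hM0 : 0 ≤ M := (norm_nonneg _).trans (hM _ (interior_subset hq))
  have hr : 0 ≤ (2 * M + 1) / ‖w‖ := by positivity
  have h1 := hM _ (interior_subset (hsub ⟨(2 * M + 1) / ‖w‖, hr, rfl⟩))
  have h2 := hM _ (interior_subset hq)
  have h3 : ‖((2 * M + 1) / ‖w‖) • w‖ = 2 * M + 1 := by
    rw [norm_smul, Real.norm_of_nonneg hr, div_mul_cancel₀ _ hwpos.ne']
  have h4 := norm_sub_le (q + ((2 * M + 1) / ‖w‖) • w) q
  rw [add_sub_cancel_left, h3] at h4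
  simp only at h1
  linarith

/-- The projection of a convex set that avoids the interior of `T` misses a boundary point. -/
theorem exists_proj_ne (H : IsBoundaryCurve T L γ) {C : Set Plane} (hC : Convex ℝ C)
    (hfree : Disjoint C (interior T)) : ∃ s₀, ∀ z ∈ C, proj T z ≠ γ s₀ := by
  obtain rfl | ⟨c, hc⟩ := C.eq_empty_or_nonempty
  · exact ⟨0, by simp⟩
  obtain ⟨f, u, hf, hu⟩ := geometric_hahn_banach_open H.convex.interior isOpen_interior hC
    hfree.symm
  set n := (InnerProductSpace.toDual ℝ Plane).symm f with hn
  have hfn : ∀ z, f z = inner ℝ n z := fun z => by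
    rw [hn, InnerProductSpace.toDual_symm_apply]
  obtain ⟨q, hq⟩ := H.interior_nonempty
  have hn0 : n ≠ 0 := fun h => by
    have h1 := hf q hq
    have h2 := hu c hc
    simp only [hfn, h, inner_zero_left] at h1 h2
    linarith
  -- The normal `n` points from `T` to `C`; the missed point `m` is where the ray from `q` in the
  -- opposite direction leaves `T`.
  obtain ⟨r, hr, hm⟩ := H.exists_exit hq (neg_ne_zero.2 hn0)
  set m := q + r • (-n) with hmdef
  obtain ⟨s₀, -, hs₀⟩ := H.exists_param hm 0
  refine ⟨s₀, fun z hz hzm => ?_⟩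
  rw [hs₀] at hzm
  obtain ⟨ε, hε, hball⟩ := Metric.isOpen_iff.1 isOpen_interior _ hq
  have hmq : inner ℝ n m < inner ℝ n q := by
    rw [hmdef, inner_add_right, real_inner_smul_right, inner_neg_right,
      real_inner_self_eq_norm_sq]
    have : 0 < r * ‖n‖ ^ 2 := by have := norm_pos_iff.2 hn0; positivity
    linarith
  have hzq : inner ℝ n q < inner ℝ n z := by
    have h1 := hf q hq
    have h2 := hu z hz
    rw [hfn] at h1 h2; linarith
  set v := z - m with hv
  have hnv : 0 < inner ℝ n v := by rw [hv, inner_sub_right]; linarith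
  have hv0 : 0 < ‖v‖ := norm_pos_iff.2 fun h => by rw [h, inner_zero_right] at hnv; exact hnv.false
  -- If `z` projected to `m`, testing the variational inequality at a point of `T` near `q` would
  -- fail, since q − m = r n and ⟨n, v⟩ > 0.
  have hmem : q + (ε / 2 / ‖v‖) • v ∈ T := by
    apply interior_subset; apply hball
    rw [Metric.mem_ball, dist_eq_norm, add_sub_cancel_left, norm_smul, Real.norm_of_nonneg
      (by positivity), div_mul_cancel₀ _ hv0.ne']
    linarith
  have key := H.inner_proj_le z hmem
  rw [hzm, ← hv] at key
  have e : q + (ε / 2 / ‖v‖) • v - m = r • n + (ε / 2 / ‖v‖) • v := by rw [hmdef]; module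
  rw [e, inner_add_right, real_inner_smul_right, real_inner_smul_right,
    real_inner_self_eq_norm_sq, real_inner_comm] at key
  have h1 : 0 < r * inner ℝ n v := by positivity
  have h2 : 0 < ε / 2 / ‖v‖ * ‖v‖ ^ 2 := by positivity
  linarith

end IsBoundaryCurve


/-! ### Lifting the projection to the parameter line -/

/-- `σ` is a lift along `γ` of the projection of `C` to the boundary. -/
def IsLift (T : Set Plane) (γ : ℝ → Plane) (C : Set Plane) (σ : Plane → ℝ) : Prop :=
  (∀ z ∈ C, γ (σ z) = proj T z) ∧ ∀ z ∈ C, ∀ z' ∈ C, |σ z - σ z'| ≤ ‖z - z'‖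

theorem IsLift.mono {C C' : Set Plane} {σ : Plane → ℝ} (h : IsLift T γ C σ) (hC : C' ⊆ C) :
    IsLift T γ C' σ :=
  ⟨fun z hz => h.1 z (hC hz), fun z hz z' hz' => h.2 z (hC hz) z' (hC hz')⟩

theorem IsLift.continuousOn {C : Set Plane} {σ : Plane → ℝ} (h : IsLift T γ C σ) :
    ContinuousOn σ C :=
  (LipschitzOnWith.of_dist_le_mul (K := 1) fun x hx y hy => by
    simpa [dist_eq_norm] using h.2 x hx y hy).continuousOn

theorem IsLift.add_const {C : Set Plane} {σ : Plane → ℝ} (h : IsLift T γ C σ)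
    (H : IsBoundaryCurve T L γ) (k : ℤ) : IsLift T γ C fun z => σ z + k * L :=
  ⟨fun z hz => by rw [H.apply_add_int_mul, h.1 z hz], fun z hz z' hz' => by
    simpa using h.2 z hz z' hz'⟩

/-- A continuous real function on `[0, 1]` running from `a` to `b` admits a monotone section. -/
theorem exists_monotone_section {τ : ℝ → ℝ} (hτ : ContinuousOn τ (Icc 0 1)) {a b : ℝ}
    (h0 : τ 0 = a) (h1 : τ 1 = b) :
    ∃ φ : ℝ → ℝ, MonotoneOn φ (Icc a b) ∧ MapsTo φ (Icc a b) (Icc 0 1) ∧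
      ∀ s ∈ Icc a b, τ (φ s) = s := by
  have key : ∀ s ∈ Icc a b, IsLeast {r | r ∈ Icc (0 : ℝ) 1 ∧ s ≤ τ r}
      (sInf {r | r ∈ Icc (0 : ℝ) 1 ∧ s ≤ τ r}) := by
    intro s hs
    have hcl : IsClosed {r | r ∈ Icc (0 : ℝ) 1 ∧ s ≤ τ r} :=
      hτ.preimage_isClosed_of_isClosed isClosed_Icc isClosed_Ici
    have hne : {r | r ∈ Icc (0 : ℝ) 1 ∧ s ≤ τ r}.Nonempty := ⟨1, by simp, by rw [h1]; exact hs.2⟩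
    have hbd : BddBelow {r | r ∈ Icc (0 : ℝ) 1 ∧ s ≤ τ r} := ⟨0, fun r hr => hr.1.1⟩
    exact ⟨hcl.csInf_mem hne hbd, fun r hr => csInf_le hbd hr⟩
  -- The section takes the first time at which `τ` is at least `s`.
  refine ⟨fun s => sInf {r | r ∈ Icc (0 : ℝ) 1 ∧ s ≤ τ r}, fun s hs t ht hst => ?_,
    fun s hs => (key s hs).1.1, fun s hs => ?_⟩
  · exact (key s hs).2 ⟨(key t ht).1.1, hst.trans (key t ht).1.2⟩
  · obtain ⟨⟨hmem, hle⟩, hmin⟩ := key s hs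
    refine le_antisymm ?_ hle
    set r := sInf {r | r ∈ Icc (0 : ℝ) 1 ∧ s ≤ τ r}
    obtain ⟨r', hr', hr's⟩ := intermediate_value_Icc hmem.1
      (hτ.mono (Icc_subset_Icc_right hmem.2)) (show s ∈ Icc (τ 0) (τ r) from ⟨h0 ▸ hs.1, hle⟩)
    have : r = r' := le_antisymm (hmin ⟨⟨hr'.1, hr'.2.trans hmem.2⟩, hr's.ge⟩) hr'.2
    exact (congrArg τ this).trans hr's |>.le

namespace IsBoundaryCurve

/-- The lift may run back and forth, but a monotone section of it exhibits the arc of `γ` as a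
reparametrized piece of the projected segment. The projection is 1-Lipschitz and the variation of
`γ` is arc length. -/
theorem abs_sub_le_of_continuous_lift (H : IsBoundaryCurve T L γ) {τ : ℝ → ℝ} {z z' : Plane}
    (hτ : ContinuousOn τ (Icc 0 1))
    (h : ∀ r ∈ Icc (0 : ℝ) 1, γ (τ r) = proj T (z + r • (z' - z))) :
    τ 1 - τ 0 ≤ ‖z - z'‖ := by
  obtain ⟨φ, hmono, hmaps, hsec⟩ := exists_monotone_section hτ rfl rfl
  set P : ℝ → Plane := fun r => proj T (z + r • (z' - z)) with hP
  have hlip : LipschitzWith ‖z - z'‖₊ P := by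
    refine LipschitzWith.of_dist_le_mul fun r s => ?_
    rw [dist_eq_norm, dist_eq_norm, coe_nnnorm]
    refine (H.norm_proj_sub_le _ _).trans ?_
    rw [show z + r • (z' - z) - (z + s • (z' - z)) = (r - s) • (z' - z) by module, norm_smul,
      norm_sub_rev z' z, mul_comm]
  have h1 : eVariationOn γ (Icc (τ 0) (τ 1)) ≤ eVariationOn P (Icc 0 1) := by
    have : EqOn γ (P ∘ φ) (Icc (τ 0) (τ 1)) := fun s hs => by
      simp only [Function.comp, hP]
      rw [← h _ (hmaps hs), hsec s hs]
    rw [eVariationOn.congr this]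
    exact eVariationOn.comp_le_of_monotoneOn P φ hmono hmaps
  have h2 : eVariationOn P (Icc 0 1) ≤ ENNReal.ofReal ‖z - z'‖ := by
    have h3 := (hlip.lipschitzOnWith (s := univ)).comp_eVariationOn_le (g := (id : ℝ → ℝ)) (s := Icc 0 1)
      (mapsTo_univ _ _)
    have h4 : eVariationOn (id : ℝ → ℝ) (Icc 0 1) ≤ ENNReal.ofReal (1 - 0) := by
      simp
    calc _ ≤ _ := h3
      _ ≤ (‖z - z'‖₊ : ENNReal) * ENNReal.ofReal (1 - 0) := by gcongr
      _ = _ := by simp [ENNReal.ofReal, norm_toNNReal]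
  rw [H.eVariationOn_Icc] at h1
  exact (ENNReal.ofReal_le_ofReal_iff (norm_nonneg _)).1 (h1.trans h2)

/-- Once `γ s₀` is excluded, `γ` is injective on the remaining open period, so the parameter of the
projection is unique there and, by compactness, continuous. -/
theorem exists_isLift_of_ne (H : IsBoundaryCurve T L γ) {C : Set Plane} (hC : Convex ℝ C)
    (hfree : Disjoint C (interior T)) {s₀ : ℝ} (hs₀ : ∀ z ∈ C, proj T z ≠ γ s₀) :
    ∃ σ, IsLift T γ C σ ∧ ∀ z ∈ C, σ z ∈ Ioo s₀ (s₀ + L) := by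
  have hex : ∀ z, ∃ s, z ∈ C → s ∈ Ioo s₀ (s₀ + L) ∧ γ s = proj T z := fun z => by
    by_cases hz : z ∈ C
    · obtain ⟨s, hs, hsz⟩ := H.exists_param
        (H.proj_mem_frontier fun h => disjoint_left.1 hfree hz h) s₀
      refine ⟨s, fun _ => ⟨⟨hs.1.lt_of_ne ?_, hs.2⟩, hsz⟩⟩
      rintro rfl; exact hs₀ z hz hsz.symm
    · exact ⟨0, fun h => (hz h).elim⟩
  choose σ hσ using hex
  have hcont : ContinuousOn σ C := by
    rw [continuousOn_iff_isClosed]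
    intro F hF
    -- Closing the period makes the image compact and adds only the point `γ s₀`, which is no
    -- projection.
    refine ⟨proj T ⁻¹' (γ '' (F ∩ Icc s₀ (s₀ + L))), ?_, ?_⟩
    · exact ((isCompact_Icc.inter_left hF).image H.continuous).isClosed.preimage H.continuous_proj
    · ext z
      constructor
      · rintro ⟨hzF, hz⟩
        exact ⟨⟨σ z, ⟨hzF, Ioo_subset_Icc_self (hσ z hz).1⟩, (hσ z hz).2⟩, hz⟩
      · rintro ⟨⟨s, ⟨hsF, hs⟩, hsz⟩, hz⟩
        refine ⟨?_, hz⟩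
        have h1 : s ≠ s₀ := by rintro rfl; exact hs₀ z hz hsz.symm
        have h2 : s ≠ s₀ + L := by
          rintro rfl; rw [H.periodic] at hsz; exact hs₀ z hz hsz.symm
        have h3 : s ∈ Ioo s₀ (s₀ + L) := ⟨hs.1.lt_of_ne h1.symm, hs.2.lt_of_ne h2⟩
        have h4 := (hσ z hz).1
        have : s = σ z := H.eq_of_abs_sub_lt (hsz.trans (hσ z hz).2.symm) (by
          rw [abs_lt]; constructor <;> linarith [h3.1, h3.2, h4.1, h4.2])
        rwa [mem_preimage, ← this]
  have hle : ∀ z ∈ C, ∀ z' ∈ C, σ z' - σ z ≤ ‖z - z'‖ := fun z hz z' hz' => by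
    have hmem : ∀ r ∈ Icc (0 : ℝ) 1, z + r • (z' - z) ∈ C := fun r hr =>
      hC.add_smul_sub_mem hz hz' hr
    have := H.abs_sub_le_of_continuous_lift (τ := fun r => σ (z + r • (z' - z))) (z := z) (z' := z')
      (hcont.comp (by fun_prop) hmem) fun r hr => (hσ _ (hmem r hr)).2
    simpa using this
  refine ⟨σ, ⟨fun z hz => (hσ z hz).2, fun z hz z' hz' => ?_⟩, fun z hz => (hσ z hz).1⟩
  rw [abs_le]
  constructor
  · linarith [hle z hz z' hz']
  · have := hle z' hz' z hz
    rwa [norm_sub_rev] at this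

theorem exists_isLift (H : IsBoundaryCurve T L γ) {C : Set Plane} (hC : Convex ℝ C)
    (hfree : Disjoint C (interior T)) : ∃ σ, IsLift T γ C σ := by
  obtain ⟨s₀, hs₀⟩ := H.exists_proj_ne hC hfree
  obtain ⟨σ, hσ, -⟩ := H.exists_isLift_of_ne hC hfree hs₀
  exact ⟨σ, hσ⟩

/-- Two continuous lifts over a connected set differ by a constant. -/
theorem sub_eq_sub_of_lift (H : IsBoundaryCurve T L γ) {X : Type*} [TopologicalSpace X]
    {S : Set X} (hS : IsPreconnected S) {f g : X → ℝ} (hf : ContinuousOn f S)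
    (hg : ContinuousOn g S) (h : ∀ x ∈ S, γ (f x) = γ (g x)) {x y : X} (hx : x ∈ S)
    (hy : y ∈ S) : f y - f x = g y - g x := by
  -- The difference of the lifts divided by `L` is continuous and integer valued.
  have hmaps : MapsTo (fun z => (g z - f z) / L) S (range ((↑) : ℤ → ℝ)) := fun z hz => by
    obtain ⟨k, hk⟩ := H.eq_iff.1 (h z hz)
    refine ⟨k, ?_⟩
    have hL := H.pos.ne'
    simp only [hk]; field_simp; ring
  have hcont : ContinuousOn (fun z => (g z - f z) / L) S := (hg.sub hf).div_const L
  have := hS.constant_of_mapsTo Int.isClosedEmbedding_coe_real.isEmbedding.isDiscrete_range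
    hcont hmaps hx hy
  have hL := H.pos.ne'
  field_simp at this
  linarith

end IsBoundaryCurve

/-- The signed arc length swept by the projection to the boundary along the segment from `x`
to `y`. -/
noncomputable def disp (T : Set Plane) (γ : ℝ → Plane) (x y : Plane) : ℝ :=
  Classical.epsilon (IsLift T γ (segment ℝ x y)) y -
    Classical.epsilon (IsLift T γ (segment ℝ x y)) x

namespace IsBoundaryCurve

/-- The arbitrary choice in `disp` is harmless: lifts over a segment differ by a constant. -/
theorem disp_eq (H : IsBoundaryCurve T L γ) {C : Set Plane} (hC : Convex ℝ C)
    {σ : Plane → ℝ} (hσ : IsLift T γ C σ) {x y : Plane} (hx : x ∈ C) (hy : y ∈ C) :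
    disp T γ x y = σ y - σ x := by
  have hsub := hC.segment_subset hx hy
  have hσ' := hσ.mono hsub
  have hε : IsLift T γ (segment ℝ x y) (Classical.epsilon (IsLift T γ (segment ℝ x y))) :=
    Classical.epsilon_spec ⟨σ, hσ'⟩
  exact H.sub_eq_sub_of_lift (convex_segment x y).isPreconnected hε.continuousOn hσ'.continuousOn
    (fun z hz => (hε.1 z hz).trans (hσ'.1 z hz).symm) (left_mem_segment ℝ x y)
    (right_mem_segment ℝ x y)

theorem exists_isLift_segment (H : IsBoundaryCurve T L γ) {x y : Plane}
    (h : Disjoint (segment ℝ x y) (interior T)) {θ : ℝ} (hθ : γ θ = proj T x) :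
    ∃ σ, IsLift T γ (segment ℝ x y) σ ∧ σ x = θ ∧ σ y = θ + disp T γ x y := by
  obtain ⟨σ, hσ⟩ := H.exists_isLift (convex_segment x y) h
  obtain ⟨k, hk⟩ := H.eq_iff.1 ((hσ.1 x (left_mem_segment ℝ x y)).trans hθ.symm)
  refine ⟨_, hσ.add_const H k, hk.symm, ?_⟩
  rw [H.disp_eq (convex_segment x y) hσ (left_mem_segment ℝ x y) (right_mem_segment ℝ x y), hk]
  ring

theorem exists_proj_param (H : IsBoundaryCurve T L γ) {x : Plane} (hx : x ∉ interior T) :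
    ∃ θ, γ θ = proj T x := by
  obtain ⟨s, -, hs⟩ := H.exists_param (H.proj_mem_frontier hx) 0
  exact ⟨s, hs⟩

theorem apply_add_disp (H : IsBoundaryCurve T L γ) {x y : Plane}
    (h : Disjoint (segment ℝ x y) (interior T)) {θ : ℝ} (hθ : γ θ = proj T x) :
    γ (θ + disp T γ x y) = proj T y := by
  obtain ⟨σ, hσ, -, h2⟩ := H.exists_isLift_segment h hθ
  rw [← h2]; exact hσ.1 y (right_mem_segment ℝ x y)

theorem abs_disp_le (H : IsBoundaryCurve T L γ) {x y : Plane}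
    (h : Disjoint (segment ℝ x y) (interior T)) : |disp T γ x y| ≤ ‖x - y‖ := by
  obtain ⟨σ, hσ⟩ := H.exists_isLift (convex_segment x y) h
  rw [H.disp_eq (convex_segment x y) hσ (left_mem_segment ℝ x y) (right_mem_segment ℝ x y),
    norm_sub_rev]
  exact hσ.2 _ (right_mem_segment ℝ x y) _ (left_mem_segment ℝ x y)

/-- Additivity comes from one lift common to the three points; this is why they must lie in one
convex set off the interior. -/
theorem disp_add_disp (H : IsBoundaryCurve T L γ) {C : Set Plane} (hC : Convex ℝ C)
    (hfree : Disjoint C (interior T)) {x y z : Plane} (hx : x ∈ C) (hy : y ∈ C) (hz : z ∈ C) :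
    disp T γ x y + disp T γ y z = disp T γ x z := by
  obtain ⟨σ, hσ⟩ := H.exists_isLift hC hfree
  rw [H.disp_eq hC hσ hx hy, H.disp_eq hC hσ hy hz, H.disp_eq hC hσ hx hz]; ring

theorem disp_symm (H : IsBoundaryCurve T L γ) {x y : Plane}
    (h : Disjoint (segment ℝ x y) (interior T)) : disp T γ y x = - disp T γ x y := by
  obtain ⟨σ, hσ⟩ := H.exists_isLift (convex_segment x y) h
  rw [H.disp_eq (convex_segment x y) hσ (left_mem_segment ℝ x y) (right_mem_segment ℝ x y),
    H.disp_eq (convex_segment x y) hσ (right_mem_segment ℝ x y) (left_mem_segment ℝ x y)]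
  ring

theorem disp_rev (H : IsBoundaryCurve T L γ) {x y : Plane}
    (h : Disjoint (segment ℝ x y) (interior T)) :
    disp T (fun s => γ (-s)) x y = - disp T γ x y := by
  obtain ⟨σ, hσ⟩ := H.exists_isLift (convex_segment x y) h
  have hσ' : IsLift T (fun s => γ (-s)) (segment ℝ x y) fun z => - σ z :=
    ⟨fun z hz => by simpa using hσ.1 z hz, fun z hz z' hz' => by
      rw [neg_sub_neg, norm_sub_rev]; exact hσ.2 z' hz' z hz⟩
  rw [H.disp_eq (convex_segment x y) hσ (left_mem_segment ℝ x y) (right_mem_segment ℝ x y),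
    H.rev.disp_eq (convex_segment x y) hσ' (left_mem_segment ℝ x y) (right_mem_segment ℝ x y)]
  ring

theorem disjoint_segment_proj (H : IsBoundaryCurve T L γ) {x : Plane} (hx : x ∉ T) :
    Disjoint (segment ℝ x (proj T x)) (interior T) := by
  rw [disjoint_left]
  intro z hz hzi
  have h1 := H.proj_eq_proj_of_mem_segment hz
  rw [H.proj_of_mem (interior_subset hzi)] at h1
  exact (H.proj_mem_frontier fun h => hx (interior_subset h)).2 (h1 ▸ hzi)

theorem disp_proj (H : IsBoundaryCurve T L γ) {x : Plane} (hx : x ∉ T) :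
    disp T γ x (proj T x) = 0 := by
  obtain ⟨θ, hθ⟩ := H.exists_proj_param fun h => hx (interior_subset h)
  have : IsLift T γ (segment ℝ x (proj T x)) fun _ => θ :=
    ⟨fun z hz => by rw [hθ, H.proj_eq_proj_of_mem_segment hz], fun z _ z' _ => by simp⟩
  rw [H.disp_eq (convex_segment _ _) this (left_mem_segment ℝ _ _) (right_mem_segment ℝ _ _)]
  ring

/-- If the projection of the segment misses the boundary point `γ s₀`, then `disp` compares
parameters in the period that starts at `s₀`. -/
theorem disp_eq_of_ne (H : IsBoundaryCurve T L γ) {x p : Plane}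
    (h : Disjoint (segment ℝ x p) (interior T)) {s₀ θ s : ℝ}
    (hne : ∀ z ∈ segment ℝ x p, proj T z ≠ γ s₀) (hθ : γ θ = proj T x)
    (hθI : θ ∈ Ioo s₀ (s₀ + L)) (hs : γ s = proj T p) (hsI : s ∈ Ioo s₀ (s₀ + L)) :
    disp T γ x p = s - θ := by
  obtain ⟨σ, hσ, hI⟩ := H.exists_isLift_of_ne (convex_segment x p) h hne
  have key : ∀ z ∈ segment ℝ x p, ∀ t ∈ Ioo s₀ (s₀ + L), γ t = proj T z → σ z = t :=
    fun z hz t ht htz => H.eq_of_abs_sub_lt ((hσ.1 z hz).trans htz.symm) (by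
      have := hI z hz
      rw [abs_lt]; constructor <;> linarith [ht.1, ht.2, this.1, this.2])
  rw [H.disp_eq (convex_segment x p) hσ (left_mem_segment ℝ x p) (right_mem_segment ℝ x p),
    key x (left_mem_segment ℝ x p) θ hθI hθ, key p (right_mem_segment ℝ x p) s hsI hs]

/-- The projection of the segment from `x` to `y` covers the arc between the end points. -/
theorem exists_proj_eq_of_mem_uIcc (H : IsBoundaryCurve T L γ) {x y : Plane}
    (h : Disjoint (segment ℝ x y) (interior T)) {θ : ℝ} (hθ : γ θ = proj T x) {s : ℝ}
    (hs : s ∈ uIcc θ (θ + disp T γ x y)) : ∃ z ∈ segment ℝ x y, proj T z = γ s := by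
  obtain ⟨σ, hσ, h1, h2⟩ := H.exists_isLift_segment h hθ
  have := (convex_segment x y).isPreconnected.image σ hσ.continuousOn
  have hsub := this.ordConnected.uIcc_subset (mem_image_of_mem σ (left_mem_segment ℝ x y))
    (mem_image_of_mem σ (right_mem_segment ℝ x y))
  rw [h1, h2] at hsub
  obtain ⟨z, hz, rfl⟩ := hsub hs
  exact ⟨z, hz, (hσ.1 z hz).symm⟩

end IsBoundaryCurve

/-! ### Visible points -/

/-- The point `p` of `T` is visible from `x`. -/
def Vis (T : Set Plane) (x p : Plane) : Prop := p ∈ T ∧ Disjoint (openSegment ℝ x p) T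

theorem mem_segment_cases {x p z : Plane} (hz : z ∈ segment ℝ x p) :
    z = x ∨ z = p ∨ z ∈ openSegment ℝ x p := by
  rw [← insert_endpoints_openSegment] at hz
  simpa using hz

theorem segment_subset_left {x p z : Plane} (hz : z ∈ segment ℝ x p) :
    segment ℝ x z ⊆ segment ℝ x p :=
  (convex_segment x p).segment_subset (left_mem_segment ℝ x p) hz

theorem segment_subset_right {x p z : Plane} (hz : z ∈ segment ℝ x p) :
    segment ℝ z p ⊆ segment ℝ x p :=
  (convex_segment x p).segment_subset hz (right_mem_segment ℝ x p)

theorem norm_sub_add_norm_sub_of_mem_segment {x p z : Plane} (hz : z ∈ segment ℝ x p) :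
    ‖x - z‖ + ‖z - p‖ = ‖x - p‖ := by
  have := (mem_segment_iff_wbtw.1 hz).dist_add_dist
  simpa [dist_eq_norm] using this

theorem Vis.eq_of_mem_segment {x p z : Plane} (hx : x ∉ T) (h : Vis T x p)
    (hz : z ∈ segment ℝ x p) (hzT : z ∈ T) : z = p := by
  rcases mem_segment_cases hz with rfl | rfl | hz
  · exact (hx hzT).elim
  · rfl
  · exact (disjoint_left.1 h.2 hz hzT).elim

theorem Vis.disjoint_interior {x p : Plane} (hx : x ∉ T) (h : Vis T x p) :
    Disjoint (segment ℝ x p) (interior T) := by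
  rw [disjoint_left]
  intro z hz hzi
  obtain rfl := h.eq_of_mem_segment hx hz (interior_subset hzi)
  have hne : x ≠ z := fun e => hx (e ▸ h.1)
  have hc : z ∈ closure (openSegment ℝ x z) := by
    rw [closure_openSegment]; exact right_mem_segment ℝ x z
  obtain ⟨w, hw, hw'⟩ := mem_closure_iff.1 hc _ isOpen_interior hzi
  exact disjoint_left.1 h.2 hw' (interior_subset hw)

theorem Vis.mem_frontier {x p : Plane} (hx : x ∉ T) (h : Vis T x p) : p ∈ frontier T :=
  ⟨subset_closure h.1, disjoint_left.1 (h.disjoint_interior hx) (right_mem_segment ℝ x p)⟩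

theorem Vis.of_mem_segment {x p z : Plane} (hx : x ∉ T) (h : Vis T x p)
    (hz : z ∈ segment ℝ x p) (hzT : z ∉ T) : Vis T z p := by
  refine ⟨h.1, disjoint_left.2 fun w hw hwT => ?_⟩
  obtain rfl := h.eq_of_mem_segment hx (segment_subset_right hz
    (openSegment_subset_segment ℝ z p hw)) hwT
  exact hzT ((right_mem_openSegment_iff.1 hw).symm ▸ hwT)

namespace IsBoundaryCurve

/-- The first point of `T` on the way from `x` to a point of `T` is visible. -/
theorem exists_vis_mem_segment (H : IsBoundaryCurve T L γ) {x p : Plane} (hx : x ∉ T)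
    (h : (segment ℝ x p ∩ T).Nonempty) : ∃ q ∈ segment ℝ x p, Vis T x q := by
  have hcomp : IsCompact (segment ℝ x p ∩ T) := H.compact.inter_left
    (by rw [segment_eq_image_lineMap]; exact (isCompact_Icc.image (by fun_prop)).isClosed)
  obtain ⟨q, ⟨hq, hqT⟩, hmin⟩ := hcomp.exists_isMinOn h (f := fun q => ‖x - q‖) (by fun_prop)
  refine ⟨q, hq, hqT, disjoint_left.2 fun z hz hzT => ?_⟩
  have hz' := openSegment_subset_segment ℝ x q hz
  have h1 := hmin ⟨segment_subset_left hq hz', hzT⟩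
  have h2 := norm_sub_add_norm_sub_of_mem_segment hz'
  change ‖x - q‖ ≤ ‖x - z‖ at h1
  have h3 : ‖z - q‖ = 0 := le_antisymm (by linarith) (norm_nonneg _)
  obtain rfl : z = q := sub_eq_zero.1 (norm_eq_zero.1 h3)
  exact hx ((right_mem_openSegment_iff.1 hz).symm ▸ hzT)

/-- The supporting line at `proj T z` has `z` strictly in front and `p` not in front. As `z` lies
between `x` and `p`, the point `x` is strictly in front. -/
theorem inner_pos_of_mem_segment (H : IsBoundaryCurve T L γ) {x p z : Plane} (hp : p ∈ T)
    (hz : z ∈ segment ℝ x p) (hzT : z ∉ T) :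
    0 < inner ℝ (z - proj T z) (x - proj T z) := by
  obtain ⟨a, b, ha, hb, hab, hzz⟩ := hz
  have h1 := H.inner_proj_le z hp
  have hne : z - proj T z ≠ 0 := fun h => hzT (by rw [sub_eq_zero.1 h]; exact H.proj_mem z)
  have h2 : 0 < inner ℝ (z - proj T z) (z - proj T z) := real_inner_self_pos.2 hne
  have h3 : inner ℝ (z - proj T z) (z - proj T z) =
      a * inner ℝ (z - proj T z) (x - proj T z) + b * inner ℝ (z - proj T z) (p - proj T z) := by
    rw [← real_inner_smul_right, ← real_inner_smul_right, ← inner_add_right]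
    congr 1
    nth_rw 1 [← hzz]
    obtain rfl : b = 1 - a := by linarith
    module
  have h4 : b * inner ℝ (z - proj T z) (p - proj T z) ≤ 0 :=
    mul_nonpos_of_nonneg_of_nonpos hb h1
  by_contra! h
  have := mul_nonpos_of_nonneg_of_nonpos ha h
  linarith

/-- `T` lies behind the supporting line at `proj T z`, the open segment from `x` strictly in front
of it. -/
theorem vis_proj_of_mem_segment (H : IsBoundaryCurve T L γ) {x p z : Plane} (hp : p ∈ T)
    (hz : z ∈ segment ℝ x p) (hzT : z ∉ T) : Vis T x (proj T z) := by
  refine ⟨H.proj_mem z, disjoint_left.2 fun w hw hwT => ?_⟩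
  have h1 := H.inner_pos_of_mem_segment hp hz hzT
  have h2 := H.inner_proj_le z hwT
  obtain ⟨a, b, ha, hb, hab, rfl⟩ := hw
  have : a • x + b • proj T z - proj T z = a • (x - proj T z) := by
    obtain rfl : b = 1 - a := by linarith
    module
  rw [this, real_inner_smul_right] at h2
  have := mul_pos ha h1
  linarith

theorem vis_proj_of_vis (H : IsBoundaryCurve T L γ) {x p z : Plane} (hx : x ∉ T)
    (h : Vis T x p) (hz : z ∈ segment ℝ x p) : Vis T x (proj T z) := by
  by_cases hzT : z ∈ T
  · rw [H.proj_of_mem hzT, h.eq_of_mem_segment hx hz hzT]; exact h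
  · exact H.vis_proj_of_mem_segment h.1 hz hzT

theorem vis_proj (H : IsBoundaryCurve T L γ) {x : Plane} (hx : x ∉ T) : Vis T x (proj T x) :=
  H.vis_proj_of_mem_segment (H.proj_mem x) (left_mem_segment ℝ _ _) hx

theorem norm_sub_proj_le (H : IsBoundaryCurve T L γ) (z : Plane) {p : Plane} (hp : p ∈ T) :
    ‖z - proj T z‖ ≤ ‖z - p‖ := by
  have h1 := H.inner_proj_le z hp
  have h2 : ‖z - p‖ ^ 2 = ‖z - proj T z‖ ^ 2 + ‖p - proj T z‖ ^ 2
      - 2 * inner ℝ (z - proj T z) (p - proj T z) := by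
    rw [show z - p = (z - proj T z) - (p - proj T z) by abel, norm_sub_sq_real]; ring
  exact le_of_sq_le_sq (by nlinarith [sq_nonneg ‖p - proj T z‖]) (norm_nonneg _)

/-- Hence the distance from `x` is monotone along the arc from `proj T x` to a visible point. -/
theorem norm_sub_proj_le_of_mem_segment (H : IsBoundaryCurve T L γ) {x p z : Plane} (hp : p ∈ T)
    (hz : z ∈ segment ℝ x p) : ‖x - proj T z‖ ≤ ‖x - p‖ := by
  have h1 := H.norm_sub_proj_le z hp
  have h2 := norm_sub_add_norm_sub_of_mem_segment hz
  have h3 := norm_sub_le_norm_sub_add_norm_sub x z (proj T z)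
  linarith

end IsBoundaryCurve

/-! ### The breaching potential -/

/-- Arc length gained towards `p` minus the time needed to get there at speed `ν`. -/
noncomputable def obj (T : Set Plane) (γ : ℝ → Plane) (ν : ℝ) (x p : Plane) : ℝ :=
  disp T γ x p - ‖x - p‖ / ν

/-- `p` is an optimal visible point for `x`. -/
def IsBest (T : Set Plane) (γ : ℝ → Plane) (ν : ℝ) (x p : Plane) : Prop :=
  Vis T x p ∧ ∀ q, Vis T x q → obj T γ ν x q ≤ obj T γ ν x p

open Classical in
/-- The optimal value of `obj`, extended by `0` to `T`. -/
noncomputable def pot (T : Set Plane) (γ : ℝ → Plane) (ν : ℝ) (x : Plane) : ℝ :=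
  if x ∈ T then 0 else sSup (obj T γ ν x '' {q | Vis T x q})

theorem IsBest.pot_eq {x p : Plane} (h : IsBest T γ ν x p) (hx : x ∉ T) :
    pot T γ ν x = obj T γ ν x p := by
  rw [pot, if_neg hx]
  refine IsGreatest.csSup_eq ⟨⟨p, h.1, rfl⟩, ?_⟩
  rintro _ ⟨q, hq, rfl⟩
  exact h.2 q hq

theorem disjoint_interior_of_disjoint {C : Set Plane} (h : Disjoint C T) :
    Disjoint C (interior T) := h.mono_right interior_subset

theorem le_div_of_le_one {a : ℝ} (ha : 0 ≤ a) (hν : ν ∈ Ioc (0 : ℝ) 1) : a ≤ a / ν :=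
  le_div_self ha hν.1 hν.2

namespace IsBoundaryCurve

/-- Stopping at the first point of `T` loses no more arc than distance, and saves at least that much
time because ν ≤ 1. -/
theorem exists_vis_obj_le (H : IsBoundaryCurve T L γ) (hν : ν ∈ Ioc (0 : ℝ) 1) {x p : Plane}
    (hx : x ∉ T) (hp : p ∈ T) (hfree : Disjoint (segment ℝ x p) (interior T)) :
    ∃ q, Vis T x q ∧ obj T γ ν x p ≤ obj T γ ν x q := by
  obtain ⟨q, hq, hvis⟩ := H.exists_vis_mem_segment hx ⟨p, right_mem_segment ℝ x p, hp⟩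
  refine ⟨q, hvis, ?_⟩
  have h1 := H.disp_add_disp (convex_segment x p) hfree (left_mem_segment ℝ x p) hq
    (right_mem_segment ℝ x p)
  have h2 := le_abs_self _ |>.trans (H.abs_disp_le (hfree.mono_left (segment_subset_right hq)))
  have h3 := norm_sub_add_norm_sub_of_mem_segment hq
  have h4 := le_div_of_le_one (norm_nonneg (q - p)) hν
  rw [obj, obj, ← h1, ← h3, add_div]
  linarith

/-- The triangle spanned by `y` and the far part of `[p, x]`, cut where the view from `y` is first
blocked. -/
theorem exists_last_blocked (H : IsBoundaryCurve T L γ) {x y p : Plane}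
    (hxy : Disjoint (segment ℝ x y) T) (hp : p ∈ T) :
    ∃ z ∈ segment ℝ x p, (segment ℝ y z ∩ T).Nonempty ∧
      Disjoint (convexJoin ℝ {y} (segment ℝ z x)) (interior T) := by
  set Z : ℝ → Plane := fun t => AffineMap.lineMap p x t with hZ
  -- Pairs (t, r) for which the point at fraction `r` of the view from `y` to `Z t` lies in `T`; by
  -- compactness there is a last blocked `t`.
  set K : Set (ℝ × ℝ) := (Icc 0 1 ×ˢ Icc 0 1) ∩
    (fun w : ℝ × ℝ => AffineMap.lineMap y (Z w.1) w.2) ⁻¹' T with hK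
  have hcont : Continuous fun w : ℝ × ℝ => (AffineMap.lineMap y (Z w.1) w.2 : Plane) := by
    simp only [hZ, AffineMap.lineMap_apply_module]; fun_prop
  have hKc : IsCompact K := (isCompact_Icc.prod isCompact_Icc).inter_right
    (H.isClosed.preimage hcont)
  have hKn : K.Nonempty := ⟨(0, 1), by simp [hK, hZ, hp]⟩
  obtain ⟨t, ⟨⟨⟨t', r⟩, hw, rfl⟩, hmax⟩⟩ := (hKc.image continuous_fst).exists_isGreatest
    (hKn.image _)
  simp only [hK, mem_inter_iff, mem_prod, mem_preimage] at hw
  obtain ⟨⟨ht, hr⟩, hwT⟩ := hw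
  have hblock : ∀ s ∈ Icc (0 : ℝ) 1, ∀ r ∈ Icc (0 : ℝ) 1,
      (AffineMap.lineMap y (Z s) r : Plane) ∈ T → s ≤ t' := fun s hs r hr h =>
    hmax ⟨(s, r), ⟨⟨hs, hr⟩, h⟩, rfl⟩
  have ht1 : t' < 1 := by
    refine ht.2.lt_of_ne fun h => ?_
    subst h
    refine disjoint_left.1 hxy ?_ hwT
    rw [segment_symm, segment_eq_image_lineMap]
    refine ⟨r, hr, by simp [hZ]⟩
  refine ⟨Z t', ?_, ⟨_, ?_, hwT⟩, ?_⟩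
  · rw [segment_symm, segment_eq_image_lineMap]; exact ⟨t', ht, rfl⟩
  · rw [segment_eq_image_lineMap]; exact ⟨r, hr, rfl⟩
  · rw [disjoint_left]
    intro w hw hwi
    obtain ⟨y', hy', z, hz, hseg⟩ := mem_convexJoin.1 hw
    rw [mem_singleton_iff] at hy'
    subst hy'
    rw [segment_eq_image_lineMap] at hz hseg
    obtain ⟨s, hs, rfl⟩ := hz
    obtain ⟨r', hr', rfl⟩ := hseg
    have e : (AffineMap.lineMap (Z t') x s : Plane) = Z (t' + s * (1 - t')) := by
      simp only [hZ, AffineMap.lineMap_apply_module]; module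
    rw [e] at hwi
    have hopen : IsOpen {u : ℝ | (AffineMap.lineMap y' (Z u) r' : Plane) ∈ interior T} :=
      isOpen_interior.preimage (hcont.comp (by fun_prop : Continuous fun u : ℝ => (u, r')))
    set t₁ := t' + s * (1 - t') with ht₁
    have hs0 : 0 ≤ s * (1 - t') := mul_nonneg hs.1 (by linarith)
    have hs1 : s * (1 - t') ≤ 1 * (1 - t') := mul_le_mul_of_nonneg_right hs.2 (by linarith)
    have hle : t₁ ≤ t' := hblock t₁ ⟨by linarith [ht.1], by linarith⟩ r' hr' (interior_subset hwi)
    -- A view through the interior stays blocked for slightly larger parameters.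
    have hev : ∀ᶠ u in nhdsWithin t₁ (Ioi t₁),
        (AffineMap.lineMap y' (Z u) r' : Plane) ∈ interior T :=
      nhdsWithin_le_nhds (hopen.mem_nhds hwi)
    obtain ⟨u, hu, hu'⟩ := (hev.and (Ioo_mem_nhdsGT (show t₁ < 1 by linarith))).exists
    have := hblock u ⟨by linarith [hu'.1, ht.1], hu'.2.le⟩ r' hr' (interior_subset hu)
    linarith [hu'.1]

/-- The view from `y` is turned along [p, x] to the last blocked position `z`, and `q` is the first
obstacle on [y, z]. The triangle y, z, x avoids the interior, so displacements add up in it, and the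
pieces [q, z] and [z, p] sweep no more arc than the time they take. -/
theorem exists_vis_transport (H : IsBoundaryCurve T L γ) (hν : ν ∈ Ioc (0 : ℝ) 1)
    {x y p : Plane} (hxy : Disjoint (segment ℝ x y) T) (hp : Vis T x p) :
    ∃ q, Vis T y q ∧ disp T γ y x + obj T γ ν x p - ‖x - y‖ / ν ≤ obj T γ ν y q := by
  have hx : x ∉ T := disjoint_left.1 hxy (left_mem_segment ℝ x y)
  have hy : y ∉ T := disjoint_left.1 hxy (right_mem_segment ℝ x y)
  obtain ⟨z, hz, hne, hC⟩ := H.exists_last_blocked hxy hp.1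
  obtain ⟨q, hq, hvis⟩ := H.exists_vis_mem_segment hy hne
  refine ⟨q, hvis, ?_⟩
  set C := convexJoin ℝ {y} (segment ℝ z x)
  have hconv : Convex ℝ C := (convex_singleton y).convexJoin (convex_segment z x)
  have hyC : y ∈ C := subset_convexJoin_left ⟨z, left_mem_segment ℝ z x⟩ rfl
  have hzC : z ∈ C := subset_convexJoin_right ⟨y, mem_singleton y⟩ (left_mem_segment ℝ z x)
  have hxC : x ∈ C := subset_convexJoin_right ⟨y, mem_singleton y⟩ (right_mem_segment ℝ z x)
  have hqC : q ∈ C := hconv.segment_subset hyC hzC hq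
  have hfree := hp.disjoint_interior hx
  have e1 := H.disp_add_disp (convex_segment x p) hfree (left_mem_segment ℝ x p) hz
    (right_mem_segment ℝ x p)
  have e2 := H.disp_add_disp hconv hC hyC hxC hzC
  have e3 := H.disp_add_disp hconv hC hyC hqC hzC
  have b1 := le_abs_self _ |>.trans (H.abs_disp_le (hC.mono_left (hconv.segment_subset hqC hzC)))
  have b2 := le_abs_self _ |>.trans (H.abs_disp_le (hfree.mono_left (segment_subset_right hz)))
  have n1 := norm_sub_add_norm_sub_of_mem_segment hz
  have n2 := norm_sub_add_norm_sub_of_mem_segment hq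
  have n3 := norm_sub_le_norm_sub_add_norm_sub y x z
  rw [norm_sub_rev y x] at n3
  have d1 := le_div_of_le_one (norm_nonneg (q - z)) hν
  have d2 := le_div_of_le_one (norm_nonneg (z - p)) hν
  have d3 : (‖y - q‖ + ‖q - z‖) / ν ≤ (‖x - y‖ + ‖x - z‖) / ν := by
    rw [n2]; exact div_le_div_of_nonneg_right n3 hν.1.le
  rw [add_div, add_div] at d3
  rw [obj, obj, ← n1, add_div]
  linarith

/-! ### Hidden points, optimal points and transport of the potential -/

/-- Some boundary point is hidden from `x` by the interior of `T`. -/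
theorem exists_hidden (H : IsBoundaryCurve T L γ) {x : Plane} (hx : x ∉ T) :
    ∃ s₀, ¬ Disjoint (segment ℝ x (γ s₀)) (interior T) := by
  obtain ⟨q, hq⟩ := H.interior_nonempty
  have hne : q - x ≠ 0 := fun h => hx (by
    rw [← sub_eq_zero.1 h]; exact interior_subset hq)
  obtain ⟨r, hr, hm⟩ := H.exists_exit hq hne
  obtain ⟨s₀, -, hs₀⟩ := H.exists_param hm 0
  refine ⟨s₀, not_disjoint_iff.2 ⟨q, ?_, hq⟩⟩
  rw [hs₀]
  refine ⟨r / (1 + r), 1 / (1 + r), by positivity, by positivity, by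
    rw [← add_div, add_comm, div_self (by positivity)], ?_⟩
  have h1 : r / (1 + r) = 1 - 1 / (1 + r) := by field_simp; ring
  have h2 : 1 / (1 + r) * r = 1 - 1 / (1 + r) := by field_simp; ring
  rw [h1, smul_add, smul_smul, h2]
  module

/-- A single hidden point thus cuts the parameter line for all unobstructed segments from `x` at
once. -/
theorem proj_ne_of_hidden (H : IsBoundaryCurve T L γ) {x p z : Plane} (hx : x ∉ T) {s₀ : ℝ}
    (hs₀ : ¬ Disjoint (segment ℝ x (γ s₀)) (interior T)) (hp : p ∈ T)
    (hfree : Disjoint (segment ℝ x p) (interior T)) (hz : z ∈ segment ℝ x p) :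
    proj T z ≠ γ s₀ := by
  intro h
  rw [← h] at hs₀
  by_cases hzT : z ∈ T
  · rw [H.proj_of_mem hzT] at hs₀
    exact hs₀ (hfree.mono_left (segment_subset_left hz))
  · exact hs₀ ((H.vis_proj_of_mem_segment hp hz hzT).disjoint_interior hx)

theorem exists_param_Ioo (H : IsBoundaryCurve T L γ) {p : Plane} (hp : p ∈ frontier T) {s₀ : ℝ}
    (hne : p ≠ γ s₀) : ∃ s ∈ Ioo s₀ (s₀ + L), γ s = p := by
  obtain ⟨s, hs, rfl⟩ := H.exists_param hp s₀
  exact ⟨s, ⟨hs.1.lt_of_ne fun h => hne (h ▸ rfl), hs.2⟩, rfl⟩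

/-- Visible points need not form a closed set, so the maximum is taken over the closed set of points
not screened by the interior; `exists_vis_obj_le` then replaces the maximizer by a visible point. -/
theorem exists_isBest (H : IsBoundaryCurve T L γ) (hν : ν ∈ Ioc (0 : ℝ) 1) {x : Plane}
    (hx : x ∉ T) : ∃ p, IsBest T γ ν x p := by
  obtain ⟨s₀, hs₀⟩ := H.exists_hidden hx
  have hvp := H.vis_proj hx
  obtain ⟨θ, hθI, hθ⟩ := H.exists_param_Ioo (hvp.mem_frontier hx)
    (H.proj_ne_of_hidden hx hs₀ (H.proj_mem x) (H.disjoint_segment_proj hx)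
      (left_mem_segment ℝ x _))
  set K : Set ℝ := Icc s₀ (s₀ + L) ∩ {s | Disjoint (segment ℝ x (γ s)) (interior T)} with hK
  have hclosed : IsClosed {s | Disjoint (segment ℝ x (γ s)) (interior T)} := by
    have : {s | Disjoint (segment ℝ x (γ s)) (interior T)} =
        ⋂ r ∈ Icc (0 : ℝ) 1, {s | (AffineMap.lineMap x (γ s) r : Plane) ∈ (interior T)ᶜ} := by
      ext s
      simp only [mem_ofPred_eq, segment_eq_image_lineMap, disjoint_left, forall_mem_image,
        mem_iInter, mem_compl_iff]
    rw [this]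
    refine isClosed_biInter fun r _ => isOpen_interior.isClosed_compl.preimage ?_
    have := H.continuous
    simp only [AffineMap.lineMap_apply_module]; fun_prop
  have hKc : IsCompact K := isCompact_Icc.inter_right hclosed
  have hdisp : ∀ s ∈ K, disp T γ x (γ s) = s - θ := by
    rintro s ⟨hs, hfree⟩
    have hne := fun z hz => H.proj_ne_of_hidden (z := z) hx hs₀ (H.apply_mem s) hfree hz
    refine H.disp_eq_of_ne hfree hne hθ hθI (H.proj_of_mem (H.apply_mem s)).symm
      ⟨hs.1.lt_of_ne ?_, hs.2.lt_of_ne ?_⟩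
    · rintro rfl; exact hs₀ hfree
    · rintro rfl; rw [mem_ofPred_eq, H.periodic] at hfree; exact hs₀ hfree
  have hθK : θ ∈ K := ⟨Ioo_subset_Icc_self hθI, by
    rw [mem_ofPred_eq, hθ]; exact H.disjoint_segment_proj hx⟩
  have hcont := H.continuous
  obtain ⟨s, hsK, hs⟩ := hKc.exists_isMaxOn ⟨θ, hθK⟩ (f := fun s => s - ‖x - γ s‖ / ν)
    (by fun_prop)
  obtain ⟨q, hq, hle⟩ := H.exists_vis_obj_le hν hx (H.apply_mem s) hsK.2
  refine ⟨q, hq, fun q' hq' => le_trans ?_ hle⟩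
  have hfree' := hq'.disjoint_interior hx
  obtain ⟨s', hs'I, rfl⟩ := H.exists_param_Ioo (hq'.mem_frontier hx) (s₀ := s₀) fun h =>
    hs₀ (h ▸ hfree')
  have hs'K : s' ∈ K := ⟨Ioo_subset_Icc_self hs'I, hfree'⟩
  have : s' - ‖x - γ s'‖ / ν ≤ s - ‖x - γ s‖ / ν := hs hs'K
  rw [obj, obj, hdisp s' hs'K, hdisp s hsK]
  linarith

/-- With the parameter line cut at an invisible point, visible points have parameters in the same
period as the projection. -/
theorem add_disp_mem_Ioo (H : IsBoundaryCurve T L γ) {x p : Plane} (hx : x ∉ T) {s₀ θ : ℝ}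
    (hs₀ : ¬ Vis T x (γ s₀)) (hθ : γ θ = proj T x) (hθI : θ ∈ Ioo s₀ (s₀ + L))
    (hp : Vis T x p) : θ + disp T γ x p ∈ Ioo s₀ (s₀ + L) := by
  obtain ⟨s, hsI, rfl⟩ := H.exists_param_Ioo (hp.mem_frontier hx) (s₀ := s₀) fun h => hs₀ (h ▸ hp)
  rw [H.disp_eq_of_ne (hp.disjoint_interior hx)
    (fun z hz h => hs₀ (h ▸ H.vis_proj_of_vis hx hp hz)) hθ hθI
    (H.proj_of_mem hp.1).symm hsI]
  simpa using hsI

theorem apply_add_disp_of_vis (H : IsBoundaryCurve T L γ) {x p : Plane} (hx : x ∉ T)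
    (hp : Vis T x p) {θ : ℝ} (hθ : γ θ = proj T x) : γ (θ + disp T γ x p) = p := by
  rw [H.apply_add_disp (hp.disjoint_interior hx) hθ, H.proj_of_mem hp.1]

theorem exists_cut (H : IsBoundaryCurve T L γ) {x : Plane} (hx : x ∉ T) :
    ∃ s₀ θ, ¬ Vis T x (γ s₀) ∧ γ θ = proj T x ∧ θ ∈ Ioo s₀ (s₀ + L) := by
  obtain ⟨s₀, hs₀⟩ := H.exists_hidden hx
  have hs₀' : ¬ Vis T x (γ s₀) := fun h => hs₀ (h.disjoint_interior hx)
  have hvp := H.vis_proj hx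
  obtain ⟨θ, hθI, hθ⟩ := H.exists_param_Ioo (hvp.mem_frontier hx) (s₀ := s₀)
    fun h => hs₀' (h ▸ hvp)
  exact ⟨s₀, θ, hs₀', hθ, hθI⟩

theorem disp_sub_disp_lt (H : IsBoundaryCurve T L γ) {x p q : Plane} (hx : x ∉ T)
    (hp : Vis T x p) (hq : Vis T x q) : disp T γ x p - disp T γ x q < L := by
  obtain ⟨s₀, θ, hs₀, hθ, hθI⟩ := H.exists_cut hx
  have h1 := H.add_disp_mem_Ioo hx hs₀ hθ hθI hp
  have h2 := H.add_disp_mem_Ioo hx hs₀ hθ hθI hq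
  linarith [h1.2, h2.1]

/-- The nearest point competes with displacement zero and the least travel time. -/
theorem disp_nonneg_of_isBest (H : IsBoundaryCurve T L γ) (hν : ν ∈ Ioc (0 : ℝ) 1) {x p : Plane}
    (hx : x ∉ T) (hp : IsBest T γ ν x p) : 0 ≤ disp T γ x p := by
  have h1 := hp.2 _ (H.vis_proj hx)
  rw [obj, obj, H.disp_proj hx] at h1
  have h2 := div_le_div_of_nonneg_right (H.norm_sub_proj_le x hp.1.1) hν.1.le
  linarith

theorem pot_nonpos (H : IsBoundaryCurve T L γ) (hν : ν ∈ Ioc (0 : ℝ) 1) (x : Plane) :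
    pot T γ ν x ≤ 0 := by
  by_cases hx : x ∈ T
  · rw [pot, if_pos hx]
  obtain ⟨p, hp⟩ := H.exists_isBest hν hx
  rw [hp.pot_eq hx, obj]
  have h1 := le_abs_self _ |>.trans (H.abs_disp_le (hp.1.disjoint_interior hx))
  have h2 := le_div_of_le_one (norm_nonneg (x - p)) hν
  linarith

theorem le_pot (H : IsBoundaryCurve T L γ) (hν : ν ∈ Ioc (0 : ℝ) 1) (x : Plane) :
    - (‖x - proj T x‖ / ν) ≤ pot T γ ν x := by
  by_cases hx : x ∈ T
  · rw [pot, if_pos hx, H.proj_of_mem hx]; simp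
  obtain ⟨p, hp⟩ := H.exists_isBest hν hx
  have h1 := hp.2 _ (H.vis_proj hx)
  rw [hp.pot_eq hx]
  rw [obj, H.disp_proj hx] at h1
  linarith

/-- An optimal point for `x` is transported to `y`. For the lifted potential Θ + `pot` this bounds
the change by the travel time, the source of the unit speed bound. -/
theorem pot_transport (H : IsBoundaryCurve T L γ) (hν : ν ∈ Ioc (0 : ℝ) 1) {x y : Plane}
    (hxy : Disjoint (segment ℝ x y) T) :
    disp T γ y x + pot T γ ν x - ‖x - y‖ / ν ≤ pot T γ ν y := by
  have hx : x ∉ T := disjoint_left.1 hxy (left_mem_segment ℝ x y)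
  have hy : y ∉ T := disjoint_left.1 hxy (right_mem_segment ℝ x y)
  obtain ⟨p, hp⟩ := H.exists_isBest hν hx
  obtain ⟨q, hq⟩ := H.exists_isBest hν hy
  obtain ⟨q', hq', hle⟩ := H.exists_vis_transport hν hxy hp.1
  rw [hp.pot_eq hx, hq.pot_eq hy]
  exact hle.trans (hq.2 q' hq')

theorem obj_add_of_mem_segment (H : IsBoundaryCurve T L γ) {x p z : Plane} (hx : x ∉ T)
    (hp : Vis T x p) (hz : z ∈ segment ℝ x p) :
    obj T γ ν x p = disp T γ x z + obj T γ ν z p - ‖x - z‖ / ν := by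
  have h1 := H.disp_add_disp (convex_segment x p) (hp.disjoint_interior hx)
    (left_mem_segment ℝ x p) hz (right_mem_segment ℝ x p)
  have h2 := norm_sub_add_norm_sub_of_mem_segment hz
  rw [obj, obj, ← h1, ← h2, add_div]; ring

theorem disjoint_segment_of_vis {x p z : Plane} (hx : x ∉ T) (hp : Vis T x p)
    (hz : z ∈ segment ℝ x p) (hzT : z ∉ T) : Disjoint (segment ℝ x z) T :=
  disjoint_left.2 fun w hw hwT => by
    obtain rfl := hp.eq_of_mem_segment hx (segment_subset_left hz hw) hwT
    have h1 := norm_sub_add_norm_sub_of_mem_segment hw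
    have h2 := norm_sub_add_norm_sub_of_mem_segment hz
    have h3 : ‖w - z‖ = 0 := by
      rw [norm_sub_rev z w] at h2
      linarith [norm_nonneg (w - z)]
    exact hzT (sub_eq_zero.1 (norm_eq_zero.1 h3) ▸ hwT)

/-- Principle of optimality: a better point for `z`, transported back to `x`, would beat `p` there.
-/
theorem isBest_of_mem_segment (H : IsBoundaryCurve T L γ) (hν : ν ∈ Ioc (0 : ℝ) 1) {x p z : Plane}
    (hx : x ∉ T) (hp : IsBest T γ ν x p) (hz : z ∈ segment ℝ x p) (hzT : z ∉ T) :
    IsBest T γ ν z p := by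
  refine ⟨hp.1.of_mem_segment hx hz hzT, fun q hq => ?_⟩
  have hd := disjoint_segment_of_vis hx hp.1 hz hzT
  obtain ⟨q', hq', hle⟩ := H.exists_vis_transport hν (by rwa [segment_symm]) hq
  have h1 := hp.2 q' hq'
  rw [H.obj_add_of_mem_segment hx hp.1 hz] at h1
  rw [norm_sub_rev] at hle
  linarith

/-- Heading straight to the optimal point raises the potential at the maximal rate. -/
theorem pot_of_mem_segment (H : IsBoundaryCurve T L γ) (hν : ν ∈ Ioc (0 : ℝ) 1) {x p z : Plane}
    (hx : x ∉ T) (hp : IsBest T γ ν x p) (hz : z ∈ segment ℝ x p) :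
    pot T γ ν z + disp T γ x z = pot T γ ν x + ‖x - z‖ / ν := by
  have h := H.obj_add_of_mem_segment (ν := ν) hx hp.1 hz
  rw [hp.pot_eq hx]
  by_cases hzT : z ∈ T
  · obtain rfl := hp.1.eq_of_mem_segment hx hz hzT
    rw [pot, if_pos hzT, obj]; ring
  · rw [(H.isBest_of_mem_segment hν hx hp hz hzT).pot_eq hzT]; linarith

end IsBoundaryCurve

/-! ### The angle at a breaching point -/

theorem inner_eq_coord (a b : Plane) : inner ℝ a b = a 0 * b 0 + a 1 * b 1 := by
  simp [PiLp.inner_apply, Fin.sum_univ_two, mul_comm]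

/-- If the line through the origin orthogonal to `n` separates `X` from `Q`, then its direction
makes with `X` an angle at most that of `Q`. -/
theorem norm_mul_inner_le_of_orthogonal {n v X Q : Plane} (hn : n ≠ 0) (hv : inner ℝ n v = 0)
    (hX : 0 ≤ inner ℝ n X) (hQ : inner ℝ n Q ≤ 0) :
    ‖v‖ * inner ℝ X Q ≤ |inner ℝ v X| * ‖Q‖ := by
  rcases eq_or_ne v 0 with rfl | hv0
  · simp
  have hvpos : 0 < ‖v‖ := norm_pos_iff.2 hv0
  have hnn : 0 < inner ℝ n n := real_inner_self_pos.2 hn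
  -- Parseval's identity in the orthogonal frame `n`, `v`, cleared of denominators.
  have key : inner ℝ n n * (inner ℝ v v * inner ℝ X Q) =
      inner ℝ n n * (inner ℝ v X * inner ℝ v Q) + inner ℝ v v * (inner ℝ n X * inner ℝ n Q) := by
    obtain ⟨μ, h0, h1⟩ : ∃ μ : ℝ, v 0 = - μ * n 1 ∧ v 1 = μ * n 0 := by
      rw [inner_eq_coord] at hv hnn
      refine ⟨(n 0 * v 1 - n 1 * v 0) / (n 0 * n 0 + n 1 * n 1), ?_, ?_⟩
      · rw [← neg_div, div_mul_eq_mul_div, eq_div_iff hnn.ne']; linear_combination n 0 * hv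
      · rw [div_mul_eq_mul_div, eq_div_iff hnn.ne']; linear_combination n 1 * hv
    simp only [inner_eq_coord, h0, h1]; ring
  have h1 : inner ℝ v v * (inner ℝ n X * inner ℝ n Q) ≤ 0 :=
    mul_nonpos_of_nonneg_of_nonpos real_inner_self_nonneg
      (mul_nonpos_of_nonneg_of_nonpos hX hQ)
  have h2 : inner ℝ v v * inner ℝ X Q ≤ inner ℝ v X * inner ℝ v Q := by
    refine le_of_mul_le_mul_left ?_ hnn
    linarith
  have h3 : inner ℝ v X * inner ℝ v Q ≤ |inner ℝ v X| * (‖v‖ * ‖Q‖) := by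
    refine (le_abs_self _).trans ?_
    rw [abs_mul]
    exact mul_le_mul_of_nonneg_left (abs_real_inner_le_norm v Q) (abs_nonneg _)
  rw [real_inner_self_eq_norm_sq] at h2
  refine le_of_mul_le_mul_left ?_ hvpos
  nlinarith

namespace IsBoundaryCurve

/-- The bounds for chords telescope over every partition, and the supremum of the polygonal lengths
is the arc length b − a. -/
theorem mul_sub_le_of_chord (H : IsBoundaryCurve T L γ) {ρ : ℝ → ℝ} {a b k : ℝ} (hk : 0 < k)
    (hab : a ≤ b)
    (h : ∀ s ∈ Icc a b, ∀ t ∈ Icc a b, s ≤ t → k * ‖γ s - γ t‖ ≤ ρ t - ρ s) :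
    k * (b - a) ≤ ρ b - ρ a := by
  have hmono : ∀ s ∈ Icc a b, ∀ t ∈ Icc a b, s ≤ t → ρ s ≤ ρ t := fun s hs t ht hst => by
    have := h s hs t ht hst
    have : 0 ≤ k * ‖γ s - γ t‖ := by positivity
    linarith
  have hvar : eVariationOn γ (Icc a b) ≤ ENNReal.ofReal ((ρ b - ρ a) / k) := by
    refine iSup_le fun ⟨n, u, hu, hus⟩ => ?_
    calc ∑ i ∈ Finset.range n, edist (γ (u (i + 1))) (γ (u i))
        ≤ ∑ i ∈ Finset.range n, ENNReal.ofReal ((ρ (u (i + 1)) - ρ (u i)) / k) := by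
          refine Finset.sum_le_sum fun i _ => ?_
          rw [edist_dist, dist_eq_norm, norm_sub_rev]
          refine ENNReal.ofReal_le_ofReal ?_
          rw [le_div_iff₀ hk, mul_comm]
          exact h _ (hus i) _ (hus (i + 1)) (hu i.le_succ)
      _ = ENNReal.ofReal ((ρ (u n) - ρ (u 0)) / k) := by
          rw [← ENNReal.ofReal_sum_of_nonneg fun i _ => div_nonneg
            (sub_nonneg.2 (hmono _ (hus i) _ (hus (i + 1)) (hu i.le_succ))) hk.le,
            ← Finset.sum_div, Finset.sum_range_sub fun i => ρ (u i)]
      _ ≤ _ := by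
          refine ENNReal.ofReal_le_ofReal (div_le_div_of_nonneg_right ?_ hk.le)
          have h1 := hmono _ (hus n) b (right_mem_Icc.2 hab) (hus n).2
          have h2 := hmono a (left_mem_Icc.2 hab) _ (hus 0) (hus 0).1
          linarith
  rw [H.eVariationOn_Icc, ENNReal.ofReal_le_ofReal_iff (div_nonneg (sub_nonneg.2 (hmono a
    (left_mem_Icc.2 hab) b (right_mem_Icc.2 hab) hab)) hk.le), le_div_iff₀ hk] at hvar
  linarith

theorem ne_of_mem_segment_of_ne {x p w₁ w₂ w : Plane} (hxp : x ≠ p) (h₁ : w₁ ∈ segment ℝ x p)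
    (hne₁ : w₁ ≠ p) (h₂ : w₂ ∈ segment ℝ x p) (hne₂ : w₂ ≠ p) (hw : w ∈ segment ℝ w₁ w₂) :
    w ≠ p := by
  have key : ∀ z ∈ segment ℝ x p, z ≠ p → 0 < inner ℝ (x - p) (z - p) := by
    rintro z ⟨a, b, ha, hb, hab, rfl⟩ hne
    obtain rfl : b = 1 - a := by linarith
    have e : a • x + (1 - a) • p - p = a • (x - p) := by module
    have ha0 : a ≠ 0 := by
      rintro rfl
      exact hne (by simp)
    rw [e, real_inner_smul_right]
    exact mul_pos (ha.lt_of_ne ha0.symm) (real_inner_self_pos.2 (sub_ne_zero.2 hxp))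
  have h1 := key w₁ h₁ hne₁
  have h2 := key w₂ h₂ hne₂
  rintro rfl
  obtain ⟨a, b, ha, hb, hab, hw⟩ := hw
  have e : (a • (w₁ - w) + b • (w₂ - w) : Plane) = 0 := by
    obtain rfl : b = 1 - a := by linarith
    rw [← sub_eq_zero] at hw
    rw [← hw]; module
  have e2 : a * inner ℝ (x - w) (w₁ - w) + b * inner ℝ (x - w) (w₂ - w) = 0 := by
    rw [← real_inner_smul_right, ← real_inner_smul_right, ← inner_add_right, e, inner_zero_right]
  rcases ha.eq_or_lt with h | h
  · have : b = 1 := by linarith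
    rw [← h, this] at e2; linarith
  · have h3 := mul_pos h h1
    have h4 := mul_nonneg hb h2.le
    linarith

/-- Growth of the distance from `x` along a chord whose end points are projections of points of
`[x, p]` close to `p`. -/
theorem chord_growth (H : IsBoundaryCurve T L γ) {x p q w₁ w₂ : Plane} (hx : x ∉ T)
    (hp : Vis T x p) (hq : q ∈ T) {K k ζ : ℝ}
    (hK : ∀ c, ‖c - p‖ ≤ ζ → K * ‖q - c‖ < inner ℝ (x - c) (q - c))
    (hk : k * (‖x - p‖ + ζ) ≤ K - 2 * ζ)
    (h₁ : w₁ ∈ segment ℝ x p) (hne₁ : w₁ ≠ p) (hw₁ : ‖w₁ - p‖ ≤ ζ)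
    (h₂ : w₂ ∈ segment ℝ x p) (hne₂ : w₂ ≠ p) (hw₂ : ‖w₂ - p‖ ≤ ζ)
    (hle : ‖x - proj T w₁‖ ≤ ‖x - proj T w₂‖) :
    k * ‖proj T w₁ - proj T w₂‖ ≤ ‖x - proj T w₂‖ - ‖x - proj T w₁‖ := by
  have hxp : x ≠ p := fun h => hx (h ▸ hp.1)
  set c₁ := proj T w₁ with hc₁
  set c₂ := proj T w₂ with hc₂
  have hpp : proj T p = p := H.proj_of_mem hp.1
  have hclose : ∀ w, ‖w - p‖ ≤ ζ → ‖proj T w - p‖ ≤ ζ := fun w hw => by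
    have := H.norm_proj_sub_le w p
    rw [hpp] at this; linarith
  -- The product ⟨w − proj w, c₂ − c₁⟩ is nonpositive at `w₁` and nonnegative at `w₂`; at a zero the
  -- supporting line is parallel to the chord and separates `x` from `q`.
  have hcont : ContinuousOn (fun r : ℝ => inner ℝ (AffineMap.lineMap w₁ w₂ r -
      proj T (AffineMap.lineMap w₁ w₂ r)) (c₂ - c₁)) (Icc 0 1) := by
    have := H.continuous_proj
    simp only [AffineMap.lineMap_apply_module]; fun_prop
  obtain ⟨r, hr, hr0⟩ := intermediate_value_Icc zero_le_one hcont (show (0 : ℝ) ∈ _ by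
    constructor
    · simpa using H.inner_proj_le w₁ (H.proj_mem w₂)
    · have := H.inner_proj_le w₂ (H.proj_mem w₁)
      rw [← neg_sub (proj T w₂) (proj T w₁), inner_neg_right] at this
      simpa using this)
  simp only at hr0
  set w : Plane := AffineMap.lineMap w₁ w₂ r with hw
  have hwseg : w ∈ segment ℝ w₁ w₂ := by
    rw [segment_eq_image_lineMap]; exact ⟨r, hr, rfl⟩
  have hwne := ne_of_mem_segment_of_ne hxp h₁ hne₁ h₂ hne₂ hwseg
  have hwxp := (convex_segment x p).segment_subset h₁ h₂ hwseg
  have hwT : w ∉ T := fun h => hwne (hp.eq_of_mem_segment hx hwxp h)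
  have hwζ : ‖w - p‖ ≤ ζ := by
    have hb := (convex_closedBall p ζ).segment_subset (x := w₁) (y := w₂)
      (by simpa [dist_eq_norm] using hw₁) (by simpa [dist_eq_norm] using hw₂) hwseg
    simpa [dist_eq_norm] using hb
  set c := proj T w with hc
  have hn : w - c ≠ 0 := fun h => hwT (by rw [sub_eq_zero.1 h]; exact H.proj_mem w)
  have hch := norm_mul_inner_le_of_orthogonal (v := c₂ - c₁) hn hr0
    (H.inner_pos_of_mem_segment hp.1 hwxp hwT).le (H.inner_proj_le w hq)
  have hKc := hK c (hclose w hwζ)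
  have hqc : 0 < ‖q - c‖ := by
    rw [norm_pos_iff, sub_ne_zero]
    rintro rfl
    simp at hKc
  have hvK : ‖c₂ - c₁‖ * K ≤ |inner ℝ (c₂ - c₁) (x - c)| := by
    refine le_of_mul_le_mul_right ?_ hqc
    refine le_trans ?_ hch
    rw [mul_assoc]
    exact mul_le_mul_of_nonneg_left hKc.le (norm_nonneg _)
  have b1 := hclose w₁ hw₁
  have b2 := hclose w₂ hw₂
  have b := hclose w hwζ
  rw [← hc₁] at b1
  rw [← hc₂] at b2
  rw [← hc] at b
  have e : ‖x - c₂‖ ^ 2 - ‖x - c₁‖ ^ 2 = -2 * inner ℝ (c₂ - c₁) (x - c)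
      - inner ℝ (c₂ - c₁) ((c - c₁) + (c - c₂)) := by
    rw [← real_inner_self_eq_norm_sq, ← real_inner_self_eq_norm_sq]
    simp only [inner_sub_left, inner_sub_right, inner_add_right, real_inner_comm x,
      real_inner_comm c₁ c₂]
    ring
  have hn4 : ‖(c - c₁) + (c - c₂)‖ ≤ 4 * ζ := by
    have h1 := norm_add_le (c - c₁) (c - c₂)
    have h2 := norm_sub_le_norm_sub_add_norm_sub c p c₁
    have h3 := norm_sub_le_norm_sub_add_norm_sub c p c₂
    rw [norm_sub_rev p c₁] at h2
    rw [norm_sub_rev p c₂] at h3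
    linarith
  have h5 : |inner ℝ (c₂ - c₁) ((c - c₁) + (c - c₂))| ≤ ‖c₂ - c₁‖ * (4 * ζ) :=
    (abs_real_inner_le_norm _ _).trans (mul_le_mul_of_nonneg_left hn4 (norm_nonneg _))
  have hρ1 : ‖x - c₁‖ ≤ ‖x - p‖ + ζ := by
    have := norm_sub_le_norm_sub_add_norm_sub x p c₁
    rw [norm_sub_rev p] at this; linarith
  have hρ2 : ‖x - c₂‖ ≤ ‖x - p‖ + ζ := by
    have := norm_sub_le_norm_sub_add_norm_sub x p c₂
    rw [norm_sub_rev p] at this; linarith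
  -- The angle estimate bounds only an absolute value; its sign is decided by `hle`. Replacing the
  -- chord ends by `c` costs at most 4ζ.
  have hge : ‖c₂ - c₁‖ * (2 * K - 4 * ζ) ≤ ‖x - c₂‖ ^ 2 - ‖x - c₁‖ ^ 2 := by
    have hnn : 0 ≤ ‖x - c₂‖ ^ 2 - ‖x - c₁‖ ^ 2 := by
      have := pow_le_pow_left₀ (norm_nonneg _) hle 2; linarith
    have h6 : |2 * inner ℝ (c₂ - c₁) (x - c)| - |inner ℝ (c₂ - c₁) ((c - c₁) + (c - c₂))| ≤
        |‖x - c₂‖ ^ 2 - ‖x - c₁‖ ^ 2| := by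
      rw [e, ← abs_neg (-2 * _ - _)]
      have := abs_sub_abs_le_abs_sub (2 * inner ℝ (c₂ - c₁) (x - c))
        (- inner ℝ (c₂ - c₁) ((c - c₁) + (c - c₂)))
      rw [abs_neg] at this
      refine this.trans (le_of_eq ?_)
      congr 1; ring
    rw [abs_of_nonneg hnn, abs_mul, abs_two] at h6
    linarith
  rw [norm_sub_rev c₁]
  have hd : 0 < ‖x - p‖ + ζ := by
    have := norm_pos_iff.2 (sub_ne_zero.2 hxp)
    linarith [(norm_nonneg (w - p)).trans hwζ]
  refine le_of_mul_le_mul_right ?_ (mul_pos two_pos hd)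
  have h7 : ‖c₂ - c₁‖ * (2 * (k * (‖x - p‖ + ζ))) ≤ ‖c₂ - c₁‖ * (2 * K - 4 * ζ) :=
    mul_le_mul_of_nonneg_left (by linarith) (norm_nonneg _)
  have h8 : (‖x - c₂‖ - ‖x - c₁‖) * (‖x - c₂‖ + ‖x - c₁‖) ≤
      (‖x - c₂‖ - ‖x - c₁‖) * (2 * (‖x - p‖ + ζ)) :=
    mul_le_mul_of_nonneg_left (by linarith) (by linarith)
  nlinarith

/-- If the cosine at `p` exceeded ν, then along the boundary arc formed by the projections of the
last part of [x, p] the distance from `x` would grow at a rate k > ν. Breaching earlier on that arc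
would save more time than it loses arc, against optimality. -/
theorem inner_le_of_isBest (H : IsBoundaryCurve T L γ) (hν : ν ∈ Ioc (0 : ℝ) 1) {x p q : Plane}
    (hx : x ∉ T) (hp : IsBest T γ ν x p) (hq : q ∈ T) :
    inner ℝ (x - p) (q - p) ≤ ν * ‖x - p‖ * ‖q - p‖ := by
  by_contra! hlt
  have hxp : x ≠ p := fun h => hx (h ▸ hp.1.1)
  have hd : 0 < ‖x - p‖ := norm_pos_iff.2 (sub_ne_zero.2 hxp)
  have hqp : 0 < ‖q - p‖ := by
    rw [norm_pos_iff, sub_ne_zero]; rintro rfl; simp at hlt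
  have hpos : 0 < inner ℝ (x - p) (q - p) := by
    have : 0 ≤ ν * ‖x - p‖ * ‖q - p‖ := by have := hν.1; positivity
    linarith
  obtain ⟨K, hK1, hK2⟩ := exists_between ((lt_div_iff₀ hqp).2 hlt)
  rw [lt_div_iff₀ hqp] at hK2
  obtain ⟨k, hk1, hk2⟩ := exists_between ((lt_div_iff₀ hd).2 hK1)
  rw [lt_div_iff₀ hd] at hk2
  have hk0 : 0 < k := hν.1.trans hk1
  -- a small scale on which the angle at the projection stays under control
  obtain ⟨ζ, hζ0, hζd, hζk, hζK⟩ : ∃ ζ > 0, ζ ≤ ‖x - p‖ ∧ k * (‖x - p‖ + ζ) ≤ K - 2 * ζ ∧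
      ∀ c, ‖c - p‖ ≤ ζ → K * ‖q - c‖ < inner ℝ (x - c) (q - c) := by
    have hev : ∀ᶠ c in nhds p, K * ‖q - c‖ < inner ℝ (x - c) (q - c) :=
      (Continuous.tendsto (by fun_prop) p).eventually_lt (Continuous.tendsto (by fun_prop) p) hK2
    obtain ⟨ε, hε, hball⟩ := Metric.eventually_nhds_iff.1 hev
    refine ⟨min (ε / 2) (min ‖x - p‖ ((K - k * ‖x - p‖) / (k + 2))), ?_, ?_, ?_, ?_⟩
    · refine lt_min (by linarith) (lt_min hd (div_pos (by linarith) (by linarith)))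
    · exact (min_le_right _ _).trans (min_le_left _ _)
    · have : min (ε / 2) (min ‖x - p‖ ((K - k * ‖x - p‖) / (k + 2))) ≤
          (K - k * ‖x - p‖) / (k + 2) := (min_le_right _ _).trans (min_le_right _ _)
      rw [le_div_iff₀ (by linarith)] at this
      linarith
    · intro c hc
      refine hball ?_
      rw [dist_eq_norm]
      have := hc.trans (min_le_left _ _)
      linarith
  obtain ⟨s₀, θ, hs₀, hθ, hθI⟩ := H.exists_cut hx
  have hfree := hp.1.disjoint_interior hx
  obtain ⟨σ, hσ, hσx, hσp⟩ := H.exists_isLift_segment hfree hθ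
  have hsI := H.add_disp_mem_Ioo hx hs₀ hθ hθI hp.1
  have hγp := H.apply_add_disp_of_vis hx hp.1 hθ
  rw [← hσp] at hsI hγp
  -- a point `z₀` of the segment close to `p`
  have hstrict : ∀ z ∈ segment ℝ x p, z ≠ p → σ z < σ p := by
    intro z hz hne
    have hzT : z ∉ T := fun h => hne (hp.1.eq_of_mem_segment hx hz h)
    have hb := H.isBest_of_mem_segment hν hx hp hz hzT
    have h1 := H.disp_nonneg_of_isBest hν hzT hb
    rw [H.disp_eq (convex_segment x p) hσ hz (right_mem_segment ℝ x p)] at h1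
    refine lt_of_le_of_ne (by linarith) fun h => ?_
    -- Projecting to `p` would make x − p an outer normal there, contradicting `hpos`.
    have h2 : proj T z = p := by rw [← hσ.1 z hz, h, hγp]
    have h3 := H.inner_proj_le z hq
    rw [h2] at h3
    obtain ⟨a, b, ha, hb, hab, rfl⟩ := hz
    obtain rfl : b = 1 - a := by linarith
    have e : a • x + (1 - a) • p - p = a • (x - p) := by module
    have ha0 : a ≠ 0 := by rintro rfl; exact hne (by simp)
    rw [e, real_inner_smul_left] at h3
    have := mul_pos (ha.lt_of_ne ha0.symm) hpos
    linarith
  obtain ⟨z₀, hz₀, hz₀ζ⟩ : ∃ z₀ ∈ segment ℝ x p, ‖z₀ - p‖ = ζ := by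
    refine ⟨AffineMap.lineMap p x (ζ / ‖x - p‖), ?_, ?_⟩
    · rw [segment_symm, segment_eq_image_lineMap]
      exact ⟨_, ⟨by positivity, (div_le_one hd).2 hζd⟩, rfl⟩
    · rw [← dist_eq_norm, dist_lineMap_left, dist_eq_norm, norm_sub_rev p x,
        Real.norm_of_nonneg (by positivity), div_mul_cancel₀ _ hd.ne']
  have hz₀p : z₀ ≠ p := by rintro rfl; simp at hz₀ζ; linarith
  -- Beyond σ z₀ the parameters come from points within ζ of `p`; beyond θ the distance from `x` is
  -- monotone.
  set a := max (σ z₀) θ with ha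
  have hap : a < σ p := max_lt (hstrict z₀ hz₀ hz₀p)
    (hσx ▸ hstrict x (left_mem_segment ℝ x p) hxp)
  have hex : ∀ s ∈ Icc a (σ p), ∃ w ∈ segment ℝ x p, ‖w - p‖ ≤ ζ ∧ σ w = s := by
    intro s hs
    have hpre := (convex_segment z₀ p).isPreconnected.image σ
      (hσ.mono (segment_subset_right hz₀)).continuousOn
    obtain ⟨w, hw, hws⟩ := hpre.ordConnected.out (mem_image_of_mem σ (left_mem_segment ℝ z₀ p))
      (mem_image_of_mem σ (right_mem_segment ℝ z₀ p)) ⟨(le_max_left _ _).trans hs.1, hs.2⟩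
    refine ⟨w, segment_subset_right hz₀ hw, ?_, hws⟩
    have := norm_sub_add_norm_sub_of_mem_segment hw
    linarith [norm_nonneg (z₀ - w)]
  have hvis : ∀ s ∈ Icc a (σ p), Vis T x (γ s) ∧ disp T γ x (γ s) = s - θ := by
    intro s hs
    obtain ⟨w, hw, -, rfl⟩ := hex s hs
    have hv : Vis T x (γ (σ w)) := by
      rw [hσ.1 w hw]; exact H.vis_proj_of_vis hx hp.1 hw
    refine ⟨hv, H.disp_eq_of_ne (hv.disjoint_interior hx)
      (fun z hz h => hs₀ (h ▸ H.vis_proj_of_vis hx hv hz)) hθ hθI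
      (H.proj_of_mem hv.1).symm ⟨?_, ?_⟩⟩
    · exact hθI.1.trans_le ((le_max_right _ _).trans hs.1)
    · exact hs.2.trans_lt hsI.2
  have hmono : ∀ s ∈ Icc a (σ p), ∀ t ∈ Icc a (σ p), s ≤ t → ‖x - γ s‖ ≤ ‖x - γ t‖ := by
    intro s hs t ht hst
    obtain ⟨hv, hdt⟩ := hvis t ht
    obtain ⟨z, hz, hzs⟩ := H.exists_proj_eq_of_mem_uIcc (hv.disjoint_interior hx) hθ (s := s) (by
      rw [hdt, add_sub_cancel]
      exact mem_uIcc_of_le ((le_max_right _ _).trans hs.1) hst)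
    rw [← hzs]
    exact H.norm_sub_proj_le_of_mem_segment hv.1 hz
  have hgrow : ∀ t ∈ Ico a (σ p), k * (t - a) ≤ ‖x - γ t‖ - ‖x - γ a‖ := by
    intro t ht
    have hsub : Icc a t ⊆ Icc a (σ p) := Icc_subset_Icc_right ht.2.le
    refine H.mul_sub_le_of_chord (ρ := fun s => ‖x - γ s‖) hk0 ht.1 fun s₁ h₁ s₂ h₂ h₁₂ => ?_
    obtain ⟨w₁, hw₁, hw₁ζ, hσ₁⟩ := hex s₁ (hsub h₁)
    obtain ⟨w₂, hw₂, hw₂ζ, hσ₂⟩ := hex s₂ (hsub h₂)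
    have hm := hmono s₁ (hsub h₁) s₂ (hsub h₂) h₁₂
    have hne₁ : w₁ ≠ p := by rintro rfl; linarith [h₁.2, ht.2]
    have hne₂ : w₂ ≠ p := by rintro rfl; linarith [h₂.2, ht.2]
    rw [← hσ₁, ← hσ₂, hσ.1 w₁ hw₁, hσ.1 w₂ hw₂] at hm ⊢
    exact H.chord_growth hx hp.1 hq hζK hζk hw₁ hne₁ hw₁ζ hw₂ hne₂ hw₂ζ hm
  -- The chord estimate needs points other than `p`, so the end point is reached by continuity.
  have hlim : k * (σ p - a) ≤ ‖x - γ (σ p)‖ - ‖x - γ a‖ := by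
    have hcont := H.continuous
    refine le_of_tendsto_of_tendsto (b := nhdsWithin (σ p) (Iio (σ p)))
      (f := fun t => k * (t - a)) (g := fun t => ‖x - γ t‖ - ‖x - γ a‖)
      (((by fun_prop : Continuous fun t => k * (t - a)).tendsto _).mono_left nhdsWithin_le_nhds)
      (((by fun_prop : Continuous fun t => ‖x - γ t‖ - ‖x - γ a‖).tendsto _).mono_left
        nhdsWithin_le_nhds) ?_
    filter_upwards [Ico_mem_nhdsLT hap] with t ht using hgrow t ht
  obtain ⟨hva, hda⟩ := hvis a ⟨le_rfl, hap.le⟩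
  have hopt := hp.2 _ hva
  rw [obj, obj, hda, show disp T γ x p = σ p - θ by linarith] at hopt
  rw [hγp] at hlim
  have h1 : (‖x - p‖ - ‖x - γ a‖) / ν ≤ σ p - a := by rw [sub_div]; linarith
  rw [div_le_iff₀ hν.1] at h1
  have : ν * (σ p - a) < k * (σ p - a) := mul_lt_mul_of_pos_right hk1 (by linarith)
  linarith

end IsBoundaryCurve

/-! ### Breaching points and the value function -/

theorem arc_eq (hL : 0 < L) {a b : ℝ} (k : ℤ) (h : b + k * L - a ∈ Ico 0 L) :
    arc L a b = b + k * L - a := by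
  have h1 : Int.fract ((b - a) / L) = (b + k * L - a) / L := by
    rw [Int.fract_eq_iff]
    refine ⟨div_nonneg h.1 hL.le, (div_lt_one hL).2 h.2, -k, ?_⟩
    push_cast; field_simp; ring
  rw [arc, h1]; field_simp

theorem arc_eq_sub (hL : 0 < L) {a b : ℝ} (h : b - a ∈ Ico 0 L) : arc L a b = b - a := by
  have := arc_eq hL (a := a) (b := b) 0 (by simpa using h)
  simpa using this

theorem arc_add_int_mul_right (hL : 0 < L) (a b : ℝ) (k : ℤ) :
    arc L a (b + k * L) = arc L a b := by
  rw [arc, arc, show (b + k * L - a) / L = (b - a) / L + k by field_simp; ring,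
    Int.fract_add_intCast]

theorem arc_add_int_mul_left (hL : 0 < L) (a b : ℝ) (k : ℤ) :
    arc L (a + k * L) b = arc L a b := by
  rw [arc, arc, show (b - (a + k * L)) / L = (b - a) / L - k by field_simp; ring,
    Int.fract_sub_intCast]

theorem arc_neg_neg (a b : ℝ) : arc L (-b) (-a) = arc L a b := by
  rw [arc, arc, show -a - -b = b - a by ring]

namespace IsBoundaryCurve

theorem mem_reachable_iff (H : IsBoundaryCurve T L γ) {x : Plane} {s : ℝ} :
    s ∈ reachable T γ x ↔ Vis T x (γ s) :=
  ⟨fun h => ⟨H.apply_mem s, h⟩, fun h => h.2⟩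

/-- Up to a constant, `JL` is the objective `obj`. -/
theorem exists_JL_eq (H : IsBoundaryCurve T L γ) {x : Plane} (hx : x ∉ T) {sD : ℝ}
    (hD : sD ∉ reachable T γ x) :
    ∃ c, ∀ s ∈ reachable T γ x, JL L γ ν s sD x = c + obj T γ ν x (γ s) := by
  rw [H.mem_reachable_iff] at hD
  have hvp := H.vis_proj hx
  obtain ⟨θ, hθI, hθ⟩ := H.exists_param_Ioo (hvp.mem_frontier hx) (s₀ := sD)
    fun h => hD (h ▸ hvp)
  refine ⟨θ - sD, fun s hs => ?_⟩
  rw [H.mem_reachable_iff] at hs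
  have h1 := H.add_disp_mem_Ioo hx hD hθ hθI hs
  obtain ⟨k, hk⟩ := H.eq_iff.1 (H.apply_add_disp_of_vis hx hs hθ).symm
  rw [JL, arc_eq H.pos k (by rw [← hk]; constructor <;> linarith [h1.1, h1.2]), ← hk, obj,
    norm_sub_rev]
  ring

theorem isBest_iff (H : IsBoundaryCurve T L γ) {x : Plane} (hx : x ∉ T) {s : ℝ} :
    (s ∈ reachable T γ x ∧ ∀ sD ∉ reachable T γ x, ∀ s' ∈ reachable T γ x,
      JL L γ ν s' sD x ≤ JL L γ ν s sD x) ↔ IsBest T γ ν x (γ s) := by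
  constructor
  · rintro ⟨hs, hmax⟩
    refine ⟨H.mem_reachable_iff.1 hs, fun q hq => ?_⟩
    obtain ⟨s₀, -, hs₀, -⟩ := H.exists_cut hx
    have hs₀' : s₀ ∉ reachable T γ x := fun h => hs₀ (H.mem_reachable_iff.1 h)
    obtain ⟨c, hc⟩ := H.exists_JL_eq (ν := ν) hx hs₀'
    obtain ⟨s', -, rfl⟩ := H.exists_param (hq.mem_frontier hx) 0
    have hs' := H.mem_reachable_iff.2 hq
    have := hmax s₀ hs₀' s' hs'
    rw [hc s hs, hc s' hs'] at this
    linarith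
  · rintro ⟨hs, hmax⟩
    have hs := H.mem_reachable_iff.2 hs
    refine ⟨hs, fun sD hD s' hs' => ?_⟩
    obtain ⟨c, hc⟩ := H.exists_JL_eq (ν := ν) hx hD
    rw [hc s hs, hc s' hs']
    linarith [hmax _ (H.mem_reachable_iff.1 hs')]

theorem sL_spec (H : IsBoundaryCurve T L γ) (hν : ν ∈ Ioc (0 : ℝ) 1) {x : Plane} (hx : x ∉ T) :
    IsBest T γ ν x (γ (sL T L γ ν x)) := by
  obtain ⟨p, hp⟩ := H.exists_isBest hν hx
  obtain ⟨s, hs, rfl⟩ := H.exists_param (hp.1.mem_frontier hx) 0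
  rw [zero_add] at hs
  have : IsLeftBreachingPoint T L γ ν x (sL T L γ ν x) :=
    Classical.epsilon_spec (p := IsLeftBreachingPoint T L γ ν x)
      ⟨s, hs, (H.isBest_iff hx).2 hp⟩
  exact (H.isBest_iff hx).1 this.2

/-- Negating parameters turns `JR` into `JL` of the reversed curve. -/
theorem sR_spec (H : IsBoundaryCurve T L γ) (hν : ν ∈ Ioc (0 : ℝ) 1) {x : Plane} (hx : x ∉ T) :
    IsBest T (fun s => γ (-s)) ν x (γ (sR T L γ ν x)) := by
  have hr : ∀ s, -s ∈ reachable T (fun s => γ (-s)) x ↔ s ∈ reachable T γ x := fun s => by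
    simp [reachable]
  have hJ : ∀ s sD, JL L (fun s => γ (-s)) ν (-s) (-sD) x = JR L γ ν s sD x := fun s sD => by
    simp [JL, JR, arc_neg_neg]
  have key : ∀ s, (s ∈ reachable T γ x ∧ ∀ sD ∉ reachable T γ x, ∀ s' ∈ reachable T γ x,
      JR L γ ν s' sD x ≤ JR L γ ν s sD x) ↔ IsBest T (fun s => γ (-s)) ν x (γ s) := fun s => by
    have := H.rev.isBest_iff (ν := ν) hx (s := -s)
    simp only [neg_neg] at this
    rw [← this, hr]
    refine and_congr_right fun _ => ⟨fun h sD hD s' hs' => ?_, fun h sD hD s' hs' => ?_⟩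
    · rw [← neg_neg sD, hr] at hD
      rw [← neg_neg s', hr] at hs'
      rw [← neg_neg sD, ← neg_neg s', hJ, hJ]
      exact h _ hD _ hs'
    · rw [← hJ, ← hJ]
      exact h _ (by rwa [hr]) _ (by rwa [hr])
  obtain ⟨p, hp⟩ := H.rev.exists_isBest hν hx
  obtain ⟨s, hs, rfl⟩ := H.exists_param (hp.1.mem_frontier hx) 0
  rw [zero_add] at hs
  have : IsRightBreachingPoint T L γ ν x (sR T L γ ν x) :=
    Classical.epsilon_spec (p := IsRightBreachingPoint T L γ ν x) ⟨s, hs, (key s).2 hp⟩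
  exact (key _).1 this.2

/-- Cauchy–Schwarz for x − p and x − q turns the angle condition into one on distances. -/
theorem norm_sub_norm_le_of_isBest (H : IsBoundaryCurve T L γ) (hν : ν ∈ Ioc (0 : ℝ) 1)
    {x p q : Plane} (hx : x ∉ T) (hp : IsBest T γ ν x p) (hq : q ∈ T) :
    ‖x - p‖ - ‖x - q‖ ≤ ν * ‖q - p‖ := by
  have h := H.inner_le_of_isBest hν hx hp hq
  have hd : 0 < ‖x - p‖ := norm_pos_iff.2 (sub_ne_zero.2 fun h => hx (h ▸ hp.1.1))
  have h2 := real_inner_le_norm (x - p) (x - q)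
  have h3 : inner ℝ (x - p) (x - q) = ‖x - p‖ ^ 2 - inner ℝ (x - p) (q - p) := by
    rw [← real_inner_self_eq_norm_sq, ← inner_sub_right]; congr 1; abel
  refine le_of_mul_le_mul_left ?_ hd
  nlinarith

/-- Coherent real lifts `l`, `r` of the breaching points of `x`, with the travel times `dl`, `dr`. -/
theorem exists_breaching_lifts (H : IsBoundaryCurve T L γ) (hν : ν ∈ Ioc (0 : ℝ) 1) {x : Plane}
    (hx : x ∉ T) {θ : ℝ} (hθ : γ θ = proj T x) :
    ∃ l r dl dr : ℝ, 0 ≤ dl ∧ 0 ≤ dr ∧ r ≤ θ ∧ θ ≤ l ∧ l - r < L ∧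
      θ + pot T γ ν x = l - dl ∧ θ - pot T (fun s => γ (-s)) ν x = r + dr ∧
      l - r + (dl - dr) ≤ L ∧ l - r + (dr - dl) ≤ L ∧
      (∀ sD, JLstar T L γ ν sD x = arc L sD l - dl) ∧
      (∀ sD, JRstar T L γ ν sD x = arc L r sD - dr) ∧
      (∀ sD, DefenderInFront T L γ ν sD x ↔ arc L r sD ≤ l - r) := by
  have hp := H.sL_spec hν hx
  have hq := H.sR_spec hν hx
  set sl := sL T L γ ν x with hsl
  set sr := sR T L γ ν x with hsr
  have hrev := H.disp_rev (hq.1.disjoint_interior hx)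
  have h1 := H.disp_nonneg_of_isBest hν hx hp
  have h2 := H.rev.disp_nonneg_of_isBest hν hx hq
  rw [hrev] at h2
  have h3 := H.disp_sub_disp_lt hx hp.1 hq.1
  have hγl := H.apply_add_disp_of_vis hx hp.1 hθ
  have hγr := H.apply_add_disp_of_vis hx hq.1 hθ
  obtain ⟨k, hk⟩ := H.eq_iff.1 hγl
  obtain ⟨m, hm⟩ := H.eq_iff.1 hγr
  set l := θ + disp T γ x (γ sl) with hl
  set r := θ + disp T γ x (γ sr) with hr
  -- The chord is compared with the complementary arc, from `l` to r + L.
  have hchord : ‖γ sr - γ sl‖ ≤ L - (l - r) := by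
    have := H.dist_le (r + L) l
    rw [H.periodic, hγl, hγr, abs_of_nonneg (by linarith)] at this
    linarith
  have e1 := H.norm_sub_norm_le_of_isBest hν hx hp hq.1.1
  have e2 := H.rev.norm_sub_norm_le_of_isBest hν hx hq hp.1.1
  rw [norm_sub_rev (γ sl)] at e2
  have hf1 : ‖x - γ sl‖ / ν - ‖x - γ sr‖ / ν ≤ ‖γ sr - γ sl‖ := by
    rw [← sub_div, div_le_iff₀ hν.1]; linarith
  have hf2 : ‖x - γ sr‖ / ν - ‖x - γ sl‖ / ν ≤ ‖γ sr - γ sl‖ := by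
    rw [← sub_div, div_le_iff₀ hν.1]; linarith
  refine ⟨l, r, ‖x - γ sl‖ / ν, ‖x - γ sr‖ / ν, div_nonneg (norm_nonneg _) hν.1.le,
    div_nonneg (norm_nonneg _) hν.1.le, by linarith, by linarith, by linarith, ?_, ?_,
    by linarith, by linarith, fun sD => ?_, fun sD => ?_, fun sD => ?_⟩
  · rw [hp.pot_eq hx, obj]; ring
  · rw [hq.pot_eq hx, obj, hrev]; ring
  · rw [JLstar, JL, ← hsl, norm_sub_rev, hk, arc_add_int_mul_right H.pos, ← hk]
  · rw [JRstar, JR, ← hsr, norm_sub_rev, hm, arc_add_int_mul_left H.pos, ← hm]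
  · rw [DefenderInFront, ← hsl, ← hsr, hk, hm, arc_add_int_mul_left H.pos,
      arc_add_int_mul_left H.pos, arc_add_int_mul_right H.pos,
      arc_eq_sub H.pos (a := r) (b := l) ⟨by linarith, by linarith⟩]

/-- The value and the side of the intruder when the defender is in the gap between two consecutive
intervals that it can no longer leave in time. -/
theorem value_of_gap (H : IsBoundaryCurve T L γ) (hν : ν ∈ Ioc (0 : ℝ) 1) {x : Plane}
    (hx : x ∉ T) {θ sD : ℝ} (hθ : γ θ = proj T x)
    (h1 : θ - pot T (fun s => γ (-s)) ν x < sD) (h2 : sD < θ + pot T γ ν x + L) :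
    V T L γ ν sD x = min (sD - (θ - pot T (fun s => γ (-s)) ν x)) (θ + pot T γ ν x + L - sD) ∧
    (InLeftRegion T L γ ν sD x →
      θ + pot T γ ν x + L - sD ≤ sD - (θ - pot T (fun s => γ (-s)) ν x)) ∧
    (¬ InLeftRegion T L γ ν sD x →
      sD - (θ - pot T (fun s => γ (-s)) ν x) ≤ θ + pot T γ ν x + L - sD) := by
  have hpl := H.pot_nonpos hν x
  have hpr := H.rev.pot_nonpos hν x
  obtain ⟨l, r, dl, dr, hdl, hdr, hrθ, hθl, hlr, hg, hh, i1, i2, hJL, hJR, hF⟩ :=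
    H.exists_breaching_lifts hν hx hθ
  have hgh : θ + pot T γ ν x ≤ θ - pot T (fun s => γ (-s)) ν x := by linarith
  rw [hg] at h2 hgh ⊢
  rw [hh] at h1 hgh ⊢
  rw [V, InLeftRegion, hF, hJL, hJR]
  have hL := H.pos
  rcases le_or_gt sD l with c1 | c1
  · -- in front of the intruder, on its left side
    rw [arc_eq_sub hL (a := sD) (b := l) ⟨by linarith, by linarith⟩,
      arc_eq_sub hL (a := r) (b := sD) ⟨by linarith, by linarith⟩]
    have hn : ¬ ((sD - r ≤ l - r ∧ sD - r - dr < l - sD - dl) ∨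
        (¬ sD - r ≤ l - r ∧ l - sD - dl < sD - r - dr)) := by
      rintro (⟨_, h⟩ | ⟨h, _⟩) <;> linarith
    rw [if_neg hn]
    refine ⟨?_, fun h => (hn h).elim, fun _ => by linarith⟩
    -- The far end is not nearer because l − r + (dl − dr) ≤ L.
    rw [min_eq_left (by linarith)]; ring
  -- Before r + L the defender is off the segment from `r` to `l`; from there on it is on the
  -- translate of that segment by `L`.
  rcases lt_or_ge sD (r + L) with c2 | c2
  · have e := arc_eq hL (a := sD) (b := l) 1 (by
      push_cast; constructor <;> linarith)
    push_cast at e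
    rw [e, arc_eq_sub hL (a := r) (b := sD) ⟨by linarith, by linarith⟩]
    have hn : ((sD - r ≤ l - r ∧ sD - r - dr < l + 1 * L - sD - dl) ∨
        (¬ sD - r ≤ l - r ∧ l + 1 * L - sD - dl < sD - r - dr)) ↔
          l + 1 * L - sD - dl < sD - r - dr := by
      constructor
      · rintro (⟨h, _⟩ | ⟨_, h⟩)
        · linarith
        · exact h
      · exact fun h => Or.inr ⟨by linarith, h⟩
    rw [hn]
    refine ⟨?_, fun h => by linarith, fun h => by linarith⟩
    split_ifs with h
    · rw [min_eq_right (by linarith)]; ring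
    · rw [min_eq_left (by linarith)]; ring
  · have e := arc_eq hL (a := sD) (b := l) 1 (by
      push_cast; constructor <;> linarith)
    have e' := arc_eq hL (a := r) (b := sD) (-1) (by
      push_cast; constructor <;> linarith)
    push_cast at e e'
    rw [e, e']
    have hn : ((sD + -1 * L - r ≤ l - r ∧ sD + -1 * L - r - dr < l + 1 * L - sD - dl) ∨
        (¬ sD + -1 * L - r ≤ l - r ∧ l + 1 * L - sD - dl < sD + -1 * L - r - dr)) :=
      Or.inl ⟨by linarith, by linarith⟩
    rw [if_pos hn]
    refine ⟨?_, fun _ => by linarith, fun h => (h hn).elim⟩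
    rw [min_eq_right (by linarith)]; ring

theorem exists_gap_of_value_pos (H : IsBoundaryCurve T L γ) (hν : ν ∈ Ioc (0 : ℝ) 1) {x : Plane}
    (hx : x ∉ T) {sD : ℝ} (hV : 0 < V T L γ ν sD x) :
    ∃ θ, γ θ = proj T x ∧ θ - pot T (fun s => γ (-s)) ν x < sD ∧ sD < θ + pot T γ ν x + L := by
  obtain ⟨θ, hθ⟩ := H.exists_proj_param fun h => hx (interior_subset h)
  have hL := H.pos
  obtain ⟨l, r, dl, dr, hdl, hdr, hrθ, hθl, hlr, hg, hh, i1, i2, hJL, hJR, hF⟩ :=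
    H.exists_breaching_lifts hν hx hθ
  obtain ⟨k, hk⟩ := H.exists_add_int_mul_mem sD r
  have hγ : ∀ m : ℤ, γ (θ + m * L) = proj T x := fun m => by rw [H.apply_add_int_mul, hθ]
  set s := sD + k * L with hs
  have hJL' : JLstar T L γ ν sD x = arc L s l - dl := by
    rw [hJL, hs, arc_add_int_mul_left hL]
  have hJR' : JRstar T L γ ν sD x = arc L r s - dr := by
    rw [hJR, hs, arc_add_int_mul_right hL]
  have hF' : DefenderInFront T L γ ν sD x ↔ s ≤ l := by
    rw [hF, ← arc_add_int_mul_right hL r sD k, ← hs, arc_eq_sub hL ⟨by linarith [hk.1], by linarith [hk.2]⟩]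
    simp
  have ar : arc L r s = s - r := arc_eq_sub hL ⟨by linarith [hk.1], by linarith [hk.2]⟩
  -- it suffices to find the gap for the shifted position
  suffices h : ∃ m : ℤ, θ + m * L - pot T (fun s => γ (-s)) ν x < s ∧
      s < θ + m * L + pot T γ ν x + L by
    obtain ⟨m, h1, h2⟩ := h
    refine ⟨θ + (m - k : ℤ) * L, hγ _, ?_, ?_⟩ <;> push_cast <;> linarith
  have i0 : ∀ c, θ + c - pot T (fun s => γ (-s)) ν x = r + dr + c := fun c => by linarith
  have i0' : ∀ c, θ + c + pot T γ ν x = l - dl + c := fun c => by linarith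
  simp only [i0, i0']
  rw [V, InLeftRegion, hJL', hJR', hF', ar] at hV
  rcases le_or_gt s l with c | c
  · rw [arc_eq_sub hL (a := s) (b := l) ⟨by linarith, by linarith [hk.1]⟩] at hV
    split_ifs at hV with hcase
    -- Here s < g, so the defender stands in the preceding gap.
    · exact ⟨-1, by push_cast; linarith [hk.1], by push_cast; linarith⟩
    · exact ⟨0, by push_cast; linarith, by push_cast; linarith⟩
  · have e := arc_eq hL (a := s) (b := l) 1 (by
      push_cast; constructor <;> linarith [hk.2])
    push_cast at e
    rw [e] at hV
    refine ⟨0, ?_⟩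
    push_cast
    split_ifs at hV with hcase
    · rcases hcase with ⟨h, _⟩ | ⟨_, h⟩
      · linarith
      · constructor <;> linarith
    · have : s - r - dr ≤ l + 1 * L - s - dl := by
        by_contra! h
        exact hcase (Or.inr ⟨by linarith, h⟩)
      constructor <;> linarith

end IsBoundaryCurve

/-! ### Lifted trajectories -/

/-- A function that does not increase just to the right of every time does not increase. -/
theorem le_of_locally_le_right {φ : ℝ → ℝ} {a b : ℝ} (hab : a ≤ b) (hφ : ContinuousOn φ (Icc a b))
    (h : ∀ t ∈ Ico a b, ∃ r > 0, ∀ t' ∈ Icc a b, t < t' → t' < t + r → φ t' ≤ φ t) :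
    φ b ≤ φ a := by
  have hcl : IsClosed ({t | φ t ≤ φ a} ∩ Icc a b) := by
    rw [inter_comm]
    exact hφ.preimage_isClosed_of_isClosed isClosed_Icc isClosed_Iic
  refine hcl.Icc_subset_of_forall_exists_gt (by simp) (fun t ht y hy => ?_)
    (right_mem_Icc.2 hab)
  obtain ⟨r, hr, hle⟩ := h t ht.2
  obtain ⟨t', h1, h2⟩ := exists_between (lt_min (show t < y from hy)
    (lt_min ht.2.2 (show t < t + r by linarith)))
  have h3 := h2.trans_le (min_le_left _ _)
  have h4 := h2.trans_le ((min_le_right _ _).trans (min_le_left _ _))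
  have h5 := h2.trans_le ((min_le_right _ _).trans (min_le_right _ _))
  exact ⟨t', (hle t' ⟨ht.2.1.trans h1.le, h4.le⟩ h1 h5).trans ht.1, h1, h3.le⟩

namespace IsBoundaryCurve

/-- On `T` the potential is squeezed between 0 and minus distance over ν; outside, transport in both
directions gives a local Lipschitz bound. -/
theorem continuous_pot (H : IsBoundaryCurve T L γ) (hν : ν ∈ Ioc (0 : ℝ) 1) :
    Continuous (pot T γ ν) := by
  rw [continuous_iff_continuousAt]
  intro x
  by_cases hx : x ∈ T
  · refine continuousAt_of_locally_lipschitz one_pos (1 / ν) fun y _ => ?_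
    have h1 := H.pot_nonpos hν y
    have h2 := H.le_pot hν y
    have h3 := div_le_div_of_nonneg_right (H.norm_sub_proj_le y hx) hν.1.le
    rw [Real.dist_eq, show pot T γ ν x = 0 by rw [pot, if_pos hx], sub_zero, dist_eq_norm,
      abs_of_nonpos h1, one_div_mul_eq_div]
    linarith
  · obtain ⟨r, hr, hball⟩ := Metric.isOpen_iff.1 H.isClosed.isOpen_compl x hx
    refine continuousAt_of_locally_lipschitz hr (2 / ν) fun y hy => ?_
    have hseg : Disjoint (segment ℝ x y) T := disjoint_left.2 fun z hz =>
      hball ((convex_ball x r).segment_subset (Metric.mem_ball_self hr) hy hz)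
    have h1 := H.pot_transport hν hseg
    have h2 := H.pot_transport hν (x := y) (y := x) (by rwa [segment_symm])
    have h3 := abs_le.1 (H.abs_disp_le (disjoint_interior_of_disjoint hseg))
    rw [H.disp_symm (disjoint_interior_of_disjoint hseg)] at h1
    have h4 := le_div_of_le_one (norm_nonneg (x - y)) hν
    rw [norm_sub_rev y x] at h2
    rw [Real.dist_eq, dist_eq_norm, norm_sub_rev y x, abs_le, mul_comm, ← mul_div_assoc, mul_comm,
      mul_div_assoc]
    constructor <;> linarith

/-- `γ` embeds the circle ℝ/Lℤ, and paths lift along its covering by ℝ. A trajectory may wind around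
`T`, so lifts over convex sets do not suffice here. -/
theorem exists_path_lift (H : IsBoundaryCurve T L γ) {c : ℝ → Plane} {b : ℝ} (hb : 0 ≤ b)
    (hc : ContinuousOn c (Icc 0 b)) (hmem : ∀ t ∈ Icc 0 b, c t ∈ frontier T) {θ₀ : ℝ}
    (hθ₀ : γ θ₀ = c 0) :
    ∃ Θ : ℝ → ℝ, Θ 0 = θ₀ ∧ ContinuousOn Θ (Icc 0 b) ∧ ∀ t ∈ Icc 0 b, γ (Θ t) = c t := by
  have : Fact (0 < L) := ⟨H.pos⟩
  set e : AddCircle L → Plane := H.periodic.lift with he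
  have hcoe : ∀ s : ℝ, e s = γ s := fun s => H.periodic.lift_coe s
  have hecont : Continuous e := by
    rw [(QuotientAddGroup.isQuotientMap_mk (N := AddSubgroup.zmultiples L)).continuous_iff]
    exact H.continuous
  have heinj : Function.Injective e := by
    intro a a' h
    induction a using QuotientAddGroup.induction_on with | _ a => ?_
    induction a' using QuotientAddGroup.induction_on with | _ a' => ?_
    have h' : γ a = γ a' := h
    obtain ⟨k, rfl⟩ := H.eq_iff.1 h'
    rw [QuotientAddGroup.eq]
    exact ⟨k, by simp⟩
  have hemb := hecont.isClosedEmbedding heinj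
  have hex : ∀ t, t ∈ Icc 0 b → ∃ s : AddCircle L, e s = c t := fun t ht => by
    obtain ⟨s, -, hs⟩ := H.exists_param (hmem t ht) 0
    exact ⟨s, hs⟩
  have hmul : ∀ r : unitInterval, b * (r : ℝ) ∈ Icc 0 b := fun r =>
    ⟨mul_nonneg hb r.2.1, mul_le_of_le_one_right hb r.2.2⟩
  choose f hf using fun r : unitInterval => hex _ (hmul r)
  have hfcont : Continuous f := by
    rw [hemb.isInducing.continuous_iff]
    have : e ∘ f = fun r : unitInterval => c (b * r) := funext hf
    rw [this]
    exact hc.comp_continuous (by fun_prop) hmul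
  have hf0 : f 0 = ((θ₀ : ℝ) : AddCircle L) := heinj (by
    rw [hf, hcoe, hθ₀]; simp)
  obtain ⟨Γ, hΓ, hΓ0⟩ := (AddCircle.isCoveringMap_coe L).exists_path_lifts ⟨f, hfcont⟩ θ₀ hf0
  have hΓ' : ∀ r, ((Γ r : ℝ) : AddCircle L) = f r := fun r => congrFun hΓ r
  refine ⟨fun t => Γ (projIcc 0 1 zero_le_one (t / b)), ?_, ?_, fun t ht => ?_⟩
  · simp only [zero_div]
    rw [projIcc_left]; exact hΓ0
  · exact (Γ.continuous.comp (continuous_projIcc.comp (by fun_prop))).continuousOn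
  · simp only
    rw [← hcoe, hΓ', hf]
    rcases hb.eq_or_lt with h | h
    · have : t = 0 := le_antisymm (h ▸ ht.2) ht.1
      rw [← h, this, zero_mul]
    · rw [projIcc_of_mem zero_le_one ⟨div_nonneg ht.1 hb, (div_le_one h).2 ht.2⟩]
      simp only
      rw [mul_div_cancel₀ _ h.ne']

end IsBoundaryCurve

/-- `Θ` is a continuous lift along `γ` of the projection of the trajectory `x` on `[0, b]`, which
stays outside `T` before the time `b` and moves with speed at most `ν`. -/
structure IsTrack (T : Set Plane) (γ : ℝ → Plane) (ν : ℝ) (x : ℝ → Plane) (b : ℝ) (Θ : ℝ → ℝ) :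
    Prop where
  norm_le : ∀ s ∈ Icc 0 b, ∀ t ∈ Icc 0 b, ‖x s - x t‖ ≤ ν * |s - t|
  notMem : ∀ t ∈ Ico 0 b, x t ∉ T
  continuousOn : ContinuousOn Θ (Icc 0 b)
  lift : ∀ t ∈ Icc 0 b, γ (Θ t) = proj T (x t)

namespace IsTrack

variable {x : ℝ → Plane} {b : ℝ} {Θ : ℝ → ℝ}

theorem continuousOn_path (h : IsTrack T γ ν x b Θ) (hν : 0 ≤ ν) : ContinuousOn x (Icc 0 b) :=
  (LipschitzOnWith.of_dist_le_mul (K := ⟨ν, hν⟩) fun s hs t ht => by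
    rw [dist_eq_norm, dist_eq_norm]; exact h.norm_le s hs t ht).continuousOn

theorem rev (h : IsTrack T γ ν x b Θ) : IsTrack T (fun s => γ (-s)) ν x b fun t => - Θ t where
  norm_le := h.norm_le
  notMem := h.notMem
  continuousOn := h.continuousOn.neg
  lift := fun t ht => by simpa using h.lift t ht

theorem add_const (h : IsTrack T γ ν x b Θ) (H : IsBoundaryCurve T L γ) (k : ℤ) :
    IsTrack T γ ν x b fun t => Θ t + k * L where
  norm_le := h.norm_le
  notMem := h.notMem
  continuousOn := h.continuousOn.add continuousOn_const
  lift := fun t ht => by rw [H.apply_add_int_mul, h.lift t ht]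

theorem sub_eq_disp (h : IsTrack T γ ν x b Θ) (H : IsBoundaryCurve T L γ) (hν : 0 ≤ ν)
    {C : Set Plane} (hC : Convex ℝ C) (hfree : Disjoint C (interior T)) {s t : ℝ} (hs : 0 ≤ s)
    (hst : s ≤ t) (ht : t ≤ b) (hx : ∀ r ∈ Icc s t, x r ∈ C) :
    Θ t - Θ s = disp T γ (x s) (x t) := by
  obtain ⟨σ, hσ⟩ := H.exists_isLift hC hfree
  have hsub : Icc s t ⊆ Icc 0 b := Icc_subset_Icc hs ht
  have hs' := left_mem_Icc.2 hst
  have ht' := right_mem_Icc.2 hst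
  rw [H.disp_eq hC hσ (hx s hs') (hx t ht')]
  exact H.sub_eq_sub_of_lift (g := fun r => σ (x r)) isPreconnected_Icc (h.continuousOn.mono hsub)
    (hσ.continuousOn.comp ((h.continuousOn_path hν).mono hsub) hx)
    (fun r hr => (h.lift r (hsub hr)).trans (hσ.1 _ (hx r hr)).symm) hs' ht'

theorem exists_local (h : IsTrack T γ ν x b Θ) (H : IsBoundaryCurve T L γ) (hν : 0 < ν) {s : ℝ}
    (hs : s ∈ Ico 0 b) : ∃ r > 0, ∀ t ∈ Icc 0 b, s < t → t < s + r →
      Disjoint (segment ℝ (x s) (x t)) T ∧ Θ t - Θ s = disp T γ (x s) (x t) := by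
  obtain ⟨r, hr, hball⟩ := Metric.isOpen_iff.1 H.isClosed.isOpen_compl _ (h.notMem s hs)
  refine ⟨r / ν, by positivity, fun t ht hst htr => ?_⟩
  have hmem : ∀ u ∈ Icc s t, x u ∈ Metric.ball (x s) r := fun u hu => by
    rw [Metric.mem_ball, dist_eq_norm]
    have h1 := h.norm_le u ⟨hs.1.trans hu.1, hu.2.trans ht.2⟩ s (Ico_subset_Icc_self hs)
    rw [abs_of_nonneg (by linarith [hu.1])] at h1
    have h2 : u - s < r / ν := by linarith [hu.2]
    rw [lt_div_iff₀ hν] at h2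
    linarith
  have hdisj : Disjoint (Metric.ball (x s) r) T := disjoint_left.2 fun z hz => hball hz
  refine ⟨hdisj.mono_left ((convex_ball _ r).segment_subset (hmem s ⟨le_rfl, hst.le⟩)
    (hmem t ⟨hst.le, le_rfl⟩)), ?_⟩
  exact h.sub_eq_disp H hν.le (convex_ball (x s) r) (disjoint_interior_of_disjoint hdisj) hs.1
    hst.le ht.2 hmem

/-- Along a trajectory the lifted breaching potential moves with speed at most `1`. -/
theorem abs_sub_le (h : IsTrack T γ ν x b Θ) (H : IsBoundaryCurve T L γ) (hν : ν ∈ Ioc (0 : ℝ) 1)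
    {s t : ℝ} (hs : 0 ≤ s) (hst : s ≤ t) (ht : t ≤ b) :
    |Θ t + pot T γ ν (x t) - (Θ s + pot T γ ν (x s))| ≤ t - s := by
  have hcont : ContinuousOn (fun u => Θ u + pot T γ ν (x u)) (Icc s t) :=
    (h.continuousOn.add ((H.continuous_pot hν).comp_continuousOn
      (h.continuousOn_path hν.1.le))).mono (Icc_subset_Icc hs ht)
  have key : ∀ u ∈ Ico s t, ∃ r > 0, ∀ u' ∈ Icc s t, u < u' → u' < u + r →
      |Θ u' + pot T γ ν (x u') - (Θ u + pot T γ ν (x u))| ≤ u' - u := by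
    intro u hu
    obtain ⟨r, hr, hloc⟩ := h.exists_local H hν.1 (s := u) ⟨hs.trans hu.1, hu.2.trans_le ht⟩
    refine ⟨r, hr, fun u' hu' huu' hr' => ?_⟩
    have hu'b : u' ∈ Icc 0 b := ⟨hs.trans hu'.1, hu'.2.trans ht⟩
    obtain ⟨hd, he⟩ := hloc u' hu'b huu' hr'
    have h1 := H.pot_transport hν hd
    have h2 := H.pot_transport hν (x := x u') (y := x u) (by rwa [segment_symm])
    rw [H.disp_symm (disjoint_interior_of_disjoint hd)] at h1
    have h3 := h.norm_le u ⟨hs.trans hu.1, (hu.2.trans_le ht).le⟩ u' hu'b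
    rw [abs_sub_comm, abs_of_nonneg (by linarith)] at h3
    have h4 : ‖x u - x u'‖ / ν ≤ u' - u := by rw [div_le_iff₀ hν.1]; linarith
    rw [norm_sub_rev (x u')] at h2
    rw [abs_le]
    constructor <;> linarith
  rw [abs_le]
  constructor
  · have := le_of_locally_le_right (φ := fun u => -(Θ u + pot T γ ν (x u)) - u) hst
      (hcont.neg.sub continuousOn_id) fun u hu => by
        obtain ⟨r, hr, hk⟩ := key u hu
        refine ⟨r, hr, fun u' h1 h2 h3 => ?_⟩
        have := abs_le.1 (hk u' h1 h2 h3)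
        linarith
    linarith
  · have := le_of_locally_le_right (φ := fun u => (Θ u + pot T γ ν (x u)) - u) hst
      (hcont.sub continuousOn_id) fun u hu => by
        obtain ⟨r, hr, hk⟩ := key u hu
        refine ⟨r, hr, fun u' h1 h2 h3 => ?_⟩
        have := abs_le.1 (hk u' h1 h2 h3)
        linarith
    linarith

/-- Heading straight to the breaching point, the lifted breaching potential moves with speed `1`. -/
theorem eq_of_heading (h : IsTrack T γ ν x b Θ) (H : IsBoundaryCurve T L γ)
    (hν : ν ∈ Ioc (0 : ℝ) 1) {s t : ℝ} (hs : 0 ≤ s) (hst : s ≤ t) (ht : t ≤ b) {p : Plane}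
    (hxs : x s ∉ T) (hp : IsBest T γ ν (x s) p) (hx : ∀ u ∈ Icc s t, x u ∈ segment ℝ (x s) p)
    (hnorm : ‖x s - x t‖ = ν * (t - s)) :
    Θ t + pot T γ ν (x t) = Θ s + pot T γ ν (x s) + (t - s) := by
  have h1 := h.sub_eq_disp H hν.1.le (convex_segment (x s) p) (hp.1.disjoint_interior hxs) hs hst
    ht hx
  have h2 := H.pot_of_mem_segment hν hxs hp (hx t (right_mem_Icc.2 hst))
  rw [hnorm, mul_div_cancel_left₀ _ hν.1.ne'] at h2
  linarith

end IsTrack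

theorem IsBoundaryCurve.exists_track (H : IsBoundaryCurve T L γ) (hν : 0 ≤ ν) {x : ℝ → Plane}
    {b : ℝ} (hb : 0 ≤ b) (hlip : ∀ s ∈ Icc 0 b, ∀ t ∈ Icc 0 b, ‖x s - x t‖ ≤ ν * |s - t|)
    (hout : ∀ t ∈ Ico 0 b, x t ∉ T) (hbi : x b ∉ interior T) {θ₀ : ℝ}
    (hθ₀ : γ θ₀ = proj T (x 0)) : ∃ Θ, IsTrack T γ ν x b Θ ∧ Θ 0 = θ₀ := by
  have hx : ContinuousOn x (Icc 0 b) :=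
    (LipschitzOnWith.of_dist_le_mul (K := ⟨ν, hν⟩) fun s hs t ht => by
      rw [dist_eq_norm, dist_eq_norm]; exact hlip s hs t ht).continuousOn
  obtain ⟨Θ, h0, hc, hl⟩ := H.exists_path_lift hb (H.continuous_proj.comp_continuousOn hx)
    (fun t ht => H.proj_mem_frontier (by
      rcases ht.2.eq_or_lt with rfl | h
      · exact hbi
      · exact fun hi => hout t ⟨ht.1, h⟩ (interior_subset hi))) hθ₀
  exact ⟨Θ, ⟨hlip, hout, hc, hl⟩, h0⟩


/-! ### Plays -/

theorem intervalIntegrable_of_norm_le {E : Type*} [NormedAddCommGroup E] [NormedSpace ℝ E]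
    [MeasurableSpace E] [BorelSpace E] [SecondCountableTopology E] {f : ℝ → E} (hf : Measurable f)
    {M : ℝ} (hM : ∀ t, ‖f t‖ ≤ M) (a b : ℝ) : IntervalIntegrable f volume a b := by
  rw [intervalIntegrable_iff]
  exact Measure.integrableOn_of_bounded (M := M) (by simp) hf.aestronglyMeasurable
    (Filter.Eventually.of_forall hM)

theorem intervalIntegral_of_const {E : Type*} [NormedAddCommGroup E] [NormedSpace ℝ E]
    [CompleteSpace E] {f : ℝ → E} {a b : ℝ} (hab : a ≤ b) {v : E} (h : ∀ r ∈ Ico a b, f r = v) :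
    ∫ r in a..b, f r = (b - a) • v := by
  rw [intervalIntegral.integral_of_le hab, ← integral_Ico_eq_integral_Ioc,
    setIntegral_congr_fun measurableSet_Ico h, setIntegral_const]
  simp [hab]

theorem IsDefenderControl.norm_le {ω : ℝ → ℝ} (h : IsDefenderControl ω) (t : ℝ) : ‖ω t‖ ≤ 1 := h.2 t

theorem defenderPos_sub {ω : ℝ → ℝ} (h : IsDefenderControl ω) (s₀ a b : ℝ) :
    defenderPos s₀ ω b - defenderPos s₀ ω a = ∫ r in a..b, ω r := by
  have hi := intervalIntegrable_of_norm_le h.1 h.norm_le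
  rw [defenderPos, defenderPos, ← intervalIntegral.integral_interval_sub_left (hi 0 b) (hi 0 a)]
  ring

theorem abs_defenderPos_sub_le {ω : ℝ → ℝ} (h : IsDefenderControl ω) (s₀ a b : ℝ) :
    |defenderPos s₀ ω b - defenderPos s₀ ω a| ≤ |b - a| := by
  rw [defenderPos_sub h]
  simpa using intervalIntegral.norm_integral_le_of_norm_le_const (C := 1) (f := ω) (a := a) (b := b)
    fun t _ => h.norm_le t

theorem defenderPos_of_const {ω : ℝ → ℝ} (h : IsDefenderControl ω) (s₀ : ℝ) {a b v : ℝ}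
    (hab : a ≤ b) (hv : ∀ r ∈ Ico a b, ω r = v) :
    defenderPos s₀ ω b = defenderPos s₀ ω a + (b - a) * v := by
  have := defenderPos_sub h s₀ a b
  rw [intervalIntegral_of_const hab hv, smul_eq_mul] at this
  linarith

theorem intruderPos_sub {u : ℝ → Plane} (hu : Measurable u) {M : ℝ} (hM : ∀ t, ‖u t‖ ≤ M)
    (x₀ : Plane) (a b : ℝ) : intruderPos x₀ u b - intruderPos x₀ u a = ∫ r in a..b, u r := by
  have hi := intervalIntegrable_of_norm_le hu hM
  rw [intruderPos, intruderPos, ← intervalIntegral.integral_interval_sub_left (hi 0 b) (hi 0 a)]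
  abel

theorem norm_intruderPos_sub_le {u : ℝ → Plane} (hu : Measurable u) {M : ℝ} (hM : ∀ t, ‖u t‖ ≤ M)
    (hν : ∀ t, 0 ≤ t → ‖u t‖ ≤ ν) (x₀ : Plane) {a b : ℝ} (ha : 0 ≤ a) (hb : 0 ≤ b) :
    ‖intruderPos x₀ u a - intruderPos x₀ u b‖ ≤ ν * |a - b| := by
  rw [intruderPos_sub hu hM]
  refine intervalIntegral.norm_integral_le_of_norm_le_const fun t ht => hν t ?_
  rw [uIoc, mem_Ioc] at ht
  exact (le_min hb ha).trans ht.1.le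

theorem intruderPos_of_const {u : ℝ → Plane} (hu : Measurable u) {M : ℝ} (hM : ∀ t, ‖u t‖ ≤ M)
    (x₀ : Plane) {a b : ℝ} {v : Plane} (hab : a ≤ b) (hv : ∀ r ∈ Ico a b, u r = v) :
    intruderPos x₀ u b = intruderPos x₀ u a + (b - a) • v := by
  have := intruderPos_sub hu hM x₀ a b
  rw [intervalIntegral_of_const hab hv] at this
  rw [← this]; abel

theorem continuousOn_intruderPos {u : ℝ → Plane} (hu : Measurable u) {M : ℝ}
    (hM : ∀ t, ‖u t‖ ≤ M) (x₀ : Plane) : ContinuousOn (intruderPos x₀ u) (Ici 0) := by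
  have hM0 : 0 ≤ M := (norm_nonneg _).trans (hM 0)
  refine (LipschitzOnWith.of_dist_le_mul (K := ⟨M, hM0⟩) fun s hs t ht => ?_).continuousOn
  rw [dist_eq_norm, dist_eq_norm]
  exact norm_intruderPos_sub_le hu hM (fun t _ => hM t) x₀ hs ht

@[simp] theorem intruderPos_zero (x₀ : Plane) (u : ℝ → Plane) : intruderPos x₀ u 0 = x₀ := by
  simp [intruderPos]

@[simp] theorem defenderPos_zero (s₀ : ℝ) (ω : ℝ → ℝ) : defenderPos s₀ ω 0 = s₀ := by
  simp [defenderPos]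

/-- Induction over the sampling times. -/
theorem forall_of_sampling {P : ℝ → Prop} {b τ : ℝ} (hτ : 0 < τ) (h0 : P 0)
    (hstep : ∀ n : ℕ, n * τ ≤ b → P (n * τ) → ∀ t ∈ Icc (n * τ) ((n + 1) * τ), t ≤ b → P t)
    {t : ℝ} (ht : t ∈ Icc 0 b) : P t := by
  have key : ∀ n : ℕ, n * τ ≤ b → P (n * τ) := by
    intro n
    induction n with
    | zero => intro _; simpa using h0
    | succ n ih =>
      intro hn
      push_cast at hn
      have h1 : n * τ ≤ (n + 1) * τ := by nlinarith
      have := hstep n (h1.trans hn) (ih (h1.trans hn)) _ (right_mem_Icc.2 h1) hn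
      push_cast; exact this
  have h1 : (⌊t / τ⌋₊ : ℝ) * τ ≤ t := by
    rw [← le_div_iff₀ hτ]; exact Nat.floor_le (div_nonneg ht.1 hτ.le)
  have h2 : t ≤ (⌊t / τ⌋₊ + 1) * τ := by
    rw [← div_le_iff₀ hτ]; exact (Nat.lt_floor_add_one _).le
  exact hstep _ (h1.trans ht.2) (key _ (h1.trans ht.2)) t ⟨h1, h2⟩ ht.2

namespace IsBoundaryCurve

/-- The breach time and the state there. -/
theorem breach_spec (H : IsBoundaryCurve T L γ) {x₀ : Plane} (hx₀ : x₀ ∉ T) {u : ℝ → Plane}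
    (hu : Measurable u) {M : ℝ} (hM : ∀ t, ‖u t‖ ≤ M) (hne : (targetTimes T x₀ u).Nonempty) :
    0 ≤ breachTime T x₀ u ∧ intruderPos x₀ u (breachTime T x₀ u) ∈ frontier T ∧
      ∀ t ∈ Ico 0 (breachTime T x₀ u), intruderPos x₀ u t ∉ T := by
  have hcont := continuousOn_intruderPos hu hM x₀
  have hcl : IsClosed (targetTimes T x₀ u) := hcont.preimage_isClosed_of_isClosed isClosed_Ici
    H.isClosed
  have hbd : BddBelow (targetTimes T x₀ u) := ⟨0, fun t ht => ht.1⟩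
  have hmem := hcl.csInf_mem hne hbd
  have hout : ∀ t ∈ Ico 0 (breachTime T x₀ u), intruderPos x₀ u t ∉ T := fun t ht h =>
    (csInf_le hbd ⟨ht.1, h⟩).not_gt ht.2
  refine ⟨hmem.1, ?_, hout⟩
  set b := breachTime T x₀ u with hb
  rw [H.isClosed.frontier_eq]
  refine ⟨hmem.2, fun hi => ?_⟩
  have hb0 : 0 < b := hmem.1.lt_of_ne fun h => hx₀ (by
    have := hmem.2
    change intruderPos x₀ u b ∈ T at this
    rwa [← show (0 : ℝ) = b from h, intruderPos_zero] at this)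
  -- An intruder in the interior at time `b` would have been in `T` before.
  have hev : ∀ᶠ t in nhdsWithin b (Iio b), intruderPos x₀ u t ∈ interior T := by
    have h1 : Filter.Tendsto (intruderPos x₀ u) (nhdsWithin b (Ico 0 b))
        (nhds (intruderPos x₀ u b)) :=
      ((hcont b hb0.le).mono fun t ht => ht.1)
    rw [← nhdsWithin_Ico_eq_nhdsLT hb0]
    exact h1 (isOpen_interior.mem_nhds hi)
  obtain ⟨t, ht, ht'⟩ := (hev.and (Ioo_mem_nhdsLT hb0)).exists
  exact hout t ⟨ht'.1.le, ht'.2⟩ (interior_subset ht)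

/-- The payoff in terms of a lift of the breaching point. -/
theorem payoff_eq (H : IsBoundaryCurve T L γ) {s₀ : ℝ} {x₀ : Plane} {ω : ℝ → ℝ} {u : ℝ → Plane}
    (hne : (targetTimes T x₀ u).Nonempty) {θ : ℝ}
    (hθ : γ θ = intruderPos x₀ u (breachTime T x₀ u)) :
    payoff T L γ s₀ x₀ ω u = min (arc L (defenderPos s₀ ω (breachTime T x₀ u)) θ)
      (arc L θ (defenderPos s₀ ω (breachTime T x₀ u))) := by
  obtain ⟨m, hm⟩ := H.exists_add_int_mul_mem θ 0
  rw [zero_add] at hm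
  have hspec := Classical.epsilon_spec
    (p := fun s => s ∈ Ico 0 L ∧ γ s = intruderPos x₀ u (breachTime T x₀ u))
    ⟨θ + m * L, hm, by rw [H.apply_add_int_mul, hθ]⟩
  obtain ⟨k, hk⟩ := H.eq_iff.1 (hθ.trans hspec.2.symm)
  have hk' : perimeterPos L γ (intruderPos x₀ u (breachTime T x₀ u)) = θ + k * L := hk
  rw [payoff, if_pos hne, hk', arc_add_int_mul_right H.pos, arc_add_int_mul_left H.pos]

/-! ### The defender strategy -/

/-- The defender is within `c` of one end of every gap between the intervals `[g + kL, h + kL]`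
that it can reach in time. -/
theorem exists_le_step (H : IsBoundaryCurve T L γ) (hν : ν ∈ Ioc (0 : ℝ) 1) {x : ℝ → Plane}
    {b : ℝ} {Θ s : ℝ → ℝ} (hΘ : IsTrack T γ ν x b Θ) {a t τ c : ℝ} (ha : 0 ≤ a) (hat : a ≤ t)
    (htb : t ≤ b) (htτ : t - a ≤ τ) (hc : 2 * τ ≤ c) (hxa : x a ∉ T)
    (hs : s t = s a + (t - a) * defenderStar T L γ ν (s a) (x a))
    (hinv : min (s a - (Θ a - pot T (fun s => γ (-s)) ν (x a)))
      (Θ a + pot T γ ν (x a) + L - s a) ≤ c) :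
    min (s t - (Θ t - pot T (fun s => γ (-s)) ν (x t))) (Θ t + pot T γ ν (x t) + L - s t) ≤ c := by
  have h1 := abs_le.1 (hΘ.abs_sub_le H hν ha hat htb)
  have h2 := abs_le.1 (hΘ.rev.abs_sub_le H.rev hν ha hat htb)
  have hlift := hΘ.lift a ⟨ha, hat.trans htb⟩
  have hσ : |defenderStar T L γ ν (s a) (x a)| ≤ 1 := by
    rw [defenderStar]; split_ifs <;> simp
  have hσ' := abs_le.1 hσ
  have m1 : -(t - a) ≤ (t - a) * defenderStar T L γ ν (s a) (x a) := by nlinarith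
  have m2 : (t - a) * defenderStar T L γ ν (s a) (x a) ≤ t - a := by nlinarith
  -- Each distance changes by at most 2τ in a step, so the feedback matters only if both exceed c −
  -- 2τ ≥ 0; then the defender is in the gap.
  rcases le_or_gt (s a - (Θ a - pot T (fun s => γ (-s)) ν (x a))) (c - 2 * τ) with c1 | c1
  · exact (min_le_left _ _).trans (by linarith)
  rcases le_or_gt (Θ a + pot T γ ν (x a) + L - s a) (c - 2 * τ) with c2 | c2
  · exact (min_le_right _ _).trans (by linarith)
  obtain ⟨-, hl, hr⟩ := H.value_of_gap hν hxa hlift (sD := s a) (by linarith) (by linarith)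
  by_cases hcase : InLeftRegion T L γ ν (s a) (x a)
  · rw [defenderStar, if_pos hcase] at hs
    rw [min_eq_right (hl hcase)] at hinv
    exact (min_le_right _ _).trans (by linarith)
  · rw [defenderStar, if_neg hcase] at hs
    rw [min_eq_left (hr hcase)] at hinv
    exact (min_le_left _ _).trans (by linarith)

theorem payoff_le_of_defenderStar (H : IsBoundaryCurve T L γ) (hν : ν ∈ Ioc (0 : ℝ) 1) {s₀ : ℝ}
    {x₀ : Plane} (hx₀ : x₀ ∉ T) {τ c : ℝ} (hτ : 0 < τ) (hc : 2 * τ ≤ c)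
    (hVc : V T L γ ν s₀ x₀ ≤ c) {ω : ℝ → ℝ} {u : ℝ → Plane} (hω : IsDefenderControl ω)
    (hu : IsIntruderControl ν u)
    (hfol : DefenderFollows (defenderStar T L γ ν) τ s₀ x₀ ω u) : payoff T L γ s₀ x₀ ω u ≤ c := by
  by_cases hne : (targetTimes T x₀ u).Nonempty
  swap
  · rw [payoff, if_neg hne]; linarith
  obtain ⟨hb0, hbf, hout⟩ := H.breach_spec hx₀ hu.1 hu.2 hne
  set b := breachTime T x₀ u with hb
  obtain ⟨θ₀, hθ₀⟩ := H.exists_proj_param fun h => hx₀ (interior_subset h)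
  obtain ⟨Θ, hΘ, hΘ0⟩ := H.exists_track hν.1.le hb0 (x := intruderPos x₀ u)
    (fun s hs t ht => norm_intruderPos_sub_le hu.1 hu.2 (fun t _ => hu.2 t) x₀ hs.1 ht.1) hout
    hbf.2 (θ₀ := θ₀) (by simpa using hθ₀)
  set s := defenderPos s₀ ω with hs
  set x := intruderPos x₀ u with hx
  have hbT : x b ∈ T := H.isClosed.frontier_subset hbf
  -- All translates are followed, because the defender may pass from one gap to another and the lift
  -- at the breach is not known in advance.
  have inv : ∀ k : ℤ, ∀ t ∈ Icc 0 b, min (s t - (Θ t + k * L - pot T (fun s => γ (-s)) ν (x t)))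
      (Θ t + k * L + pot T γ ν (x t) + L - s t) ≤ c := by
    intro k t ht
    have hk := hΘ.add_const H k
    refine forall_of_sampling (P := fun t => min (s t - (Θ t + k * L -
      pot T (fun s => γ (-s)) ν (x t))) (Θ t + k * L + pot T γ ν (x t) + L - s t) ≤ c) hτ ?_
      (fun n hn ih t ht htb => ?_) ht
    · have hl := hk.lift 0 ⟨le_rfl, hb0⟩
      have hx0 : x 0 = x₀ := intruderPos_zero x₀ u
      have hs0 : s 0 = s₀ := defenderPos_zero s₀ ω
      rw [hs0]
      rw [hx0] at hl ⊢
      by_cases hgap : Θ 0 + k * L - pot T (fun s => γ (-s)) ν x₀ < s₀ ∧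
          s₀ < Θ 0 + k * L + pot T γ ν x₀ + L
      · rw [← (H.value_of_gap hν hx₀ hl hgap.1 hgap.2).1]; exact hVc
      · rw [not_and_or, not_lt, not_lt] at hgap
        rcases hgap with h | h
        · exact (min_le_left _ _).trans (by linarith)
        · exact (min_le_right _ _).trans (by linarith)
    · rcases hn.eq_or_lt with h | h
      · have : t = n * τ := le_antisymm (h ▸ htb) ht.1
        rw [this]; exact ih
      · have hn0 : 0 ≤ n * τ := by positivity
        refine H.exists_le_step hν (s := s) hk hn0 ht.1 htb (τ := τ) (by linarith [ht.2]) hc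
          (hout _ ⟨hn0, h⟩) ?_ ih
        exact defenderPos_of_const hω s₀ ht.1 fun r hr =>
          hfol n r ⟨hr.1, hr.2.trans_le ht.2⟩
  have hpot : pot T γ ν (x b) = 0 := by rw [pot, if_pos hbT]
  have hpot' : pot T (fun s => γ (-s)) ν (x b) = 0 := by rw [pot, if_pos hbT]
  have hΘb : γ (Θ b) = x b := by rw [hΘ.lift b ⟨hb0, le_rfl⟩, H.proj_of_mem hbT]
  rw [H.payoff_eq hne hΘb]
  obtain ⟨k, hk⟩ := H.exists_add_int_mul_mem (s b) (Θ b)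
  have hinv := inv (-k) b ⟨hb0, le_rfl⟩
  rw [hpot, hpot'] at hinv
  push_cast at hinv
  have e1 : arc L (Θ b) (s b) = s b + k * L - Θ b := arc_eq H.pos k ⟨by linarith [hk.1], by linarith [hk.2]⟩
  rcases min_le_iff.1 hinv with h | h
  · exact (min_le_right _ _).trans (by rw [e1]; linarith)
  -- If the defender stands at the breach, the arc is 0 and not `L`.
  · rcases hk.1.eq_or_lt with h0 | h0
    · exact (min_le_right _ _).trans (by rw [e1]; linarith)
    · have e2 : arc L (s b) (Θ b) = Θ b + (1 - k : ℤ) * L - s b := arc_eq H.pos _ (by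
        push_cast; constructor <;> linarith [hk.2])
      push_cast at e2
      exact (min_le_left _ _).trans (by rw [e2]; linarith)

theorem defenderStar_guarantees (H : IsBoundaryCurve T L γ) (hν : ν ∈ Ioc (0 : ℝ) 1) {s₀ : ℝ}
    {x₀ : Plane} (hx₀ : x₀ ∉ T) (hV : 0 ≤ V T L γ ν s₀ x₀) :
    DefenderGuarantees T L γ ν s₀ x₀ (defenderStar T L γ ν) (V T L γ ν s₀ x₀) := by
  refine ⟨fun s x => by rw [defenderStar]; split_ifs <;> simp, fun ε hε => ⟨ε / 2, by linarith, ?_⟩⟩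
  intro τ hτ ω u hω hu hfol
  exact H.payoff_le_of_defenderStar hν hx₀ hτ.1 (by linarith [hτ.2]) (by linarith) hω hu hfol

end IsBoundaryCurve

/-! ### The width and its growth -/

/-- The sum of the two breaching potentials. -/
noncomputable def width (T : Set Plane) (γ : ℝ → Plane) (ν : ℝ) (x : Plane) : ℝ :=
  pot T γ ν x + pot T (fun s => γ (-s)) ν x

theorem width_rev (x : Plane) : width T (fun s => γ (-s)) ν x = width T γ ν x := by
  simp only [width, neg_neg]; ring

namespace IsBoundaryCurve

theorem width_nonpos (H : IsBoundaryCurve T L γ) (hν : ν ∈ Ioc (0 : ℝ) 1) (x : Plane) :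
    width T γ ν x ≤ 0 := by
  have h1 := H.pot_nonpos hν x
  have h2 := H.rev.pot_nonpos hν x
  rw [width]; linarith

/-- The left end g advances by exactly the travel time, the right end h by at most that. -/
theorem width_le_of_mem_segment (H : IsBoundaryCurve T L γ) (hν : ν ∈ Ioc (0 : ℝ) 1)
    {x p y : Plane} (hx : x ∉ T) (hp : IsBest T γ ν x p) (hy : y ∈ segment ℝ x p) (hyT : y ∉ T) :
    width T γ ν x ≤ width T γ ν y := by
  have h1 := H.pot_of_mem_segment hν hx hp hy
  have hd := disjoint_segment_of_vis hx hp.1 hy hyT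
  have h2 := H.rev.pot_transport hν hd
  rw [H.rev.disp_symm (disjoint_interior_of_disjoint hd),
    H.disp_rev (disjoint_interior_of_disjoint hd)] at h2
  rw [width, width]; linarith

/-- Moving by `η` towards one breaching point gains width, according to the angle between the two
viewing directions. -/
theorem width_gain (H : IsBoundaryCurve T L γ) (hν : ν ∈ Ioc (0 : ℝ) 1) {x p q y z : Plane}
    (hx : x ∉ T) (hp : IsBest T γ ν x p) (hq : IsBest T (fun s => γ (-s)) ν x q) {η : ℝ}
    (hη : η < ‖x - proj T x‖) (hy : y ∈ segment ℝ x p) (hyη : ‖x - y‖ = η)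
    (hz : z ∈ segment ℝ x q) (hzη : ‖x - z‖ = η) :
    width T γ ν x + (2 * η - ‖y - z‖) / ν ≤ width T γ ν y := by
  set B := Metric.ball x ‖x - proj T x‖ with hB
  have hBT : Disjoint B T := disjoint_left.2 fun w hw hwT => by
    rw [hB, Metric.mem_ball, dist_eq_norm, norm_sub_rev] at hw
    exact (H.norm_sub_proj_le x hwT).not_gt hw
  have hyB : y ∈ B := by rw [hB, Metric.mem_ball, dist_eq_norm, norm_sub_rev, hyη]; exact hη
  have hzB : z ∈ B := by rw [hB, Metric.mem_ball, dist_eq_norm, norm_sub_rev, hzη]; exact hη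
  have hxB : x ∈ B := Metric.mem_ball_self ((norm_nonneg (x - y)).trans_lt (hyη ▸ hη))
  have hconv : Convex ℝ B := convex_ball _ _
  have hfree := disjoint_interior_of_disjoint hBT
  have h1 := H.pot_of_mem_segment hν hx hp hy
  have h2 := H.rev.pot_of_mem_segment hν hx hq hz
  -- The reversed potential is bounded at `y` through `z`, where it has gained η/ν.
  have h3 := H.rev.pot_transport hν (x := z) (y := y)
    (hBT.mono_left (hconv.segment_subset hzB hyB))
  have h4 := H.rev.disp_add_disp hconv hfree hyB hzB hxB
  have h5 := H.rev.disp_symm (hfree.mono_left (hconv.segment_subset hxB hzB))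
  have h6 := H.disp_rev (hfree.mono_left (hconv.segment_subset hyB hxB))
  have h7 := H.disp_symm (hfree.mono_left (hconv.segment_subset hxB hyB))
  rw [hyη] at h1
  rw [hzη] at h2
  rw [norm_sub_rev z y] at h3
  have h8 : (2 * η - ‖y - z‖) / ν = η / ν + η / ν - ‖y - z‖ / ν := by ring
  rw [width, width, h8]
  linarith

/-- Viewing directions of a distant convex set are not opposite to each other. -/
theorem norm_sub_le_of_directions (H : IsBoundaryCurve T L γ) {x p q : Plane} {r M : ℝ}
    (hr : 0 < r) (hxr : r ≤ ‖x - proj T x‖) (hp : p ∈ T) (hq : q ∈ T) (hpM : ‖x - p‖ ≤ M)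
    (hqM : ‖x - q‖ ≤ M) :
    ‖‖p - x‖⁻¹ • (p - x) - ‖q - x‖⁻¹ • (q - x)‖ ≤ 2 - r ^ 2 / M ^ 2 := by
  set n := x - proj T x with hn
  have hn0 : 0 < ‖n‖ := hr.trans_le hxr
  have hdir : ∀ p ∈ T, ‖x - p‖ ≤ M → ‖(‖p - x‖⁻¹ • (p - x) : Plane)‖ = 1 ∧
      r / M * ‖n‖ ≤ - inner ℝ n (‖p - x‖⁻¹ • (p - x)) := by
    intro p hp hpM
    have h1 := H.inner_proj_le x hp
    have h2 : inner ℝ n (p - x) = inner ℝ n (p - proj T x) - ‖n‖ ^ 2 := by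
      rw [← real_inner_self_eq_norm_sq, ← inner_sub_right]; congr 1; rw [hn]; abel
    have hd : 0 < ‖p - x‖ := by
      rw [norm_sub_rev]
      exact hn0.trans_le (H.norm_sub_proj_le x hp)
    have hM : 0 < M := by rw [norm_sub_rev] at hd; linarith
    refine ⟨by rw [norm_smul, norm_inv, norm_norm, inv_mul_cancel₀ hd.ne'], ?_⟩
    rw [real_inner_smul_right, ← mul_neg]
    have h3 : r * ‖n‖ ≤ - inner ℝ n (p - x) := by nlinarith
    rw [norm_sub_rev] at hpM
    calc r / M * ‖n‖ = M⁻¹ * (r * ‖n‖) := by ring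
      _ ≤ ‖p - x‖⁻¹ * (r * ‖n‖) := by gcongr
      _ ≤ _ := by gcongr
  obtain ⟨hp1, hp2⟩ := hdir p hp hpM
  obtain ⟨hq1, hq2⟩ := hdir q hq hqM
  set e := (‖p - x‖⁻¹ • (p - x) : Plane)
  set f := (‖q - x‖⁻¹ • (q - x) : Plane)
  have hM : 0 < M := by
    have := hn0.trans_le (H.norm_sub_proj_le x hp); linarith
  have hrM : r / M ≤ 1 := by
    rw [div_le_one hM]
    exact hxr.trans ((H.norm_sub_proj_le x hp).trans hpM)
  have hrM0 : 0 ≤ r / M := by positivity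
  -- Both directions have a component of at least r/M against `n`; the parallelogram law turns this
  -- lower bound for e + f into an upper one for e − f.
  have hsum : 2 * (r / M) ≤ ‖e + f‖ := by
    refine le_of_mul_le_mul_right ?_ hn0
    have h1 := abs_real_inner_le_norm n (e + f)
    have h2 := neg_abs_le (inner ℝ n (e + f))
    rw [inner_add_right] at h1 h2
    linarith
  have hpar := parallelogram_law_with_norm ℝ e f
  rw [hp1, hq1] at hpar
  rw [show r ^ 2 / M ^ 2 = (r / M) ^ 2 by ring]
  refine le_of_sq_le_sq ?_ (by nlinarith)
  nlinarith [sq_nonneg ((r / M) ^ 2)]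

/-- A breaching point is close to an intruder that is close to the target, if the intruder is
slower than the defender or the target is strictly convex. -/
theorem exists_near (H : IsBoundaryCurve T L γ) (hν : ν ∈ Ioc (0 : ℝ) 1)
    (hcase : ν < 1 ∨ StrictConvex ℝ T) {η : ℝ} (hη : 0 < η) :
    ∃ r > 0, ∀ x ∉ T, ‖x - proj T x‖ < r → ∀ p, IsBest T γ ν x p → ‖x - p‖ < η := by
  rcases hcase with hν1 | hstrict
  · refine ⟨η * (1 - ν) / 2, by have : 0 < 1 - ν := by linarith
                                positivity, fun x hx hxr p hp => ?_⟩
    have h1 := H.norm_sub_norm_le_of_isBest hν hx hp (H.proj_mem x)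
    have h2 := norm_sub_le_norm_sub_add_norm_sub (proj T x) x p
    rw [norm_sub_rev (proj T x) x] at h2
    have h3 := mul_le_mul_of_nonneg_left h2 hν.1.le
    have h4 : ν * ‖x - proj T x‖ ≤ ‖x - proj T x‖ := mul_le_of_le_one_left (norm_nonneg _) hν.2
    by_contra! h
    have h5 : η * (1 - ν) ≤ ‖x - p‖ * (1 - ν) := mul_le_mul_of_nonneg_right h (by linarith)
    linarith
  · by_contra! hno
    choose x hxT hx p hp hxp using fun n : ℕ => hno (1 / ((n : ℝ) + 1)) Nat.one_div_pos_of_nat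
    obtain ⟨⟨y, q⟩, hyq, φ, hφ, hlim⟩ := (H.compact.prod H.compact).tendsto_subseq
      (x := fun n => (proj T (x n), p n)) fun n => ⟨H.proj_mem _, (hp n).1.1⟩
    have hy : Filter.Tendsto (fun n => proj T (x (φ n))) Filter.atTop (nhds y) :=
      (continuous_fst.tendsto _).comp hlim
    have hq : Filter.Tendsto (fun n => p (φ n)) Filter.atTop (nhds q) :=
      (continuous_snd.tendsto _).comp hlim
    have h0 : Filter.Tendsto (fun n => x (φ n) - proj T (x (φ n))) Filter.atTop (nhds 0) := by
      refine squeeze_zero_norm (fun n => (hx (φ n)).le) ?_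
      exact (tendsto_one_div_add_atTop_nhds_zero_nat (𝕜 := ℝ)).comp hφ.tendsto_atTop
    have hxlim : Filter.Tendsto (fun n => x (φ n)) Filter.atTop (nhds y) := by
      have := h0.add hy
      simpa using this
    have hyq' : η ≤ ‖y - q‖ := ge_of_tendsto' (hxlim.sub hq).norm fun n => hxp (φ n)
    have hne : y ≠ q := by rintro rfl; simp at hyq'; linarith
    -- Intruder and breaching point tend to distinct points of `T`, whose midpoint is interior; so
    -- some midpoint of [x, p] lies in `T`, against visibility.
    have hmid : (1 / 2 : ℝ) • y + (1 / 2 : ℝ) • q ∈ interior T :=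
      hstrict hyq.1 hyq.2 hne (by norm_num) (by norm_num) (by norm_num)
    have hmlim : Filter.Tendsto (fun n => (1 / 2 : ℝ) • x (φ n) + (1 / 2 : ℝ) • p (φ n))
        Filter.atTop (nhds ((1 / 2 : ℝ) • y + (1 / 2 : ℝ) • q)) :=
      (hxlim.const_smul _).add (hq.const_smul _)
    obtain ⟨n, hn⟩ := (hmlim.eventually (isOpen_interior.mem_nhds hmid)).exists
    refine disjoint_left.1 (hp (φ n)).1.2 ?_ (interior_subset hn)
    exact ⟨1 / 2, 1 / 2, by norm_num, by norm_num, by norm_num, rfl⟩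

/-- The travel time is `disp` − `pot`, and `disp` < L. Since `width` grows along a play, this keeps
breaching points at bounded distance. -/
theorem norm_sub_le_of_width (H : IsBoundaryCurve T L γ) (hν : ν ∈ Ioc (0 : ℝ) 1) {x p : Plane}
    (hx : x ∉ T) (hp : IsBest T γ ν x p) : ‖x - p‖ ≤ L - width T γ ν x := by
  have h1 := H.rev.pot_nonpos hν x
  have h2 := hp.pot_eq hx
  have h3 := H.disp_sub_disp_lt hx hp.1 (H.vis_proj hx)
  rw [H.disp_proj hx] at h3
  have h4 := le_div_of_le_one (norm_nonneg (x - p)) hν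
  rw [obj] at h2
  rw [width]; linarith

theorem exists_mem_segment_norm_eq {x p : Plane} {η : ℝ} (h0 : 0 ≤ η) (h : η ≤ ‖x - p‖)
    (hxp : x ≠ p) :
    x + η • (‖p - x‖⁻¹ • (p - x)) ∈ segment ℝ x p ∧
      ‖x - (x + η • (‖p - x‖⁻¹ • (p - x)))‖ = η := by
  have hd : 0 < ‖p - x‖ := norm_pos_iff.2 (sub_ne_zero.2 hxp.symm)
  rw [norm_sub_rev x p] at h
  constructor
  · rw [segment_eq_image']
    refine ⟨η / ‖p - x‖, ⟨by positivity, (div_le_one hd).2 h⟩, ?_⟩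
    simp only [smul_smul, div_eq_mul_inv]
  · rw [sub_add_cancel_left, norm_neg, norm_smul, norm_smul, norm_inv, norm_norm,
      inv_mul_cancel₀ hd.ne', mul_one, Real.norm_of_nonneg h0]

/-- A straight move to a breaching point, of length at least `η`, from a position at distance at
least `r` gains a definite amount of width. -/
theorem width_gain_of_far (H : IsBoundaryCurve T L γ) (hν : ν ∈ Ioc (0 : ℝ) 1) {x p y : Plane}
    (hx : x ∉ T) (hp : IsBest T γ ν x p) {r η w₀ : ℝ} (hη0 : 0 < η) (hηr : η < r)
    (hxr : r ≤ ‖x - proj T x‖) (hw₀ : w₀ ≤ width T γ ν x) (hy : y ∈ segment ℝ x p) (hyT : y ∉ T)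
    (hxy : η ≤ ‖x - y‖) :
    width T γ ν x + η * (r ^ 2 / (L - w₀) ^ 2) ≤ width T γ ν y := by
  obtain ⟨q, hq⟩ := H.rev.exists_isBest hν hx
  have hxp : x ≠ p := fun h => hx (h ▸ hp.1.1)
  have hxq : x ≠ q := fun h => hx (h ▸ hq.1.1)
  have hxy' : x ≠ y := by rintro rfl; simp at hxy; linarith
  have hηp : η ≤ ‖x - p‖ := hηr.le.trans (hxr.trans (H.norm_sub_proj_le x hp.1.1))
  have hηq : η ≤ ‖x - q‖ := hηr.le.trans (hxr.trans (H.norm_sub_proj_le x hq.1.1))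
  have hpM := H.norm_sub_le_of_width hν hx hp
  have hqM := H.rev.norm_sub_le_of_width hν hx hq
  rw [width_rev] at hqM
  obtain ⟨hz, hzη⟩ := exists_mem_segment_norm_eq hη0.le hηp hxp
  obtain ⟨hz', hzη'⟩ := exists_mem_segment_norm_eq hη0.le hηq hxq
  have hgain := H.width_gain hν hx hp hq (hηr.trans_le hxr) hz hzη hz' hzη'
  have hdir := H.norm_sub_le_of_directions (hη0.trans hηr) hxr hp.1.1 hq.1.1 (M := L - w₀)
    (by linarith) (by linarith)
  set z := x + η • (‖p - x‖⁻¹ • (p - x)) with hzdef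
  have hzT : z ∉ T := fun h => by
    have := H.norm_sub_proj_le x h
    rw [hzη] at this; linarith
  have hnorm : ‖z - (x + η • (‖q - x‖⁻¹ • (q - x)))‖ =
      η * ‖‖p - x‖⁻¹ • (p - x) - ‖q - x‖⁻¹ • (q - x)‖ := by
    rw [hzdef, add_sub_add_left_eq_sub, ← smul_sub, norm_smul, Real.norm_of_nonneg hη0.le]
  rw [hnorm] at hgain
  -- The gain is obtained at `z`, at distance η from `x`; on the rest of the way `width` does not
  -- decrease.
  have hyz : y ∈ segment ℝ z p := by
    have hpos : 0 < ‖p - x‖ := norm_pos_iff.2 (sub_ne_zero.2 hxp.symm)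
    rw [segment_eq_image'] at hy
    obtain ⟨t, ht, rfl⟩ := hy
    simp only [sub_add_cancel_left, norm_neg, norm_smul, Real.norm_of_nonneg ht.1] at hxy
    have ht' : η / ‖p - x‖ ≤ t := (div_le_iff₀ hpos).2 hxy
    have hs1 : η / ‖p - x‖ ≤ 1 := ht'.trans ht.2
    have hseg : AffineMap.lineMap x p '' segment ℝ (η / ‖p - x‖) (1 : ℝ) = segment ℝ z p := by
      rw [image_segment, AffineMap.lineMap_apply_one, hzdef, AffineMap.lineMap_apply_module',
        smul_smul, div_eq_mul_inv, add_comm x]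
    rw [← hseg, segment_eq_Icc hs1]
    exact ⟨t, ⟨ht', ht.2⟩, by rw [AffineMap.lineMap_apply_module', add_comm]⟩
  have hmono := H.width_le_of_mem_segment hν hzT (H.isBest_of_mem_segment hν hx hp hz hzT) hyz hyT
  have h1 : η * (r ^ 2 / (L - w₀) ^ 2) ≤
      2 * η - η * ‖‖p - x‖⁻¹ • (p - x) - ‖q - x‖⁻¹ • (q - x)‖ := by
    have := mul_le_mul_of_nonneg_left hdir hη0.le
    linarith
  have h2 := le_div_of_le_one ((by positivity : 0 ≤ η * (r ^ 2 / (L - w₀) ^ 2)).trans h1) hν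
  linarith

end IsBoundaryCurve

/-! ### The intruder strategy -/

theorem norm_headTo_le (hν : 0 ≤ ν) (x y : Plane) : ‖headTo ν x y‖ ≤ ν := by
  rw [headTo, norm_smul, norm_smul, norm_inv, norm_norm, Real.norm_of_nonneg hν]
  exact mul_le_of_le_one_right hν inv_mul_le_one

theorem norm_intruderStar_le (hν : 0 ≤ ν) (s : ℝ) (x : Plane) :
    ‖intruderStar T L γ ν s x‖ ≤ ν := by
  rw [intruderStar]; split_ifs <;> exact norm_headTo_le hν _ _

/-- Heading to `p`, the intruder stays on the segment to `p` as long as it has not arrived. -/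
theorem mem_segment_of_heading (hν : 0 < ν) {x : ℝ → Plane} {p : Plane} (hp : p ∈ T) {a t : ℝ}
    (ha : x a ∉ T) (hx : ∀ r ∈ Icc a t, x r = x a + (r - a) • headTo ν (x a) p)
    (hout : ∀ r ∈ Ico a t, x r ∉ T) :
    ∀ r ∈ Icc a t, x r ∈ segment ℝ (x a) p ∧ ‖x a - x r‖ = ν * (r - a) := by
  have hd : 0 < ‖p - x a‖ := norm_pos_iff.2 (sub_ne_zero.2 fun h => ha (h ▸ hp))
  have hle : ∀ r ∈ Icc a t, ν * (r - a) ≤ ‖p - x a‖ := by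
    intro r hr
    by_contra! h
    have h1 : ‖p - x a‖ / ν < r - a := (div_lt_iff₀' hν).2 h
    have h0 : 0 < ‖p - x a‖ / ν := by positivity
    -- This is the arrival time at `p`.
    refine hout (a + ‖p - x a‖ / ν) ⟨by linarith, by linarith [hr.2]⟩ ?_
    rw [hx _ ⟨by linarith, by linarith [hr.2]⟩, headTo, add_sub_cancel_left, smul_smul,
      div_mul_cancel₀ _ hν.ne', smul_smul, mul_inv_cancel₀ hd.ne', one_smul, add_sub_cancel]
    exact hp
  intro r hr
  have h0 : 0 ≤ ν * (r - a) := mul_nonneg hν.le (sub_nonneg.2 hr.1)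
  have hxr : x r = x a + (ν * (r - a)) • (‖p - x a‖⁻¹ • (p - x a)) := by
    rw [hx r hr, headTo, smul_smul, mul_comm]
  rw [hxr]
  exact IsBoundaryCurve.exists_mem_segment_norm_eq h0 (norm_sub_rev p (x a) ▸ hle r hr)
    fun h => ha (h ▸ hp)

namespace IsBoundaryCurve

/-- The breaching point to which the intruder strategy heads. -/
theorem intruderStar_cases (H : IsBoundaryCurve T L γ) (hν : ν ∈ Ioc (0 : ℝ) 1) {x : Plane}
    (hx : x ∉ T) (s : ℝ) : ∃ p, intruderStar T L γ ν s x = headTo ν x p ∧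
      ((InLeftRegion T L γ ν s x ∧ IsBest T γ ν x p) ∨
        (¬ InLeftRegion T L γ ν s x ∧ IsBest T (fun s => γ (-s)) ν x p)) := by
  by_cases h : InLeftRegion T L γ ν s x
  · exact ⟨_, by rw [intruderStar, if_pos h], Or.inl ⟨h, H.sL_spec hν hx⟩⟩
  · exact ⟨_, by rw [intruderStar, if_neg h], Or.inr ⟨h, H.sR_spec hν hx⟩⟩

theorem width_le_of_heading (H : IsBoundaryCurve T L γ) (hν : ν ∈ Ioc (0 : ℝ) 1)
    {x p y : Plane} (hx : x ∉ T) (hp : IsBest T γ ν x p) (hy : y ∈ segment ℝ x p) :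
    width T γ ν x ≤ width T γ ν y := by
  by_cases hyT : y ∈ T
  · rw [width.eq_def T γ ν y, pot, pot, if_pos hyT, if_pos hyT, add_zero]
    exact H.width_nonpos hν x
  · exact H.width_le_of_mem_segment hν hx hp hy hyT

/-- Heading to the left breaching point keeps both distances of the defender to the ends of
the gap large, if the right one is the larger. -/
theorem le_step_of_heading (H : IsBoundaryCurve T L γ) (hν : ν ∈ Ioc (0 : ℝ) 1) {x : ℝ → Plane}
    {b : ℝ} {Θ s : ℝ → ℝ} (hΘ : IsTrack T γ ν x b Θ) {a t τ c : ℝ} (ha : 0 ≤ a) (hat : a ≤ t)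
    (htb : t ≤ b) (htτ : t - a ≤ τ) (hxa : x a ∉ T) {p : Plane} (hp : IsBest T γ ν (x a) p)
    (hx : ∀ r ∈ Icc a t, x r ∈ segment ℝ (x a) p ∧ ‖x a - x r‖ = ν * (r - a))
    (hs : |s t - s a| ≤ t - a)
    (hle : Θ a + pot T γ ν (x a) + L - s a ≤ s a - (Θ a - pot T (fun s => γ (-s)) ν (x a)))
    (h1 : c - 2 * τ ≤ Θ a + pot T γ ν (x a) + L - s a)
    (h2 : 2 * c ≤ L + width T γ ν (x a)) :
    c - 2 * τ ≤ s t - (Θ t - pot T (fun s => γ (-s)) ν (x t)) ∧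
      c - 2 * τ ≤ Θ t + pot T γ ν (x t) + L - s t ∧ 2 * c ≤ L + width T γ ν (x t) := by
  have e1 := hΘ.eq_of_heading H hν ha hat htb hxa hp (fun r hr => (hx r hr).1)
    (hx t ⟨hat, le_rfl⟩).2
  have e2 := abs_le.1 (hΘ.rev.abs_sub_le H.rev hν ha hat htb)
  have e3 := H.width_le_of_heading hν hxa hp (hx t ⟨hat, le_rfl⟩).1
  have e4 := abs_le.1 hs
  have e5 := width.eq_def T γ ν (x a)
  exact ⟨by linarith, by linarith, by linarith⟩

theorem width_gain_of_heading (H : IsBoundaryCurve T L γ) (hν : ν ∈ Ioc (0 : ℝ) 1)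
    {x p y : Plane} (hx : x ∉ T) (hp : IsBest T γ ν x p ∨ IsBest T (fun s => γ (-s)) ν x p)
    {r η w₀ : ℝ} (hη0 : 0 < η) (hηr : η < r) (hxr : r ≤ ‖x - proj T x‖)
    (hw₀ : w₀ ≤ width T γ ν x) (hy : y ∈ segment ℝ x p) (hyT : y ∉ T) (hxy : η ≤ ‖x - y‖) :
    width T γ ν x + η * (r ^ 2 / (L - w₀) ^ 2) ≤ width T γ ν y := by
  rcases hp with hp | hp
  · exact H.width_gain_of_far hν hx hp hη0 hηr hxr hw₀ hy hyT hxy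
  · rw [← width_rev x] at hw₀ ⊢
    rw [← width_rev y]
    exact H.rev.width_gain_of_far hν hx hp hη0 hηr hxr hw₀ hy hyT hxy

/-- An intruder that heads to a breaching point in every step reaches the target. -/
theorem exists_mem_of_heading (H : IsBoundaryCurve T L γ) (hν : ν ∈ Ioc (0 : ℝ) 1)
    (hcase : ν < 1 ∨ StrictConvex ℝ T) {η : ℝ} (hη : 0 < η) {x : ℕ → Plane}
    (hx : ∀ n, x n ∉ T → x (n + 1) ∉ T →
      ∃ p, (IsBest T γ ν (x n) p ∨ IsBest T (fun s => γ (-s)) ν (x n) p) ∧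
        x (n + 1) ∈ segment ℝ (x n) p ∧ ‖x n - x (n + 1)‖ = η) : ∃ n, x n ∈ T := by
  by_contra! hno
  obtain ⟨r₁, hr₁, hn₁⟩ := H.exists_near hν hcase hη
  obtain ⟨r₂, hr₂, hn₂⟩ := H.rev.exists_near hν hcase hη
  set r := min r₁ r₂
  have hr : 0 < r := lt_min hr₁ hr₂
  set w := fun n => width T γ ν (x n)
  set d := min r η / 2 with hd
  have hmin : 0 < min r η := lt_min hr hη
  have hd0 : 0 < d := by positivity
  have hdr : d < r := by linarith [min_le_left r η]
  have hdη : d ≤ η := by linarith [min_le_right r η]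
  set c := d * (r ^ 2 / (L - w 0) ^ 2)
  have hw0 : w 0 ≤ 0 := H.width_nonpos hν _
  have hLw : 0 < L - w 0 := by linarith [H.pos]
  have hc : 0 < c := by positivity
  have hgrow : ∀ n : ℕ, w 0 + n * c ≤ w n := by
    intro n
    induction n with
    | zero => simp
    | succ n ih =>
      obtain ⟨p, hp, hseg, hnorm⟩ := hx n (hno n) (hno (n + 1))
      -- Within distance `r` of the target the breaching point is nearer than η, so a full step of
      -- length η towards it does not fit.
      have hfar : r ≤ ‖x n - proj T (x n)‖ := by
        by_contra! h
        have h1 : ‖x n - x (n + 1)‖ ≤ ‖x n - p‖ := by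
          have := norm_sub_add_norm_sub_of_mem_segment hseg
          linarith [norm_nonneg (x (n + 1) - p)]
        rcases hp with hp | hp
        · linarith [hn₁ _ (hno n) (h.trans_le (min_le_left _ _)) p hp]
        · linarith [hn₂ _ (hno n) (h.trans_le (min_le_right _ _)) p hp]
      have hnc : 0 ≤ n * c := by positivity
      have := H.width_gain_of_heading hν (hno n) hp hd0 hdr hfar (w₀ := w 0) (by
        change w 0 ≤ w n; linarith) hseg (hno (n + 1)) (hnorm ▸ hdη)
      change w n + c ≤ w (n + 1) at this
      push_cast; linarith
  obtain ⟨n, hn⟩ := exists_nat_gt (-w 0 / c)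
  rw [div_lt_iff₀ hc] at hn
  have h1 := hgrow n
  have h2 : w n ≤ 0 := H.width_nonpos hν _
  linarith

/-- The bound `M` on the control is independent of ν, so the strategy of a slower speed may be
played by a faster intruder. -/
theorem le_payoff_of_intruderStar (H : IsBoundaryCurve T L γ) (hν : ν ∈ Ioc (0 : ℝ) 1)
    (hcase : ν < 1 ∨ StrictConvex ℝ T) {s₀ : ℝ} {x₀ : Plane} (hx₀ : x₀ ∉ T)
    (hV : 0 < V T L γ ν s₀ x₀) {τ : ℝ} (hτ : 0 < τ) (hτV : 2 * τ < V T L γ ν s₀ x₀)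
    {ω : ℝ → ℝ} {u : ℝ → Plane} (hω : IsDefenderControl ω) (hu : Measurable u) {M : ℝ}
    (hM : ∀ t, ‖u t‖ ≤ M) (hfol : IntruderFollows (intruderStar T L γ ν) τ s₀ x₀ ω u) :
    V T L γ ν s₀ x₀ - 2 * τ ≤ payoff T L γ s₀ x₀ ω u := by
  set s := defenderPos s₀ ω with hs
  set x := intruderPos x₀ u with hx
  -- At nonnegative times the control is prescribed by the strategy, hence bounded by ν.
  have huν : ∀ t, 0 ≤ t → ‖u t‖ ≤ ν := by
    intro t ht
    have h1 : (⌊t / τ⌋₊ : ℝ) * τ ≤ t := by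
      rw [← le_div_iff₀ hτ]; exact Nat.floor_le (div_nonneg ht hτ.le)
    have h2 : t < (⌊t / τ⌋₊ + 1) * τ := by
      rw [← div_lt_iff₀ hτ]; exact Nat.lt_floor_add_one _
    rw [hfol _ t ⟨h1, h2⟩]
    exact norm_intruderStar_le hν.1.le _ _
  have hhead : ∀ (n : ℕ) (t : ℝ), t ≤ (n + 1) * τ → x (n * τ) ∉ T →
      (∀ r ∈ Ico (n * τ) t, x r ∉ T) → ∃ p, (∀ r ∈ Icc (n * τ) t,
        x r ∈ segment ℝ (x (n * τ)) p ∧ ‖x (n * τ) - x r‖ = ν * (r - n * τ)) ∧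
      ((InLeftRegion T L γ ν (s (n * τ)) (x (n * τ)) ∧ IsBest T γ ν (x (n * τ)) p) ∨
        (¬ InLeftRegion T L γ ν (s (n * τ)) (x (n * τ)) ∧
          IsBest T (fun s => γ (-s)) ν (x (n * τ)) p)) := by
    intro n t ht hxn hout
    obtain ⟨p, hpu, hp⟩ := H.intruderStar_cases hν hxn (s (n * τ))
    have hpT : p ∈ T := by rcases hp with hp | hp <;> exact hp.2.1.1
    refine ⟨p, mem_segment_of_heading hν.1 hpT hxn (fun r hr => ?_) hout, hp⟩
    rw [← hpu]
    exact intruderPos_of_const hu hM x₀ hr.1 fun r' hr' =>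
      hfol n r' ⟨hr'.1, hr'.2.trans_le (hr.2.trans ht)⟩
  have hne : (targetTimes T x₀ u).Nonempty := by
    by_contra hno
    have hout : ∀ t, 0 ≤ t → x t ∉ T := fun t ht h => hno ⟨t, ht, h⟩
    obtain ⟨n, hn⟩ := H.exists_mem_of_heading hν hcase (mul_pos hν.1 hτ)
      (x := fun n : ℕ => x (n * τ)) fun n _ _ => by
        have hn0 : 0 ≤ n * τ := by positivity
        obtain ⟨p, hp, hp'⟩ := hhead n ((n + 1) * τ) le_rfl (hout _ hn0) fun r hr =>
          hout r (hn0.trans hr.1)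
        have h1 := hp ((n + 1) * τ) ⟨by nlinarith, le_rfl⟩
        refine ⟨p, hp'.imp And.right And.right, ?_⟩
        push_cast
        exact ⟨h1.1, by rw [h1.2]; ring⟩
    exact hout _ (by positivity) hn
  obtain ⟨hb0, hbf, hout⟩ := H.breach_spec hx₀ hu hM hne
  set b := breachTime T x₀ u with hb
  obtain ⟨θ₀, hθ₀, hg1, hg2⟩ := H.exists_gap_of_value_pos hν hx₀ hV
  have hx0 : x 0 = x₀ := intruderPos_zero x₀ u
  have hs0 : s 0 = s₀ := defenderPos_zero s₀ ω
  obtain ⟨Θ, hΘ, hΘ0⟩ := H.exists_track hν.1.le hb0 (x := x)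
    (fun s hs t ht => norm_intruderPos_sub_le hu hM huν x₀ hs.1 ht.1) hout
    hbf.2 (θ₀ := θ₀) (by rw [hx0, hθ₀])
  have hbT : x b ∈ T := H.isClosed.frontier_subset hbf
  set c := V T L γ ν s₀ x₀ with hc
  have inv : ∀ t ∈ Icc 0 b, c - 2 * τ ≤ s t - (Θ t - pot T (fun s => γ (-s)) ν (x t)) ∧
      c - 2 * τ ≤ Θ t + pot T γ ν (x t) + L - s t ∧ 2 * c ≤ L + width T γ ν (x t) := by
    intro t ht
    refine forall_of_sampling (P := fun t => c - 2 * τ ≤ s t - (Θ t -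
      pot T (fun s => γ (-s)) ν (x t)) ∧ c - 2 * τ ≤ Θ t + pot T γ ν (x t) + L - s t ∧
      2 * c ≤ L + width T γ ν (x t)) hτ ?_ (fun n hn ih t ht htb => ?_) ht
    · rw [hs0, hx0, hΘ0]
      have h1 := (H.value_of_gap hν hx₀ hθ₀ hg1 hg2).1
      rw [← hc] at h1
      have h2 := h1.le.trans (min_le_left _ _)
      have h3 := h1.le.trans (min_le_right _ _)
      rw [width]
      exact ⟨by linarith, by linarith, by linarith⟩
    · rcases hn.eq_or_lt with h | h
      · have : t = n * τ := le_antisymm (h ▸ htb) ht.1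
        rw [this]; exact ih
      have hn0 : 0 ≤ n * τ := by positivity
      have hxn := hout _ ⟨hn0, h⟩
      have htτ : t - n * τ ≤ τ := by linarith [ht.2]
      have hst : |s t - s (n * τ)| ≤ t - n * τ := by
        have := abs_defenderPos_sub_le hω s₀ (n * τ) t
        rwa [abs_of_nonneg (sub_nonneg.2 ht.1)] at this
      obtain ⟨-, hl, hr⟩ := H.value_of_gap hν hxn (hΘ.lift _ ⟨hn0, hn⟩) (sD := s (n * τ))
        (by linarith) (by linarith)
      obtain ⟨p, hseg, ⟨hcl, hp⟩ | ⟨hcr, hp⟩⟩ := hhead n t ht.2 hxn fun r hr =>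
        hout r ⟨hn0.trans hr.1, hr.2.trans_le htb⟩
      · exact H.le_step_of_heading hν hΘ hn0 ht.1 htb htτ hxn hp hseg hst (hl hcl) ih.2.1 ih.2.2
      -- For the reversed curve with defender L − s, the two distances trade places.
      · have := H.rev.le_step_of_heading hν hΘ.rev (s := fun t => L - s t) (c := c) hn0 ht.1 htb
          htτ hxn hp hseg (by rw [sub_sub_sub_cancel_left, abs_sub_comm]; exact hst)
          (by simp only [neg_neg]; linarith [hr hcr]) (by linarith [ih.1])
          (by rw [width_rev]; exact ih.2.2)
        rw [width_rev] at this
        simp only [neg_neg] at this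
        exact ⟨by linarith [this.2.1], by linarith [this.1], this.2.2⟩
  have hΘb : γ (Θ b) = x b := by rw [hΘ.lift b ⟨hb0, le_rfl⟩, H.proj_of_mem hbT]
  obtain ⟨i1, i2, -⟩ := inv b ⟨hb0, le_rfl⟩
  rw [pot, if_pos hbT] at i1 i2
  rw [H.payoff_eq hne hΘb]
  have e1 : arc L (Θ b) (s b) = s b + (0 : ℤ) * L - Θ b := arc_eq H.pos 0 (by
    push_cast; constructor <;> linarith)
  have e2 : arc L (s b) (Θ b) = Θ b + (1 : ℤ) * L - s b := arc_eq H.pos 1 (by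
    push_cast; constructor <;> linarith)
  push_cast at e1 e2
  exact le_min (by rw [e2]; linarith) (by rw [e1]; linarith)

/-- The strategy uses speed ν, the game allows ν'; the difference is needed to approximate speed 1.
-/
theorem intruderStar_guarantees (H : IsBoundaryCurve T L γ) {ν' : ℝ} (hν : ν ∈ Ioc (0 : ℝ) 1)
    (hνν' : ν ≤ ν') (hcase : ν < 1 ∨ StrictConvex ℝ T) {s₀ : ℝ} {x₀ : Plane} (hx₀ : x₀ ∉ T)
    (hV : 0 < V T L γ ν s₀ x₀) :
    IntruderGuarantees T L γ ν' s₀ x₀ (intruderStar T L γ ν) (V T L γ ν s₀ x₀) := by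
  refine ⟨fun s x => (norm_intruderStar_le hν.1.le s x).trans hνν', fun ε hε =>
    ⟨min (ε / 2) (V T L γ ν s₀ x₀ / 2), lt_min (by linarith) (by linarith), ?_⟩⟩
  intro τ hτ ω u hω hu hfol
  have h1 := hτ.2.trans_le (min_le_left _ _)
  have h2 := hτ.2.trans_le (min_le_right _ _)
  have := H.le_payoff_of_intruderStar hν hcase hx₀ hV hτ.1 (by linarith) hω hu.1 hu.2 hfol
  linarith

end IsBoundaryCurve

/-! ### Two strategies against each other -/

/-- The states at the sampling times when both players use sampled feedback strategies. -/
noncomputable def sampledState (σ : ℝ → Plane → ℝ) (μ : ℝ → Plane → Plane) (τ s₀ : ℝ)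
    (x₀ : Plane) : ℕ → ℝ × Plane
  | 0 => (s₀, x₀)
  | n + 1 =>
    let z := sampledState σ μ τ s₀ x₀ n
    (z.1 + τ * σ z.1 z.2, z.2 + τ • μ z.1 z.2)

/-- Both feedbacks sample on the same grid, so the sampled states obey a recursion that determines
piecewise constant controls. -/
theorem exists_joint_play {σ : ℝ → Plane → ℝ} {μ : ℝ → Plane → Plane} (hσ : ∀ s x, |σ s x| ≤ 1)
    (hμ : ∀ s x, ‖μ s x‖ ≤ ν) {τ : ℝ} (hτ : 0 < τ) (s₀ : ℝ) (x₀ : Plane) :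
    ∃ ω u, IsDefenderControl ω ∧ IsIntruderControl ν u ∧ DefenderFollows σ τ s₀ x₀ ω u ∧
      IntruderFollows μ τ s₀ x₀ ω u := by
  set z := sampledState σ μ τ s₀ x₀
  set ω : ℝ → ℝ := fun t => σ (z ⌊t / τ⌋₊).1 (z ⌊t / τ⌋₊).2
  set u : ℝ → Plane := fun t => μ (z ⌊t / τ⌋₊).1 (z ⌊t / τ⌋₊).2
  have hfloor : Measurable fun t : ℝ => ⌊t / τ⌋₊ := Nat.measurable_floor.comp (by fun_prop)
  have hω : IsDefenderControl ω :=
    ⟨(measurable_from_nat (f := fun n => σ (z n).1 (z n).2)).comp hfloor, fun t => hσ _ _⟩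
  have hu : IsIntruderControl ν u :=
    ⟨(measurable_from_nat (f := fun n => μ (z n).1 (z n).2)).comp hfloor, fun t => hμ _ _⟩
  have hk : ∀ k : ℕ, ∀ t ∈ Ico (k * τ) ((k + 1) * τ), ⌊t / τ⌋₊ = k := by
    intro k t ht
    have h0 : 0 ≤ k * τ := by positivity
    rw [Nat.floor_eq_iff (div_nonneg (h0.trans ht.1) hτ.le)]
    exact ⟨(le_div_iff₀ hτ).2 ht.1, (div_lt_iff₀ hτ).2 ht.2⟩
  have hωk : ∀ k : ℕ, ∀ t ∈ Ico (k * τ) ((k + 1) * τ), ω t = σ (z k).1 (z k).2 := by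
    intro k t ht; simp only [ω, hk k t ht]
  have huk : ∀ k : ℕ, ∀ t ∈ Ico (k * τ) ((k + 1) * τ), u t = μ (z k).1 (z k).2 := by
    intro k t ht; simp only [u, hk k t ht]
  have hz : ∀ k : ℕ, defenderPos s₀ ω (k * τ) = (z k).1 ∧ intruderPos x₀ u (k * τ) = (z k).2 := by
    intro k
    induction k with
    | zero => simp [z, sampledState]
    | succ k ih =>
      have hle : k * τ ≤ (k + 1) * τ := by nlinarith
      have hsub : (k + 1) * τ - k * τ = τ := by ring
      push_cast
      rw [defenderPos_of_const hω s₀ hle (hωk k), intruderPos_of_const hu.1 hu.2 x₀ hle (huk k),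
        ih.1, ih.2, hsub]
      exact ⟨rfl, rfl⟩
  exact ⟨ω, u, hω, hu, fun k t ht => by rw [(hz k).1, (hz k).2, hωk k t ht],
    fun k t ht => by rw [(hz k).1, (hz k).2, huk k t ht]⟩

/-- A joint play with small sampling period satisfies both guarantees. -/
theorem IntruderGuarantees.le {σ : ℝ → Plane → ℝ} {μ : ℝ → Plane → Plane} {s₀ c c' : ℝ}
    {x₀ : Plane} (hμ : IntruderGuarantees T L γ ν s₀ x₀ μ c')
    (hσ : DefenderGuarantees T L γ ν s₀ x₀ σ c) : c' ≤ c := by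
  refine le_of_forall_pos_le_add fun ε hε => ?_
  obtain ⟨δ, hδ, h1⟩ := hσ.2 (ε / 2) (by linarith)
  obtain ⟨δ', hδ', h2⟩ := hμ.2 (ε / 2) (by linarith)
  have hm : 0 < min δ δ' := lt_min hδ hδ'
  have hτ : 0 < min δ δ' / 2 := by linarith
  obtain ⟨ω, u, hω, hu, hd, hi⟩ := exists_joint_play hσ.1 hμ.1 hτ s₀ x₀
  have h3 := h1 _ ⟨hτ, by linarith [min_le_left δ δ']⟩ ω u hω hu hd
  have h4 := h2 _ ⟨hτ, by linarith [min_le_right δ δ']⟩ ω u hω hu hi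
  linarith

/-! ### Approximation by slower intruders -/

namespace IsBoundaryCurve

/-- The point optimal at speed ν still competes at speed ν'. -/
theorem pot_sub_le_of_speed (H : IsBoundaryCurve T L γ) {ν' : ℝ} (hν' : ν' ∈ Ioc (0 : ℝ) 1)
    {x p : Plane} (hx : x ∉ T) (hp : IsBest T γ ν x p) :
    pot T γ ν x - ‖x - p‖ * (1 / ν' - 1 / ν) ≤ pot T γ ν' x := by
  obtain ⟨p', hp'⟩ := H.exists_isBest hν' hx
  have h1 := hp'.2 p hp.1
  rw [← hp'.pot_eq hx] at h1
  have h2 := hp.pot_eq hx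
  rw [obj] at h1 h2
  have h3 : ‖x - p‖ * (1 / ν' - 1 / ν) = ‖x - p‖ / ν' - ‖x - p‖ / ν := by ring
  linarith

/-- The value does not jump down if the intruder gets slightly slower. -/
theorem exists_slower (H : IsBoundaryCurve T L γ) {s₀ : ℝ} {x₀ : Plane} (hx₀ : x₀ ∉ T)
    (hV : 0 < V T L γ 1 s₀ x₀) {ε : ℝ} (hε : 0 < ε) :
    ∃ ν' ∈ Ioo (0 : ℝ) 1, 0 < V T L γ ν' s₀ x₀ ∧ V T L γ 1 s₀ x₀ - ε ≤ V T L γ ν' s₀ x₀ := by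
  have h1 : (1 : ℝ) ∈ Ioc (0 : ℝ) 1 := ⟨one_pos, le_rfl⟩
  obtain ⟨θ, hθ, hg1, hg2⟩ := H.exists_gap_of_value_pos h1 hx₀ hV
  have hval := (H.value_of_gap h1 hx₀ hθ hg1 hg2).1
  obtain ⟨p, hp⟩ := H.exists_isBest h1 hx₀
  obtain ⟨q, hq⟩ := H.rev.exists_isBest h1 hx₀
  -- The bound V/2 keeps the value positive, so that the defender remains in the same gap at the
  -- lower speed.
  set e := min ε (V T L γ 1 s₀ x₀ / 2) with he
  have he0 : 0 < e := lt_min hε (by linarith)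
  have hlim : ∀ d : ℝ, ∀ᶠ ν' in nhdsWithin (1 : ℝ) (Iio 1), d * (1 / ν' - 1 / 1) < e := by
    intro d
    have hc : ContinuousAt (fun ν' : ℝ => d * (1 / ν' - 1 / 1)) 1 := by
      have : (1 : ℝ) ≠ 0 := one_ne_zero
      fun_prop (disch := assumption)
    refine (hc.eventually_lt continuousAt_const ?_).filter_mono nhdsWithin_le_nhds
    simpa using he0
  obtain ⟨ν', ⟨e1, e2⟩, hν'⟩ :=
    (((hlim ‖x₀ - p‖).and (hlim ‖x₀ - q‖)).and (Ioo_mem_nhdsLT one_pos)).exists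
  have hν'' : ν' ∈ Ioc (0 : ℝ) 1 := ⟨hν'.1, hν'.2.le⟩
  have p1 := H.pot_sub_le_of_speed hν'' hx₀ hp
  have p2 := H.rev.pot_sub_le_of_speed hν'' hx₀ hq
  have v1 := hval.le.trans (min_le_left _ _)
  have v2 := hval.le.trans (min_le_right _ _)
  have eV := min_le_right ε (V T L γ 1 s₀ x₀ / 2)
  have eε := min_le_left ε (V T L γ 1 s₀ x₀ / 2)
  rw [← he] at eV eε
  have hval' := (H.value_of_gap hν'' hx₀ hθ (sD := s₀) (by linarith) (by linarith)).1
  refine ⟨ν', hν', ?_, ?_⟩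
  · rw [hval']; exact lt_min (by linarith) (by linarith)
  · rw [hval']; exact le_min (by linarith) (by linarith)

theorem exists_intruderGuarantees (H : IsBoundaryCurve T L γ) (hν : ν ∈ Ioc (0 : ℝ) 1) {s₀ : ℝ}
    {x₀ : Plane} (hx₀ : x₀ ∉ T) (hV : 0 < V T L γ ν s₀ x₀) {ε : ℝ} (hε : 0 < ε) :
    ∃ μ c, IntruderGuarantees T L γ ν s₀ x₀ μ c ∧ V T L γ ν s₀ x₀ - ε ≤ c := by
  rcases hν.2.lt_or_eq with h | rfl
  · exact ⟨_, _, H.intruderStar_guarantees hν le_rfl (Or.inl h) hx₀ hV, by linarith⟩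
  · obtain ⟨ν', hν', hV', hle⟩ := H.exists_slower hx₀ hV hε
    exact ⟨_, _, H.intruderStar_guarantees ⟨hν'.1, hν'.2.le⟩ hν'.2.le (Or.inl hν'.2) hx₀ hV', hle⟩

end IsBoundaryCurve
end PerimeterDefense

/-! ### The saddle point and the value of the game -/

theorem mainTheorem2 (T : Set PerimeterDefense.Plane) (hconv : Convex ℝ T) (hcomp : IsCompact T)
    (hint : (interior T).Nonempty) (L : ℝ) (γ : ℝ → PerimeterDefense.Plane)
    (hγ : PerimeterDefense.IsPerimeter T L γ) (ν : ℝ) (hν : ν ∈ Set.Ioc (0 : ℝ) 1)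
    (sD : ℝ) (xA : PerimeterDefense.Plane) (hxA : xA ∉ T)
    (hV : 0 < PerimeterDefense.V T L γ ν sD xA) :
    -- the defender strategy keeps the payoff at most `V` against every intruder
    PerimeterDefense.DefenderGuarantees T L γ ν sD xA (PerimeterDefense.defenderStar T L γ ν)
      (PerimeterDefense.V T L γ ν sD xA) ∧
    -- the intruder strategy secures at least `V` against every defender
    ((ν < 1 ∨ StrictConvex ℝ T) →
      PerimeterDefense.IntruderGuarantees T L γ ν sD xA (PerimeterDefense.intruderStar T L γ ν)
        (PerimeterDefense.V T L γ ν sD xA)) ∧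
    -- `V` is the upper value and the lower value of the game
    IsLeast {c | ∃ σ, PerimeterDefense.DefenderGuarantees T L γ ν sD xA σ c}
      (PerimeterDefense.V T L γ ν sD xA) ∧
    IsLUB {c | ∃ μ, PerimeterDefense.IntruderGuarantees T L γ ν sD xA μ c}
      (PerimeterDefense.V T L γ ν sD xA) := by
  have H : PerimeterDefense.IsBoundaryCurve T L γ :=
    ⟨hconv, hcomp, hint, hγ.pos, hγ.periodic, hγ.injOn, hγ.image_eq, hγ.unitSpeed⟩
  have hdef := H.defenderStar_guarantees hν hxA hV.le
  refine ⟨hdef, fun hcase => H.intruderStar_guarantees hν le_rfl hcase hxA hV,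
    ⟨⟨_, hdef⟩, ?_⟩, ?_, fun c hc => ?_⟩
  · rintro c ⟨σ, hσ⟩
    refine le_of_forall_pos_le_add fun ε hε => ?_
    obtain ⟨μ, c', hμ, hle⟩ := H.exists_intruderGuarantees hν hxA hV hε
    linarith [hμ.le hσ]
  · rintro c ⟨μ, hμ⟩
    exact hμ.le hdef
  · refine le_of_forall_pos_le_add fun ε hε => ?_
    obtain ⟨μ, c', hμ, hle⟩ := H.exists_intruderGuarantees hν hxA hV hε
    linarith [hc ⟨μ, hμ⟩]
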